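/- **Theorem ($d_l=6$, $g=6$).** All graphs are finite Tanner graphs $G=(L\cup R,E)$ without parallel edges ($L$: variable nodes, $R$: check nodes) that are left-regular of left degree $6$ (every variable node has degree $6$) and have girth $6$. *Definitions.* For $\mathcal S\subset L$ let $\Gamma(\mathcal S)\subset R$ be its set of neighbours and $G(\mathcal S)$ the subgraph with nodes $\mathcal S\cup\Gamma(\mathcal S)$ and all edges between $\mathcal S$ and $\Gamma(\mathcal S)$. A check node in $\Gamma(\mathcal S)$ is *satisfied* if its degree in $G(\mathcal S)$ is even, *unsatisfied* if it is odd. $\mathcal S$ is an $(a,b)$ *trapping set* if $|\mathcal S|=a$ and it has exactly $b$ unsatisfied check nodes; it is *elementary* (an ETS) if all check nodes of $G(\mathcal S)$ have degree $1$ or $2$; it is an *absorbing set* if every node of $\mathcal S$ has more satisfied than unsatisfied neighbours. $\mathcal T$ is the set of trapping sets $\mathcal S$ for which $G(\mathcal S)$ is connected and every node of $\mathcal S$ has at least two satisfied neighbours. Two ETSs (possibly in different graphs) have the same *structure* if their graphs $G(\mathcal S)$ are isomorphic. An ETS $\mathcal S\in\mathcal T$ is a *layered superset* (LSS) of $C\subseteq\mathcal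 S$ if there is a sequence $C=\mathcal S^{(0)}\subset\mathcal S^{(1)}\subset\dots\subset\mathcal S^{(n)}=\mathcal S$ of ETSs in $\mathcal T$ with $|\mathcal S^{(i)}|=|C|+i$. $\mathcal S$ is an LSS of an $x$-cycle if it is an LSS of the set of variable nodes of some cycle of length $x$; it is an $\mathrm{LSS}_x$ structure if $x$ is the least length for which this holds, and it is labelled NA (it fails the LSS property) if there is no such $x$. *Claim.* 1. For all $0\le a\le 9$ and $0\le b\le 10$, the numbers of non-isomorphic structures of $(a,b)$ ETSs in $\mathcal T$ (row TS), and of those that are absorbing sets (row AS), are as follows. Classes that are not listed (in particular all those with $b$ odd or $a\le 4$) are empty. All counted structures are $\mathrm{LSS}_6$ structures, except where stated. | class $(a,b)$ | (5,10) | (6,6) | (6,8) | (6,10) | (7,0) | (7,2) | (7,4) | (7,6) | (7,8) | (7,10) | |---|---|---|---|---|---|---|---|---|---|---| | TS | 1 | 1 | 1 | 2 | 1 | 1 | 2 | 5 | 10 | 20 | | AS | 1 | 1 | 1 | 1 | 1 | 1 | 2 | 4 | 6 | 7 | | class $(a,b)$ | (8,0) | (8,2) | (8,4) | (8,6) | (8,8)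 | (8,10) | |---|---|---|---|---|---|---| | TS | 1 | 3 | 15 | 48 | 120 | 260 | | AS | 1 | 3 | 12 | 32 | 60 | 76 | | class $(a,b)$ | (9,0) | (9,2) | (9,4) | (9,6) | (9,8) | (9,10) | |---|---|---|---|---|---|---| | TS | 4 | 25 | 162 | 726 | $\mathrm{LSS}_6$: 2273, $\mathrm{LSS}_{10}$: 1 | $\mathrm{LSS}_6$: 5406, $\mathrm{LSS}_8$: 2, $\mathrm{LSS}_{10}$: 2, NA: 1 | | AS | 4 | 25 | 146 | 525 | 1157 | 1620 | 2. Every $(a,b)$ ETS in $\mathcal T$ with $a\le 9$ and $b\le 10$ that is an absorbing set is an LSS of a $6$-cycle. 3. There are exactly $5411$ non-isomorphic structures of $(9,10)$ ETSs in $\mathcal T$, and exactly one of them fails the LSS property. -/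

import Mathlib

/-- A Tanner graph without parallel edges, with set of variable nodes `L` and set of check
nodes `R`: `Adj v c` says that the variable node `v` and the check node `c` are joined. -/
structure TannerGraph (L R : Type*) where
  Adj : L → R → Prop

namespace TannerGraph

variable {L R : Type*} (G : TannerGraph L R)

/-- The Tanner graph as a bipartite simple graph on `L ⊕ R`. -/
def graph : SimpleGraph (L ⊕ R) :=
  SimpleGraph.fromRel fun p q => ∃ v c, p = Sum.inl v ∧ q = Sum.inr c ∧ G.Adj v c

/-- Every variable node has degree `d`. -/
def LeftRegular (d : ℕ) : Prop := ∀ v : L, {c | G.Adj v c}.ncard = d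

/-- `Γ(S)`: the check nodes that have a neighbour in `S`. -/
def neighbors (S : Set L) : Set R := {c | ∃ v ∈ S, G.Adj v c}

/-- The degree of the check node `c` in the subgraph induced by `S`. -/
noncomputable def checkDegree (S : Set L) (c : R) : ℕ := {v | v ∈ S ∧ G.Adj v c}.ncard

/-- `Γₒ(S)`: the unsatisfied check nodes. -/
def unsatisfied (S : Set L) : Set R := {c | c ∈ G.neighbors S ∧ Odd (G.checkDegree S c)}

/-- `Γₑ(S)`: the satisfied check nodes. -/
def satisfied (S : Set L) : Set R := {c | c ∈ G.neighbors S ∧ Even (G.checkDegree S c)}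

/-- The node set `S ∪ Γ(S)`. -/
def inducedNodes (S : Set L) : Set (L ⊕ R) := Sum.inl '' S ∪ Sum.inr '' G.neighbors S

/-- `G(S)`: the subgraph with nodes `S ∪ Γ(S)` and all edges between `S` and `Γ(S)`. -/
def inducedSubgraph (S : Set L) : SimpleGraph (G.inducedNodes S) :=
  G.graph.induce (G.inducedNodes S)

/-- `S` is an `(a, b)` trapping set. -/
def IsTrappingSet (a b : ℕ) (S : Set L) : Prop :=
  S.ncard = a ∧ (G.unsatisfied S).ncard = b

/-- All check nodes of `G(S)` have degree one or two. -/
def IsElementary (S : Set L) : Prop :=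
  ∀ c ∈ G.neighbors S, G.checkDegree S c = 1 ∨ G.checkDegree S c = 2

/-- Every node of `S` has more satisfied than unsatisfied neighbours. -/
def IsAbsorbing (S : Set L) : Prop :=
  ∀ v ∈ S, {c | G.Adj v c ∧ c ∈ G.unsatisfied S}.ncard <
    {c | G.Adj v c ∧ c ∈ G.satisfied S}.ncard

/-- Membership in `𝒯`: `G(S)` is connected and every node of `S` is joined to at least two
satisfied check nodes. -/
def InT (S : Set L) : Prop :=
  (G.inducedSubgraph S).Connected ∧
    ∀ v ∈ S, 2 ≤ {c | G.Adj v c ∧ c ∈ G.satisfied S}.ncard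

/-- `S` is a layered superset of `C`: there is a nested sequence of elementary trapping sets
in `𝒯` from `C` to `S` whose sizes grow by one at each step. (For `C = S` the sequence is
trivial.) -/
def IsLayeredSuperset (C S : Set L) : Prop :=
  ∃ (n : ℕ) (T : ℕ → Set L), T 0 = C ∧ T n = S ∧ (∀ i < n, T i ⊂ T (i + 1)) ∧
    ∀ i ≤ n, G.IsElementary (T i) ∧ G.InT (T i) ∧ (T i).ncard = C.ncard + i

/-- `C` is the set of variable nodes of a cycle of length `x`. -/
def IsCycleSet (x : ℕ) (C : Set L) : Prop :=
  ∃ (u : L ⊕ R) (p : G.graph.Walk u u),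
    p.IsCycle ∧ p.length = x ∧ C = {v | Sum.inl v ∈ p.support}

/-- `S` is a layered superset of one of its cycles of length `x`. -/
def IsLSSOfCycle (x : ℕ) (S : Set L) : Prop :=
  ∃ C, G.IsCycleSet x C ∧ G.IsLayeredSuperset C S

/-- The `x` for which `S` is an `LSS_x` structure: the least length of a cycle of which `S` is
a layered superset. It is `⊤` (the label NA) if there is no such cycle. -/
noncomputable def lssType (S : Set L) : ℕ∞ :=
  ⨅ (x : ℕ) (_ : G.IsLSSOfCycle x S), (x : ℕ∞)

/-- `G` is left-regular with left degree `d` and girth `g`, and `S` is an `(a, b)` elementary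
trapping set of `G` in `𝒯`. -/
def IsETSIn (d g a b : ℕ) (S : Set L) : Prop :=
  G.LeftRegular d ∧ G.graph.girth = g ∧
    G.IsTrappingSet a b S ∧ G.IsElementary S ∧ G.InT S

end TannerGraph

/-- A finite Tanner graph with a chosen set of variable nodes. -/
structure MarkedTannerGraph where
  L : Type
  R : Type
  finite_left : Finite L
  finite_right : Finite R
  G : TannerGraph L R
  S : Set L

/-- Two marked Tanner graphs have the same structure if the subgraphs induced by their chosen
sets are isomorphic graphs. -/
instance structureSetoid : Setoid MarkedTannerGraph where
  r X Y := Nonempty (X.G.inducedSubgraph X.S ≃g Y.G.inducedSubgraph Y.S)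
  iseqv :=
    { refl := fun _ => ⟨SimpleGraph.Iso.refl⟩
      symm := fun ⟨e⟩ => ⟨e.symm⟩
      trans := fun ⟨e⟩ ⟨f⟩ => ⟨f.comp e⟩ }

/-- The number of non-isomorphic structures that occur among the marked Tanner graphs with the
property `P` (`⊤` if there are infinitely many). -/
noncomputable def structureCount (P : MarkedTannerGraph → Prop) : ℕ∞ :=
  ((fun X => (Quotient.mk structureSetoid X)) '' {X | P X}).encard

/-- For `d_l = 6`, `g = 6`: the multiplicities of the non-isomorphic `LSS_x` structures of the
`(a, b)` elementary trapping sets in `𝒯`, as a list of pairs `(x, multiplicity)`. -/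
def trappingTable (a b : ℕ) : List (ℕ∞ × ℕ) :=
  match a, b with
  | 5, 10 => [(6, 1)]
  | 6, 6 => [(6, 1)]
  | 6, 8 => [(6, 1)]
  | 6, 10 => [(6, 2)]
  | 7, 0 => [(6, 1)]
  | 7, 2 => [(6, 1)]
  | 7, 4 => [(6, 2)]
  | 7, 6 => [(6, 5)]
  | 7, 8 => [(6, 10)]
  | 7, 10 => [(6, 20)]
  | 8, 0 => [(6, 1)]
  | 8, 2 => [(6, 3)]
  | 8, 4 => [(6, 15)]
  | 8, 6 => [(6, 48)]
  | 8, 8 => [(6, 120)]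
  | 8, 10 => [(6, 260)]
  | 9, 0 => [(6, 4)]
  | 9, 2 => [(6, 25)]
  | 9, 4 => [(6, 162)]
  | 9, 6 => [(6, 726)]
  | 9, 8 => [(6, 2273), (10, 1)]
  | 9, 10 => [(6, 5406), (8, 2), (10, 2), (⊤, 1)]
  | _, _ => []

/-- The same for those structures that are absorbing sets. -/
def absorbingTable (a b : ℕ) : List (ℕ∞ × ℕ) :=
  match a, b with
  | 5, 10 => [(6, 1)]
  | 6, 6 => [(6, 1)]
  | 6, 8 => [(6, 1)]
  | 6, 10 => [(6, 1)]
  | 7, 0 => [(6, 1)]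
  | 7, 2 => [(6, 1)]
  | 7, 4 => [(6, 2)]
  | 7, 6 => [(6, 4)]
  | 7, 8 => [(6, 6)]
  | 7, 10 => [(6, 7)]
  | 8, 0 => [(6, 1)]
  | 8, 2 => [(6, 3)]
  | 8, 4 => [(6, 12)]
  | 8, 6 => [(6, 32)]
  | 8, 8 => [(6, 60)]
  | 8, 10 => [(6, 76)]
  | 9, 0 => [(6, 4)]
  | 9, 2 => [(6, 25)]
  | 9, 4 => [(6, 146)]
  | 9, 6 => [(6, 525)]
  | 9, 8 => [(6, 1157)]
  | 9, 10 => [(6, 1620)]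
  | _, _ => []

/-- The multiplicity listed for the label `x`, zero if `x` is not listed. -/
def listedCount (t : List (ℕ∞ × ℕ)) (x : ℕ∞) : ℕ := (t.lookup x).getD 0

/-! Girth 6 forbids 4-cycles, so two variable nodes share at most one check node. An elementary
trapping set `S` is therefore encoded by its normal graph: the simple graph on `S` in which two
nodes are adjacent if they share a check node. Its edges are the satisfied checks, and a node of
degree `d` carries `6 - d` unsatisfied checks. Hence `b + 2m = 6a` for `m` edges. Membership in `𝒯`
gives degrees between 2 and 6, and absorbing means degrees at least 4. Two trapping sets have the
same structure exactly if their normal graphs are isomorphic (`nonempty_normalGraph_iso`,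
`nonempty_inducedSubgraph_iso`). Conversely every graph with 5 to 9 vertices, these degrees and at
least `3a - 5` edges is realised (`isETSIn_ofGraph`), since such density forces connectedness and a
triangle, hence girth 6.

The totals are thus numbers of isomorphism classes of graphs with prescribed degree range and edge
number. Burnside's lemma gives them (`sum_card_relabel_eq_self`): one permutation per cycle type
suffices, and the graphs fixed by it are the unions of its orbits on vertex pairs. These unions are
enumerated by a sparse generating function. Its keys hold the degrees of one vertex per cycle as
base 64 digits, and its coefficients count edges in powers of `2 ^ 64`. All edge numbers are then
read off as digits of one number.

A cycle of length `2k` in the Tanner graph is a `k`-cycle of the normal graph, and one layer of a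
layered superset adds a vertex with at least two neighbours in the set already reached
(`isLSSOfCycle_iff`). By Turán's theorem the graphs in question contain a triangle. If growth from
it stops at a proper subset `T`, counting edges leaves only 9 vertices with `T` of size 3 or 7
(`card_of_isGrowthClosed`), and size 3 leads to another closed set of size 7
(`exists_isGrowthClosed_seven`). The two vertices outside such a set are adjacent, of degree 2, with
one neighbour each in the set, which spans a complete graph on seven vertices minus one or two
edges. Up to isomorphism six graphs remain. A cycle from which one of them grows must contain the
two outer vertices and their neighbours `x`, `y`. It has length 4 if `x`, `y` are adjacent and 5 if
they are distinct and not adjacent. For `x = y` it would be a triangle that cannot grow, which gives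
the NA structure. Degrees of at least 4 exclude all six. -/

/-! ### Sparse generating functions and their dual operators. -/

/-- Sparse formal sums of keys with natural coefficients. -/
inductive KeySum where
  | nil : KeySum
  | cons (k v : ℕ) (t : KeySum) : KeySum

namespace KeySum

/-- The value of the linear extension of `f` at a formal sum. -/
def eval (f : ℕ → ℕ) : KeySum → ℕ
  | nil => 0
  | cons k v t => v * f k + eval f t

/-- `A + c • (B shifted by w)`, merging terms as in the merge of sorted lists. -/
noncomputable def mergeShift (w c : ℕ) (A : KeySum) : KeySum → KeySum :=
  KeySum.rec (motive := fun _ => KeySum → KeySum)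
    (fun B => KeySum.rec (motive := fun _ => KeySum) nil
      (fun k v _ ih => cons (Nat.add k w) (Nat.mul v c) ih) B)
    (fun k v t ih B => KeySum.rec (motive := fun _ => KeySum) (cons k v t)
      (fun k' v' t' ih' =>
        Bool.rec (motive := fun _ => KeySum)
          (cons (Nat.add k' w) (Nat.mul v' c) ih')
          (Bool.rec (motive := fun _ => KeySum)
            (cons k v (ih (cons k' v' t')))
            (cons k (Nat.add v (Nat.mul v' c)) (ih t'))
            (Nat.beq k (Nat.add k' w)))
          (Nat.ble k (Nat.add k' w))) B) A

/-- No sortedness is needed: an unsorted list would only leave like keys unmerged, which makes the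
result longer but does not change its value. -/
theorem eval_mergeShift (f : ℕ → ℕ) (w c : ℕ) (A B : KeySum) :
    eval f (mergeShift w c A B) = eval f A + c * eval (fun k => f (k + w)) B := by
  induction A generalizing B with
  | nil =>
    induction B with
    | nil => simp [mergeShift, eval]
    | cons k v t ih =>
      change (v * c) * f (k + w) + eval f (mergeShift w c nil t) = _
      rw [ih]; simp only [eval]; ring
  | cons k v t ih =>
    induction B with
    | nil => simp [mergeShift, eval]
    | cons k' v' t' ih' =>
      have key : mergeShift w c (cons k v t) (cons k' v' t') =
        Bool.rec (motive := fun _ => KeySum)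
          (cons (k' + w) (v' * c) (mergeShift w c (cons k v t) t'))
          (Bool.rec (motive := fun _ => KeySum)
            (cons k v (mergeShift w c t (cons k' v' t')))
            (cons k (v + v' * c) (mergeShift w c t t'))
            (Nat.beq k (k' + w)))
          (Nat.ble k (k' + w)) := rfl
      rw [key]
      cases Nat.ble k (k' + w) with
      | false => simp only [eval] at ih' ⊢; rw [ih']; ring
      | true =>
        cases hb : Nat.beq k (k' + w) with
        | false => simp only [eval] at ih ⊢; rw [ih]; simp only [eval]; ring
        | true =>
          have := Nat.eq_of_beq_eq_true hb
          simp only [eval] at ih ⊢; rw [ih, this]; ring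

/-- The test `lo ≤ d ≤ hi`. -/
def inRange (lo hi d : ℕ) : Bool := and (Nat.ble lo d) (Nat.ble d hi)

/-- Keep the terms whose lowest digit lies in the range, and remove that digit. -/
noncomputable def siftAux (lo hi : ℕ) (A : KeySum) : ℕ → ℕ → KeySum :=
  KeySum.rec (motive := fun _ => ℕ → ℕ → KeySum)
    (fun ck cv => cons ck cv nil)
    (fun k v _ ih ck cv => Bool.rec (motive := fun _ => KeySum)
      (ih ck cv)
      (Bool.rec (motive := fun _ => KeySum)
        (cons ck cv (ih (Nat.div k 64) v))
        (ih ck (Nat.add cv v))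
        (Nat.beq (Nat.div k 64) ck))
      (inRange lo hi (Nat.mod k 64))) A

/-- The pair `ck`, `cv` is a pending term that absorbs following terms with the same key. A run that
starts from `0 0` therefore only adds a term with coefficient zero. -/
theorem eval_siftAux (f : ℕ → ℕ) (lo hi : ℕ) (A : KeySum) (ck cv : ℕ) :
    eval f (siftAux lo hi A ck cv) = cv * f ck +
      eval (fun k => if inRange lo hi (k % 64) then f (k / 64) else 0) A := by
  induction A generalizing ck cv with
  | nil => simp [siftAux, eval]
  | cons k v t ih =>
    have key : siftAux lo hi (cons k v t) ck cv = Bool.rec (motive := fun _ => KeySum)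
      (siftAux lo hi t ck cv)
      (Bool.rec (motive := fun _ => KeySum)
        (cons ck cv (siftAux lo hi t (k / 64) v))
        (siftAux lo hi t ck (cv + v))
        (Nat.beq (k / 64) ck))
      (inRange lo hi (k % 64)) := rfl
    rw [key]
    cases h : inRange lo hi (k % 64) with
    | false => simp only [eval]; rw [ih, h]; simp
    | true =>
      cases hb : Nat.beq (k / 64) ck with
      | false => simp only [eval, h, if_true]; rw [ih]
      | true =>
        have := Nat.eq_of_beq_eq_true hb
        simp only [eval, h, if_true]; rw [ih, this]; ring

/-- Multiply a formal sum by `∏ (1 + c • shift w)`. -/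
noncomputable def mulShifts (g : List (ℕ × ℕ)) : KeySum → KeySum :=
  List.rec (motive := fun _ => KeySum → KeySum) (fun A => A)
    (fun p _ ih A => ih (mergeShift p.1 p.2 A A)) g

/-- Process the groups of shifts one after the other, testing one digit after each group. -/
noncomputable def process (lo hi : ℕ) (gs : List (List (ℕ × ℕ))) : KeySum → KeySum :=
  List.rec (motive := fun _ => KeySum → KeySum) (fun A => A)
    (fun g _ ih A => ih (siftAux lo hi (mulShifts g A) 0 0)) gs

/-- The sum of the coefficients. -/
noncomputable def total (A : KeySum) : ℕ :=
  KeySum.rec (motive := fun _ => ℕ) 0 (fun _ v _ ih => Nat.add v ih) A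

theorem total_eq_eval (A : KeySum) : total A = eval (fun _ => 1) A := by
  induction A with
  | nil => rfl
  | cons k v t ih => simp only [eval, mul_one]; rw [← ih]; rfl

end KeySum

/-- The linear operator dual to `KeySum.mulShifts`. -/
def shiftSum (F : ℕ → ℕ) : List (ℕ × ℕ) → ℕ → ℕ
  | [], k => F k
  | p :: g, k => shiftSum F g k + p.2 * shiftSum F g (k + p.1)

/-- The operator dual to `KeySum.process`. -/
def digitSum (lo hi : ℕ) : List (List (ℕ × ℕ)) → ℕ → ℕ
  | [], _ => 1
  | g :: gs, k =>
    shiftSum (fun k => if KeySum.inRange lo hi (k % 64) then digitSum lo hi gs (k / 64) else 0) g k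

namespace KeySum

theorem eval_add_mul (f g : ℕ → ℕ) (c : ℕ) (A : KeySum) :
    eval (fun k => f k + c * g k) A = eval f A + c * eval g A := by
  induction A with
  | nil => simp [eval]
  | cons k v t ih => simp only [eval, ih]; ring

/-- Evaluation pairs functions with formal sums, and `shiftSum` is the adjoint of multiplication.
Statements about the computed list thereby become recursions for functions on keys. -/
theorem eval_mulShifts (f : ℕ → ℕ) (g : List (ℕ × ℕ)) (A : KeySum) :
    eval f (mulShifts g A) = eval (shiftSum f g) A := by
  induction g generalizing A with
  | nil => rfl
  | cons p g ih =>
    change eval f (mulShifts g (mergeShift p.1 p.2 A A)) = _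
    rw [ih, eval_mergeShift, ← eval_add_mul]; rfl

theorem eval_process (lo hi : ℕ) (gs : List (List (ℕ × ℕ))) (A : KeySum) :
    eval (fun _ => 1) (process lo hi gs A) = eval (digitSum lo hi gs) A := by
  induction gs generalizing A with
  | nil => rfl
  | cons g gs ih =>
    change eval (fun _ => 1) (process lo hi gs (siftAux lo hi (mulShifts g A) 0 0)) = _
    rw [ih, eval_siftAux, eval_mulShifts]; simp [digitSum]

theorem total_process (lo hi : ℕ) (gs : List (List (ℕ × ℕ))) :
    total (process lo hi gs (cons 0 1 nil)) = digitSum lo hi gs 0 := by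
  rw [total_eq_eval, eval_process]; simp [eval]

end KeySum

/-! ### Sums over unions of edge blocks, computed digit by digit. -/

/-- The sum of `f` over the concatenations of the sublists of `O`. -/
def sumSub {α : Type*} : List (List α) → (List α → ℕ) → ℕ
  | [], f => f []
  | o :: O, f => sumSub O f + sumSub O (fun s => f (o ++ s))

theorem sumSub_eq_sum {α : Type*} (O : List (List α)) (f : List α → ℕ) :
    sumSub O f = (O.sublists'.map (fun T => f T.flatten)).sum := by
  induction O generalizing f with
  | nil => simp [sumSub]
  | cons o O ih => simp [sumSub, ih, List.sublists'_cons, Function.comp_def]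

theorem sumSub_append {α : Type*} (O₁ O₂ : List (List α)) (f : List α → ℕ) :
    sumSub (O₁ ++ O₂) f = sumSub O₁ (fun s => sumSub O₂ (fun t => f (s ++ t))) := by
  induction O₁ generalizing f with
  | nil => simp [sumSub]
  | cons o O ih => simp [sumSub, ih]

theorem sumSub_mul {α : Type*} (O : List (List α)) (c : ℕ) (f : List α → ℕ) :
    sumSub O (fun s => c * f s) = c * sumSub O f := by
  induction O generalizing f with
  | nil => simp [sumSub]
  | cons o O ih => simp [sumSub, ih, mul_add]

theorem sumSub_congr {α : Type*} {O : List (List α)} {f g : List α → ℕ}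
    (h : ∀ T : List (List α), T.Sublist O → f T.flatten = g T.flatten) : sumSub O f = sumSub O g := by
  rw [sumSub_eq_sum, sumSub_eq_sum]
  congr 1
  exact List.map_congr_left fun T hT => h T (List.mem_sublists'.1 hT)

/-- The number of pairs in the list that contain `v`. -/
def touchCount (v : ℕ) (l : List (ℕ × ℕ)) : ℕ := l.countP fun p => or (Nat.beq p.1 v) (Nat.beq p.2 v)

theorem touchCount_append (v : ℕ) (l₁ l₂ : List (ℕ × ℕ)) :
    touchCount v (l₁ ++ l₂) = touchCount v l₁ + touchCount v l₂ := List.countP_append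

theorem touchCount_le (v : ℕ) (l : List (ℕ × ℕ)) : touchCount v l ≤ l.length :=
  List.countP_le_length

/-- The degrees of the vertices in `vs`, as the digits of a number in base `64`. -/
def degreeKey (vs : List ℕ) (l : List (ℕ × ℕ)) : ℕ :=
  vs.foldr (fun v k => Nat.add (touchCount v l) (Nat.mul 64 k)) 0

theorem degreeKey_cons (v : ℕ) (vs : List ℕ) (l : List (ℕ × ℕ)) :
    degreeKey (v :: vs) l = touchCount v l + 64 * degreeKey vs l := rfl

theorem degreeKey_append (vs : List ℕ) (l₁ l₂ : List (ℕ × ℕ)) :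
    degreeKey vs (l₁ ++ l₂) = degreeKey vs l₁ + degreeKey vs l₂ := by
  induction vs with
  | nil => rfl
  | cons v vs ih => simp only [degreeKey_cons, ih, touchCount_append]; ring

/-- The shifts that describe the addition of the blocks of edges. -/
def blockWeights : List ℕ → List (List (List (ℕ × ℕ))) → List (List (ℕ × ℕ))
  | v :: vs, g :: gs =>
    g.map (fun o => (degreeKey (v :: vs) o, Nat.pow 2 (Nat.mul 64 o.length))) :: blockWeights vs gs
  | _, _ => []

/-- The blocks after the `i`-th group do not touch the `i`-th vertex. -/
def Staged : List ℕ → List (List (List (ℕ × ℕ))) → Prop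
  | v :: vs, _ :: gs => (∀ o ∈ gs.flatten, touchCount v o = 0) ∧ Staged vs gs
  | [], [] => True
  | _, _ => False

theorem shiftSum_map (F : ℕ → ℕ) (vs : List ℕ) (g : List (List (ℕ × ℕ))) (acc : List (ℕ × ℕ)) :
    shiftSum F (g.map (fun o => (degreeKey vs o, Nat.pow 2 (Nat.mul 64 o.length))))
      (degreeKey vs acc) =
    sumSub g (fun s => (2 ^ 64) ^ s.length * F (degreeKey vs (acc ++ s))) := by
  induction g generalizing acc with
  | nil => simp [shiftSum, sumSub]
  | cons o g ih =>
    simp only [List.map_cons, shiftSum, sumSub]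
    rw [ih, ← degreeKey_append, ih, ← sumSub_mul]
    congr 2
    funext s
    rw [List.length_append, pow_add, ← pow_mul (2 : ℕ) 64 o.length, List.append_assoc, mul_assoc]
    rfl

/-- Here `acc` holds the edges chosen so far. After the first group has been decided the degree of
the first vertex is final, by `Staged`, so its digit can be tested and dropped before the later
groups are treated. -/
theorem digitSum_blockWeights (lo hi : ℕ) (vs : List ℕ) (gs : List (List (List (ℕ × ℕ))))
    (acc : List (ℕ × ℕ)) (hs : Staged vs gs)
    (hl : acc.length + gs.flatten.flatten.length < 64) :
    digitSum lo hi (blockWeights vs gs) (degreeKey vs acc) =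
      sumSub gs.flatten (fun s =>
        if ∀ v ∈ vs, KeySum.inRange lo hi (touchCount v (acc ++ s)) then (2 ^ 64) ^ s.length
        else 0) := by
  induction gs generalizing vs acc with
  | nil =>
    cases vs with
    | nil => simp [blockWeights, digitSum, sumSub]
    | cons v vs => exact hs.elim
  | cons g gs ih =>
    cases vs with
    | nil => exact hs.elim
    | cons v vs =>
      obtain ⟨hv, hs⟩ := hs
      simp only [blockWeights, digitSum, List.flatten_cons]
      rw [shiftSum_map, sumSub_append]
      refine sumSub_congr fun T hT => ?_
      have hT' : T.flatten.length ≤ g.flatten.length := hT.flatten.length_le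
      simp only [List.flatten_cons, List.flatten_append, List.length_append] at hl
      -- With fewer than 64 edges in all, no digit in base 64 produces a carry.
      have h64 : touchCount v (acc ++ T.flatten) < 64 := by
        have := touchCount_le v (acc ++ T.flatten)
        rw [List.length_append] at this
        omega
      rw [degreeKey_cons]
      have e1 : (touchCount v (acc ++ T.flatten) + 64 * degreeKey vs (acc ++ T.flatten)) % 64 =
        touchCount v (acc ++ T.flatten) := by omega
      have e2 : (touchCount v (acc ++ T.flatten) + 64 * degreeKey vs (acc ++ T.flatten)) / 64 =
        degreeKey vs (acc ++ T.flatten) := by omega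
      rw [e1, e2, ih vs _ hs (by rw [List.length_append]; omega)]
      -- Later groups do not touch `v`, so the degree tested now is also the degree in the complete
      -- graph.
      have e3 : ∀ U : List (List (ℕ × ℕ)), U.Sublist gs.flatten →
          touchCount v U.flatten = 0 := by
        intro U hU
        have : ∀ o ∈ U, touchCount v o = 0 := fun o ho => hv o (hU.subset ho)
        clear hU
        induction U with
        | nil => rfl
        | cons o U ih2 =>
          rw [List.flatten_cons, touchCount_append, this o (by simp),
            ih2 fun o ho => this o (by simp [ho])]
      split_ifs with hr
      · rw [← sumSub_mul]
        refine sumSub_congr fun U hU => ?_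
        have := e3 U hU
        simp only [List.forall_mem_cons, ← List.append_assoc, touchCount_append _ _ U.flatten, this,
          add_zero, hr, true_and, List.length_append, pow_add]
        split_ifs <;> simp
      · have : sumSub gs.flatten (fun _ => 0 * 0) = 0 := by rw [sumSub_mul, zero_mul]
        rw [mul_zero]; symm
        refine Eq.trans (sumSub_congr fun U hU => ?_) this
        have := e3 U hU
        simp only [List.forall_mem_cons, ← List.append_assoc, touchCount_append _ _ U.flatten, this,
          add_zero, hr]
        simp

theorem total_process_blockWeights (lo hi : ℕ) (vs : List ℕ) (gs : List (List (List (ℕ × ℕ))))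
    (hs : Staged vs gs) (hl : gs.flatten.flatten.length < 64) :
    KeySum.total (KeySum.process lo hi (blockWeights vs gs) (.cons 0 1 .nil)) =
      sumSub gs.flatten (fun s =>
        if ∀ v ∈ vs, KeySum.inRange lo hi (touchCount v s) then (2 ^ 64) ^ s.length else 0) := by
  have h0 : degreeKey vs [] = 0 := by
    induction vs generalizing gs with
    | nil => rfl
    | cons v vs ih =>
      cases gs with
      | nil => exact hs.elim
      | cons g gs =>
        rw [degreeKey_cons, ih gs hs.2 (by
          simp only [List.flatten_cons, List.flatten_append, List.length_append] at hl; omega)]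
        rfl
  rw [KeySum.total_process]
  simpa [h0] using digitSum_blockWeights lo hi vs gs [] hs (by simpa using hl)

/-! ### Graphs on `Fin n` given by lists of increasing pairs. -/

/-- The graph on `Fin n` whose edges are the pairs in the list. -/
def graphOf (n : ℕ) (l : List (ℕ × ℕ)) : SimpleGraph (Fin n) :=
  SimpleGraph.fromRel fun a b => (a.val, b.val) ∈ l

/-- All pairs are increasing pairs of numbers below `n`. -/
def ValidPairs (n : ℕ) (l : List (ℕ × ℕ)) : Prop := ∀ p ∈ l, p.1 < p.2 ∧ p.2 < n

instance (n : ℕ) (l : List (ℕ × ℕ)) : Decidable (ValidPairs n l) := by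
  unfold ValidPairs; infer_instance

theorem graphOf_adj_of_lt {n : ℕ} {l : List (ℕ × ℕ)} (hl : ValidPairs n l) {a b : Fin n}
    (h : a < b) : (graphOf n l).Adj a b ↔ (a.val, b.val) ∈ l := by
  simp only [graphOf, SimpleGraph.fromRel_adj]
  constructor
  · rintro ⟨_, h' | h'⟩
    · exact h'
    · have := (hl _ h').1
      simp only at this
      omega
  · exact fun h' => ⟨h.ne, Or.inl h'⟩

/-- The edge of the complete graph that belongs to a pair. -/
def pairEdge (n : ℕ) [NeZero n] (p : ℕ × ℕ) : Sym2 (Fin n) := s(Fin.ofNat n p.1, Fin.ofNat n p.2)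

section

variable {n : ℕ} [NeZero n] {l : List (ℕ × ℕ)}

theorem mem_pairEdge {p : ℕ × ℕ} (h1 : p.1 < n) (h2 : p.2 < n) (v : Fin n) :
    v ∈ pairEdge n p ↔ p.1 = v ∨ p.2 = v := by
  simp only [pairEdge, Sym2.mem_iff, Fin.ext_iff, Fin.ofNat, Nat.mod_eq_of_lt h1,
    Nat.mod_eq_of_lt h2, eq_comm]

theorem nodup_map_pairEdge (hl : ValidPairs n l) (hn : l.Nodup) : (l.map (pairEdge n)).Nodup := by
  refine hn.map_on fun p hp q hq h => ?_
  have h1 := hl p hp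
  have h2 := hl q hq
  simp only [pairEdge, Sym2.eq_iff, Fin.ext_iff, Fin.ofNat, Nat.mod_eq_of_lt h1.2,
    Nat.mod_eq_of_lt h2.2, Nat.mod_eq_of_lt (h1.1.trans h1.2),
    Nat.mod_eq_of_lt (h2.1.trans h2.2)] at h
  ext <;> omega

theorem mem_edgeSet_graphOf (hl : ValidPairs n l) (e : Sym2 (Fin n)) :
    e ∈ (graphOf n l).edgeSet ↔ e ∈ l.map (pairEdge n) := by
  have key : ∀ a b : Fin n, a < b →
      (s(a, b) ∈ (graphOf n l).edgeSet ↔ s(a, b) ∈ l.map (pairEdge n)) := by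
    intro a b hab
    rw [SimpleGraph.mem_edgeSet, graphOf_adj_of_lt hl hab, List.mem_map]
    constructor
    · intro h
      refine ⟨_, h, ?_⟩
      simp [pairEdge]
    · rintro ⟨p, hp, h⟩
      have h1 := hl p hp
      simp only [pairEdge, Sym2.eq_iff, Fin.ext_iff, Fin.ofNat, Nat.mod_eq_of_lt h1.2,
        Nat.mod_eq_of_lt (h1.1.trans h1.2)] at h
      have hab' : a.val < b.val := hab
      have : p = (a.val, b.val) := by ext <;> simp only <;> omega
      rwa [← this]
  induction e with
  | _ a b =>
    rcases lt_trichotomy a b with h | h | h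
    · exact key a b h
    · subst h
      simp only [SimpleGraph.mem_edgeSet, SimpleGraph.irrefl, false_iff, List.mem_map, not_exists,
        not_and]
      intro p hp h
      have h1 := hl p hp
      simp only [pairEdge, Sym2.eq_iff, Fin.ext_iff, Fin.ofNat, Nat.mod_eq_of_lt h1.2,
        Nat.mod_eq_of_lt (h1.1.trans h1.2)] at h
      omega
    · rw [Sym2.eq_swap]; exact key b a h

open Classical in
theorem edgeFinset_graphOf (hl : ValidPairs n l) :
    (graphOf n l).edgeFinset = (l.map (pairEdge n)).toFinset := by
  ext e
  rw [SimpleGraph.mem_edgeFinset, mem_edgeSet_graphOf hl, List.mem_toFinset]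

theorem ncard_edgeSet_graphOf (hl : ValidPairs n l) (hn : l.Nodup) :
    (graphOf n l).edgeSet.ncard = l.length := by
  classical
  rw [← SimpleGraph.coe_edgeFinset, Set.ncard_coe_finset, edgeFinset_graphOf hl,
    List.toFinset_card_of_nodup (nodup_map_pairEdge hl hn), List.length_map]

theorem ncard_neighborSet_graphOf (hl : ValidPairs n l) (hn : l.Nodup) (v : Fin n) :
    ((graphOf n l).neighborSet v).ncard = touchCount v l := by
  classical
  rw [Set.ncard_eq_toFinset_card', Set.toFinset_card, SimpleGraph.card_neighborSet_eq_degree,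
    ← SimpleGraph.card_incidenceFinset_eq_degree, SimpleGraph.incidenceFinset_eq_filter,
    edgeFinset_graphOf hl, show (l.map (pairEdge n)).toFinset.filter (v ∈ ·) =
      ((l.map (pairEdge n)).filter (fun e => decide (v ∈ e))).toFinset by ext; simp,
    List.toFinset_card_of_nodup ((nodup_map_pairEdge hl hn).filter _),
    ← List.countP_eq_length_filter, List.countP_map, touchCount]
  refine List.countP_congr fun p hp => ?_
  have h1 := hl p hp
  simp [mem_pairEdge (h1.1.trans h1.2) h1.2]

end

/-! ### Graphs fixed by a permutation as unions of edge orbits. -/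

/-- The increasing pair with the entries `x` and `y`. -/
def ordPair (x y : ℕ) : ℕ × ℕ := bif Nat.ble x y then (x, y) else (y, x)

/-- The edges of a graph on `n` vertices are listed in blocks, which are the orbits of the
permutation `nxt`; the blocks come in groups such that later groups do not touch the earlier ones
of the vertices `vs`, and `vs` meets all orbits of vertices. -/
structure IsOrbitList (n : ℕ) (nxt : ℕ → ℕ) (vs : List ℕ) (gs : List (List (List (ℕ × ℕ)))) :
    Prop where
  valid : ValidPairs n gs.flatten.flatten
  nodup : gs.flatten.flatten.Nodup
  complete : ∀ j < n, ∀ i < j, (i, j) ∈ gs.flatten.flatten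
  orbit : ∀ o ∈ gs.flatten, o ≠ [] ∧
    o.map (fun p => ordPair (nxt p.1) (nxt p.2)) = o.rotate 1
  reps_lt : ∀ v ∈ vs, v < n
  reps : ∀ x < n, ∃ v ∈ vs, ∃ t < n, nxt^[t] v = x

/-- A sublist of a duplicate-free list is determined by its set of members. This makes sublists of
blocks a faithful parametrisation of the fixed graphs. -/
theorem List.Sublist.filter_mem_eq {α : Type*} [DecidableEq α] {l₁ l₂ : List α} (h : l₁.Sublist l₂)
    (hn : l₂.Nodup) : l₂.filter (fun a => a ∈ l₁) = l₁ := by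
  induction h with
  | slnil => rfl
  | @cons l₁ l₂ a h ih =>
    rw [List.nodup_cons] at hn
    rw [List.filter_cons_of_neg (by simpa using fun h' => hn.1 (h.subset h')), ih hn.2]
  | @cons_cons l₁ l₂ a h ih =>
    rw [List.nodup_cons] at hn
    rw [List.filter_cons_of_pos (by simp)]
    conv_rhs => rw [← ih hn.2]
    congr 1
    refine List.filter_congr fun x hx => ?_
    have : x ≠ a := fun e => hn.1 (e ▸ hx)
    simp [this]

/-- The map sends each entry to the next one, so the truth value of `P` is carried from the first
entry around the whole list. -/
theorem List.forall_or_forall_not_of_map_eq_rotate {α : Type*} {o : List α} {f : α → α}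
    (h : o.map f = o.rotate 1) {P : α → Prop} (hP : ∀ p ∈ o, P (f p) ↔ P p) :
    (∀ p ∈ o, P p) ∨ ∀ p ∈ o, ¬ P p := by
  have step : ∀ i (hi : i < o.length), P o[i] ↔ P (o[0]'(by omega)) := by
    intro i
    induction i with
    | zero => intro _; rfl
    | succ i ih =>
      intro hi
      rw [← ih (by omega), ← hP _ (List.getElem_mem (show i < o.length by omega))]
      have : (o.map f)[i]'(by simp; omega) = (o.rotate 1)[i]'(by simp; omega) := by
        simp only [h]
      rw [List.getElem_map, List.getElem_rotate] at this
      rw [this]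
      simp only [Nat.mod_eq_of_lt hi]
  rcases Nat.eq_zero_or_pos o.length with h0 | h0
  · rw [List.length_eq_zero_iff] at h0
    simp [h0]
  · by_cases h1 : P o[0]
    · left
      intro p hp
      obtain ⟨i, hi, rfl⟩ := List.getElem_of_mem hp
      exact (step i hi).2 h1
    · right
      intro p hp
      obtain ⟨i, hi, rfl⟩ := List.getElem_of_mem hp
      exact fun h2 => h1 ((step i hi).1 h2)

/-- The graph with vertices renamed by the permutation `σ`. -/
def SimpleGraph.relabel {V : Type*} (σ : Equiv.Perm V) (H : SimpleGraph V) : SimpleGraph V :=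
  H.comap (σ⁻¹ : Equiv.Perm V)

theorem SimpleGraph.relabel_adj {V : Type*} (σ : Equiv.Perm V) (H : SimpleGraph V) (a b : V) :
    (H.relabel σ).Adj (σ a) (σ b) ↔ H.Adj a b := by
  simp [relabel]

theorem SimpleGraph.relabel_eq_iff {V : Type*} (σ : Equiv.Perm V) (H H' : SimpleGraph V) :
    H.relabel σ = H' ↔ ∀ a b, H'.Adj (σ a) (σ b) ↔ H.Adj a b := by
  constructor
  · rintro rfl a b
    exact relabel_adj σ H a b
  · intro h
    ext a b
    have := h (σ⁻¹ a) (σ⁻¹ b)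
    simpa [relabel] using this.symm

/-- The adjacency of a graph on `Fin n`, as a property of pairs of numbers. -/
def PairAdj {n : ℕ} (H : SimpleGraph (Fin n)) (p : ℕ × ℕ) : Prop :=
  ∃ a b : Fin n, p = (a.val, b.val) ∧ H.Adj a b

theorem pairAdj_mk {n : ℕ} (H : SimpleGraph (Fin n)) (a b : Fin n) :
    PairAdj H (a.val, b.val) ↔ H.Adj a b := by
  constructor
  · rintro ⟨c, d, h, hcd⟩
    simp only [Prod.mk.injEq, ← Fin.ext_iff] at h
    rwa [h.1, h.2]
  · exact fun h => ⟨a, b, rfl, h⟩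

theorem pairAdj_ordPair {n : ℕ} (H : SimpleGraph (Fin n)) (a b : Fin n) :
    PairAdj H (ordPair a.val b.val) ↔ H.Adj a b := by
  unfold ordPair
  cases Nat.ble a.val b.val
  · rw [cond_false, pairAdj_mk, H.adj_comm]
  · rw [cond_true, pairAdj_mk]

namespace IsOrbitList

variable {n : ℕ} {nxt : ℕ → ℕ} {vs : List ℕ} {gs : List (List (List (ℕ × ℕ)))}
  (D : IsOrbitList n nxt vs gs) {σ : Equiv.Perm (Fin n)} (hσ : ∀ x, (σ x).val = nxt x.val)

include D

theorem eq_of_mem {o o' : List (ℕ × ℕ)} (ho : o ∈ gs.flatten) (ho' : o' ∈ gs.flatten)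
    {p : ℕ × ℕ} (hp : p ∈ o) (hp' : p ∈ o') : o = o' := by
  by_contra hne
  have := (List.nodup_flatten.1 D.nodup).2
  have hsymm : Std.Symm (List.Disjoint (α := ℕ × ℕ)) := ⟨fun _ _ h => h.symm⟩
  exact this.forall ho ho' hne hp hp'

theorem nodup_blocks : gs.flatten.Nodup := by
  refine (List.nodup_flatten.1 D.nodup).2.imp_of_mem fun {o o'} ho _ hd h => ?_
  subst h
  obtain ⟨p, hp⟩ := List.exists_mem_of_ne_nil _ (D.orbit o ho).1
  exact hd hp hp

theorem validPairs {T : List (List (ℕ × ℕ))} (hT : T.Sublist gs.flatten) :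
    ValidPairs n T.flatten := fun p hp => D.valid p (hT.flatten.subset hp)

theorem exists_fin {o : List (ℕ × ℕ)} (ho : o ∈ gs.flatten) {p : ℕ × ℕ} (hp : p ∈ o) :
    ∃ a b : Fin n, a < b ∧ p = (a.val, b.val) := by
  have := D.valid p (List.mem_flatten_of_mem ho hp)
  exact ⟨⟨p.1, this.1.trans this.2⟩, ⟨p.2, this.2⟩, this.1, rfl⟩

theorem exists_block {a b : Fin n} (h : a < b) : ∃ o ∈ gs.flatten, (a.val, b.val) ∈ o := by
  simpa using List.mem_flatten.1 (D.complete b b.2 a h)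

include hσ

/-- A block is a single orbit of pairs, and adjacency in a fixed graph is constant along orbits. -/
theorem forall_or_forall_not {H : SimpleGraph (Fin n)} (hH : H.relabel σ = H)
    {o : List (ℕ × ℕ)} (ho : o ∈ gs.flatten) :
    (∀ p ∈ o, PairAdj H p) ∨ ∀ p ∈ o, ¬ PairAdj H p := by
  refine List.forall_or_forall_not_of_map_eq_rotate (D.orbit o ho).2 fun p hp => ?_
  obtain ⟨a, b, -, rfl⟩ := D.exists_fin ho hp
  simp only
  rw [← hσ, ← hσ, pairAdj_ordPair, pairAdj_mk]
  exact (SimpleGraph.relabel_eq_iff σ H H).1 hH a b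

/-- Each pair lies in exactly one block, and the permutation maps each block into itself. -/
theorem relabel_graphOf {T : List (List (ℕ × ℕ))} (hT : T.Sublist gs.flatten) :
    (graphOf n T.flatten).relabel σ = graphOf n T.flatten := by
  have hp : ∀ o ∈ gs.flatten, ∀ p ∈ o, ordPair (nxt p.1) (nxt p.2) ∈ o := by
    intro o ho p hp
    rw [← List.mem_rotate (n := 1), ← (D.orbit o ho).2]
    exact List.mem_map_of_mem hp
  have hp' : ∀ o ∈ gs.flatten, ∀ a b : Fin n, a < b → (a.val, b.val) ∈ o →
      ordPair (σ a).val (σ b).val ∈ o := by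
    intro o ho a b _ h
    rw [hσ, hσ]
    exact hp o ho _ h
  have adj_iff : ∀ a b : Fin n, (graphOf n T.flatten).Adj a b ↔ ordPair a.val b.val ∈ T.flatten := by
    intro a b
    rcases lt_trichotomy a b with h | h | h
    · rw [graphOf_adj_of_lt (D.validPairs hT) h]
      have : Nat.ble a.val b.val = true := Nat.ble_eq_true_of_le h.le
      rw [ordPair, this, cond_true]
    · subst h
      simp only [SimpleGraph.irrefl, false_iff]
      intro h
      have := (D.validPairs hT _ h).1
      unfold ordPair at this
      cases Nat.ble a.val a.val <;> simp at this
    · rw [SimpleGraph.adj_comm, graphOf_adj_of_lt (D.validPairs hT) h]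
      have : Nat.ble a.val b.val = false := by
        rw [Bool.eq_false_iff, ne_eq, Nat.ble_eq]; exact not_le.2 h
      rw [ordPair, this, cond_false]
  have swap : ∀ a b : Fin n, a ≠ b → ordPair a.val b.val = ordPair b.val a.val := by
    have : ∀ a b : Fin n, a < b → ordPair a.val b.val = ordPair b.val a.val := by
      intro a b h
      have h1 : Nat.ble a.val b.val = true := Nat.ble_eq_true_of_le h.le
      have h2 : Nat.ble b.val a.val = false := by
        rw [Bool.eq_false_iff, ne_eq, Nat.ble_eq]; exact not_le.2 h
      rw [ordPair, ordPair, h1, h2]; rfl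
    intro a b h
    rcases lt_or_gt_of_ne h with h | h
    · exact this a b h
    · exact (this b a h).symm
  rw [SimpleGraph.relabel_eq_iff]
  have key : ∀ a b : Fin n, a < b →
      ((graphOf n T.flatten).Adj (σ a) (σ b) ↔ (graphOf n T.flatten).Adj a b) := by
    intro a b hab
    obtain ⟨o, ho, hpo⟩ := D.exists_block hab
    have h2 := hp' o ho a b hab hpo
    rw [adj_iff, graphOf_adj_of_lt (D.validPairs hT) hab, List.mem_flatten, List.mem_flatten]
    constructor
    · rintro ⟨o', ho', h⟩
      obtain rfl := D.eq_of_mem ho (hT.subset ho') h2 h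
      exact ⟨_, ho', hpo⟩
    · rintro ⟨o', ho', h⟩
      obtain rfl := D.eq_of_mem ho (hT.subset ho') hpo h
      exact ⟨_, ho', h2⟩
  intro a b
  rcases lt_trichotomy a b with h | h | h
  · exact key a b h
  · subst h; simp
  · rw [SimpleGraph.adj_comm, key b a h, SimpleGraph.adj_comm]

-- Fixed graphs correspond to sublists of the list of blocks: a sublist gives the graph of its
-- union, and a fixed graph gives the blocks that it meets, which it then contains entirely.
open Classical in
theorem sum_relabel_eq_self [Fintype (SimpleGraph (Fin n))] (w : SimpleGraph (Fin n) → ℕ) :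
    ∑ H with H.relabel σ = H, w H = sumSub gs.flatten (fun l => w (graphOf n l)) := by
  rw [sumSub_eq_sum, ← List.sum_toFinset _ (List.nodup_sublists'.2 D.nodup_blocks)]
  symm
  refine Finset.sum_bij' (fun T _ => graphOf n T.flatten)
    (fun H _ => gs.flatten.filter fun o => ∃ p ∈ o, PairAdj H p) ?_ ?_ ?_ ?_ ?_
  · intro T hT
    rw [List.mem_toFinset, List.mem_sublists'] at hT
    simpa using D.relabel_graphOf hσ hT
  · intro H _
    rw [List.mem_toFinset, List.mem_sublists']
    exact List.filter_sublist
  · intro T hT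
    rw [List.mem_toFinset, List.mem_sublists'] at hT
    conv_rhs => rw [← hT.filter_mem_eq D.nodup_blocks]
    refine List.filter_congr fun o ho => ?_
    rw [decide_eq_decide]
    constructor
    · rintro ⟨p, hp, h⟩
      obtain ⟨a, b, hab, rfl⟩ := D.exists_fin ho hp
      rw [pairAdj_mk, graphOf_adj_of_lt (D.validPairs hT) hab, List.mem_flatten] at h
      obtain ⟨o', ho', h⟩ := h
      rwa [D.eq_of_mem ho (hT.subset ho') hp h]
    · intro h
      obtain ⟨p, hp⟩ := List.exists_mem_of_ne_nil _ (D.orbit o ho).1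
      refine ⟨p, hp, ?_⟩
      obtain ⟨a, b, hab, rfl⟩ := D.exists_fin ho hp
      rw [pairAdj_mk, graphOf_adj_of_lt (D.validPairs hT) hab]
      exact List.mem_flatten_of_mem h hp
  · intro H hH
    have hH : H.relabel σ = H := by simpa using hH
    have key : ∀ a b : Fin n, a < b → ((graphOf n (gs.flatten.filter
        fun o => ∃ p ∈ o, PairAdj H p).flatten).Adj a b ↔ H.Adj a b) := by
      intro a b hab
      rw [graphOf_adj_of_lt (D.validPairs List.filter_sublist) hab, List.mem_flatten]
      constructor
      · rintro ⟨o, ho, h⟩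
        rw [List.mem_filter, decide_eq_true_iff] at ho
        obtain ⟨ho, p, hp, hp'⟩ := ho
        rcases D.forall_or_forall_not hσ hH ho with h1 | h1
        · exact (pairAdj_mk H a b).1 (h1 _ h)
        · exact (h1 p hp hp').elim
      · intro h
        obtain ⟨o, ho, h2⟩ := D.exists_block hab
        refine ⟨o, ?_, h2⟩
        rw [List.mem_filter, decide_eq_true_iff]
        exact ⟨ho, _, h2, (pairAdj_mk H a b).2 h⟩
    ext a b
    rcases lt_trichotomy a b with h | h | h
    · exact key a b h
    · subst h; simp
    · rw [SimpleGraph.adj_comm, key b a h, SimpleGraph.adj_comm]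
  · intro T _
    rfl

/-- Degrees in a fixed graph are constant along the cycles of `σ`, so testing one vertex per cycle
suffices. -/
theorem forall_degree_iff [NeZero n] {l : List (ℕ × ℕ)} (hl : ValidPairs n l) (hn : l.Nodup)
    (hH : (graphOf n l).relabel σ = graphOf n l) (P : ℕ → Prop) :
    (∀ x, P ((graphOf n l).neighborSet x).ncard) ↔ ∀ v ∈ vs, P (touchCount v l) := by
  have hdeg : ∀ x, ((graphOf n l).neighborSet (σ x)).ncard = ((graphOf n l).neighborSet x).ncard := by
    intro x
    rw [← Set.ncard_image_of_injective ((graphOf n l).neighborSet x) σ.injective]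
    congr 1
    ext y
    constructor
    · intro h
      refine ⟨σ⁻¹ y, ?_, by simp⟩
      rw [SimpleGraph.mem_neighborSet, ← (SimpleGraph.relabel_eq_iff σ _ _).1 hH]
      simpa using h
    · rintro ⟨z, hz, rfl⟩
      exact ((SimpleGraph.relabel_eq_iff σ _ _).1 hH _ _).2 hz
  constructor
  · intro h v hv
    have := h ⟨v, D.reps_lt v hv⟩
    rwa [ncard_neighborSet_graphOf hl hn] at this
  · intro h x
    obtain ⟨v, hv, t, -, ht⟩ := D.reps x x.2
    have key : ∀ t, (σ^[t] ⟨v, D.reps_lt v hv⟩).val = nxt^[t] v ∧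
        ((graphOf n l).neighborSet (σ^[t] ⟨v, D.reps_lt v hv⟩)).ncard = touchCount v l := by
      intro t
      induction t with
      | zero => exact ⟨rfl, ncard_neighborSet_graphOf hl hn _⟩
      | succ t ih =>
        rw [Function.iterate_succ_apply', Function.iterate_succ_apply', hdeg, hσ, ih.1]
        exact ⟨rfl, ih.2⟩
    have hx : σ^[t] ⟨v, D.reps_lt v hv⟩ = x := Fin.ext ((key t).1.trans ht)
    rw [← hx, (key t).2]
    exact h v hv

end IsOrbitList

/-! ### Burnside's lemma for isomorphism classes of graphs. -/

/-- Isomorphism of graphs with the vertex set `V`. -/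
def graphSetoid (V : Type*) : Setoid (SimpleGraph V) where
  r H H' := Nonempty (H ≃g H')
  iseqv :=
    { refl := fun _ => ⟨SimpleGraph.Iso.refl⟩
      symm := fun ⟨e⟩ => ⟨e.symm⟩
      trans := fun ⟨e⟩ ⟨f⟩ => ⟨f.comp e⟩ }

/-- The isomorphism classes of the graphs with a given property. -/
def isoClasses {V : Type*} (p : SimpleGraph V → Prop) : Set (Quotient (graphSetoid V)) :=
  Quotient.mk (graphSetoid V) '' {H | p H}

/-- A property of graphs that does not depend on the names of the vertices. -/
def IsoInvariant {V : Type*} (p : SimpleGraph V → Prop) : Prop :=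
  ∀ H H' : SimpleGraph V, Nonempty (H ≃g H') → p H → p H'

namespace SimpleGraph

variable {V : Type*}

/-- The isomorphism from a graph to the relabelled graph. -/
def relabelIso (σ : Equiv.Perm V) (H : SimpleGraph V) : H ≃g H.relabel σ where
  toEquiv := σ
  map_rel_iff' := H.relabel_adj σ _ _

theorem relabel_mul (σ τ : Equiv.Perm V) (H : SimpleGraph V) :
    H.relabel (σ * τ) = (H.relabel τ).relabel σ := by
  ext a b; simp [relabel]

theorem relabel_one (H : SimpleGraph V) : H.relabel 1 = H := by
  ext a b; simp [relabel]

theorem nonempty_iso_iff_exists_relabel (H H' : SimpleGraph V) :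
    Nonempty (H ≃g H') ↔ ∃ σ : Equiv.Perm V, H.relabel σ = H' := by
  constructor
  · rintro ⟨e⟩
    exact ⟨e.toEquiv, (relabel_eq_iff _ _ _).2 fun a b => e.map_adj_iff⟩
  · rintro ⟨σ, rfl⟩
    exact ⟨relabelIso σ H⟩

/-- The action of the permutations of the vertices on the graphs with an invariant property. -/
@[reducible] def relabelAction {p : SimpleGraph V → Prop} (hp : IsoInvariant p) :
    MulAction (Equiv.Perm V) {H // p H} where
  smul σ H := ⟨H.1.relabel σ, hp _ _ ⟨relabelIso σ H.1⟩ H.2⟩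
  one_smul H := Subtype.ext (relabel_one H.1)
  mul_smul σ τ H := Subtype.ext (relabel_mul σ τ H.1)

end SimpleGraph

open SimpleGraph

/-- Burnside's lemma for the symmetric group acting on the labelled graphs with property `p`. -/
theorem sum_card_relabel_eq_self {n : ℕ} {p : SimpleGraph (Fin n) → Prop} (hp : IsoInvariant p) :
    ∑ σ : Equiv.Perm (Fin n), Nat.card {H // p H ∧ H.relabel σ = H} =
      (isoClasses p).ncard * n.factorial := by
  classical
  let _ := relabelAction hp
  have h := MulAction.sum_card_fixedBy_eq_card_orbits_mul_card_group
    (Equiv.Perm (Fin n)) {H : SimpleGraph (Fin n) // p H}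
  rw [Fintype.card_perm, Fintype.card_fin] at h
  have e1 : ∀ σ : Equiv.Perm (Fin n), Nat.card {H // p H ∧ H.relabel σ = H} =
      Fintype.card (MulAction.fixedBy {H : SimpleGraph (Fin n) // p H} σ) := by
    intro σ
    rw [← Nat.card_eq_fintype_card]
    refine Nat.card_congr ((Equiv.subtypeSubtypeEquivSubtypeInter p _).symm.trans
      (Equiv.subtypeEquivRight fun H => ?_))
    exact ⟨fun h => Subtype.ext h, fun h => congrArg Subtype.val h⟩
  -- The orbits are the isomorphism classes: an isomorphism between graphs on the same vertex set is
  -- a relabelling.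
  have e2 : (isoClasses p).ncard = Fintype.card (Quotient
      (MulAction.orbitRel (Equiv.Perm (Fin n)) {H : SimpleGraph (Fin n) // p H})) := by
    rw [← Nat.card_eq_fintype_card, ← Nat.card_coe_set_eq]
    symm
    refine Nat.card_congr (Equiv.ofBijective
      (Quotient.lift (fun H : {H // p H} => (⟨Quotient.mk _ H.1, H.1, H.2, rfl⟩ : isoClasses p))
        ?_) ⟨?_, ?_⟩)
    · rintro H H' ⟨σ, rfl⟩
      exact Subtype.ext (Quotient.sound ⟨(relabelIso σ _).symm⟩)
    · intro a b
      induction a using Quotient.inductionOn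
      induction b using Quotient.inductionOn
      rename_i H H'
      intro h
      obtain ⟨σ, hσ⟩ := (nonempty_iso_iff_exists_relabel _ _).1
        (Quotient.exact (Subtype.ext_iff.1 h.symm))
      exact Quotient.sound ⟨σ, Subtype.ext hσ⟩
    · rintro ⟨_, H, hH, rfl⟩
      exact ⟨Quotient.mk _ ⟨H, hH⟩, rfl⟩
  rw [e2, ← h]
  exact Finset.sum_congr rfl fun σ _ => e1 σ

theorem SimpleGraph.Iso.ncard_neighborSet {V W : Type*} {H : SimpleGraph V} {H' : SimpleGraph W}
    (e : H ≃g H') (v : V) : (H'.neighborSet (e v)).ncard = (H.neighborSet v).ncard := by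
  rw [← Nat.card_coe_set_eq, ← Nat.card_coe_set_eq]
  exact (Nat.card_congr (e.mapNeighborSet v)).symm

theorem SimpleGraph.Iso.ncard_edgeSet {V W : Type*} {H : SimpleGraph V} {H' : SimpleGraph W}
    (e : H ≃g H') : H'.edgeSet.ncard = H.edgeSet.ncard := by
  rw [← Nat.card_coe_set_eq, ← Nat.card_coe_set_eq]
  exact (Nat.card_congr e.mapEdgeSet).symm

/-- All degrees lie between `lo` and `hi`. -/
def DegreesIn (lo hi : ℕ) {V : Type*} (H : SimpleGraph V) : Prop :=
  ∀ v, lo ≤ (H.neighborSet v).ncard ∧ (H.neighborSet v).ncard ≤ hi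

theorem DegreesIn.iso {lo hi : ℕ} {V W : Type*} {H : SimpleGraph V} {H' : SimpleGraph W}
    (e : H ≃g H') (h : DegreesIn lo hi H) : DegreesIn lo hi H' := by
  intro w
  have := h (e.symm w)
  rwa [← e.ncard_neighborSet, e.apply_symm_apply] at this

theorem isoInvariant_degreesIn_edges (lo hi m : ℕ) (V : Type*) :
    IsoInvariant (V := V) fun H => DegreesIn lo hi H ∧ H.edgeSet.ncard = m :=
  fun _ _ ⟨e⟩ ⟨h1, h2⟩ => ⟨h1.iso e, e.ncard_edgeSet.trans h2⟩

open Classical in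
/-- The generating number (with base `2 ^ 64`) of the labelled graphs fixed by `σ` that have
degrees in a given range, counted by their numbers of edges. -/
noncomputable def fixedSum (n lo hi : ℕ) (σ : Equiv.Perm (Fin n)) : ℕ :=
  ∑ H : SimpleGraph (Fin n) with H.relabel σ = H,
    if DegreesIn lo hi H then (2 ^ 64) ^ H.edgeSet.ncard else 0

/-- If `τ = cσc⁻¹`, relabelling by `c` is a bijection from the graphs fixed by `σ` to those fixed by
`τ`, and it preserves degrees and edge numbers. -/
theorem fixedSum_conj {n lo hi : ℕ} {σ τ : Equiv.Perm (Fin n)} (h : IsConj σ τ) :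
    fixedSum n lo hi σ = fixedSum n lo hi τ := by
  classical
  obtain ⟨c, hc⟩ := isConj_iff.1 h
  unfold fixedSum
  refine Finset.sum_bij' (fun H _ => H.relabel c) (fun H _ => H.relabel c⁻¹) ?_ ?_ ?_ ?_ ?_
  · intro H hH
    have hH : H.relabel σ = H := by simpa using hH
    have : (H.relabel c).relabel τ = H.relabel c := by
      rw [← relabel_mul, ← hc, inv_mul_cancel_right, relabel_mul, hH]
    simpa using this
  · intro H hH
    have hH : H.relabel τ = H := by simpa using hH
    have hc' : σ = c⁻¹ * τ * c := by rw [← hc]; group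
    have : (H.relabel c⁻¹).relabel σ = H.relabel c⁻¹ := by
      rw [← relabel_mul, hc', mul_inv_cancel_right, relabel_mul, hH]
    simpa using this
  · intro H _
    rw [← relabel_mul, inv_mul_cancel, relabel_one]
  · intro H _
    rw [← relabel_mul, mul_inv_cancel, relabel_one]
  · intro H _
    have e := relabelIso c H
    rw [e.ncard_edgeSet]
    congr 1
    exact propext ⟨fun h => h.iso e, fun h => h.iso e.symm⟩

/-- The bound counts unordered pairs including the diagonal. This crude range also serves later: for
`n = 5` it reaches exactly the 15 edges that belong to `b = 0`. -/
theorem ncard_edgeSet_lt {n : ℕ} (H : SimpleGraph (Fin n)) :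
    H.edgeSet.ncard < (n + 1).choose 2 + 1 := by
  have h := Set.ncard_le_ncard (Set.subset_univ H.edgeSet)
  rw [Set.ncard_univ, Nat.card_eq_fintype_card, Sym2.card, Fintype.card_fin] at h
  omega

/-- Burnside's lemma is applied for every edge number `m` separately, and the results are collected
with weights `(2 ^ 64) ^ m`. -/
theorem sum_fixedSum (n lo hi : ℕ) :
    ∑ σ : Equiv.Perm (Fin n), fixedSum n lo hi σ =
      n.factorial * ∑ m ∈ Finset.range ((n + 1).choose 2 + 1),
        (isoClasses fun H : SimpleGraph (Fin n) =>
          DegreesIn lo hi H ∧ H.edgeSet.ncard = m).ncard * (2 ^ 64) ^ m := by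
  classical
  rw [Finset.mul_sum]
  have h1 : ∀ m, n.factorial * ((isoClasses fun H : SimpleGraph (Fin n) =>
      DegreesIn lo hi H ∧ H.edgeSet.ncard = m).ncard * (2 ^ 64) ^ m) =
      ∑ σ : Equiv.Perm (Fin n), Nat.card {H : SimpleGraph (Fin n) //
        (DegreesIn lo hi H ∧ H.edgeSet.ncard = m) ∧ H.relabel σ = H} * (2 ^ 64) ^ m := by
    intro m
    rw [← Finset.sum_mul, sum_card_relabel_eq_self (isoInvariant_degreesIn_edges lo hi m _)]
    ring
  simp only [h1]
  rw [Finset.sum_comm]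
  refine Finset.sum_congr rfl fun σ _ => ?_
  unfold fixedSum
  rw [← Finset.sum_filter, Finset.filter_filter,
    ← Finset.sum_fiberwise_of_maps_to (g := fun H => H.edgeSet.ncard)
      (t := Finset.range ((n + 1).choose 2 + 1)) (fun H _ => Finset.mem_range.2 (ncard_edgeSet_lt H))]
  refine Finset.sum_congr rfl fun m _ => ?_
  rw [Finset.sum_congr rfl (g := fun _ => (2 ^ 64) ^ m) (fun H hH => by
    rw [(Finset.mem_filter.1 hH).2]), Finset.sum_const, smul_eq_mul]
  congr 1
  rw [Nat.card_eq_fintype_card, Fintype.card_subtype, Finset.filter_filter]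
  congr 1
  ext H
  simp only [Finset.mem_filter, Finset.mem_univ, true_and]
  tauto

theorem digit_of_sum (B : ℕ) (c : ℕ → ℕ) (N : ℕ) (hc : ∀ i, c i < B) (k : ℕ) (hk : k < N) :
    (∑ i ∈ Finset.range N, c i * B ^ i) / B ^ k % B = c k := by
  have hB : 0 < B := (Nat.zero_le _).trans_lt (hc 0)
  induction k generalizing c N with
  | zero =>
    obtain ⟨N, rfl⟩ : ∃ M, N = M + 1 := ⟨N - 1, by omega⟩
    rw [Finset.sum_range_succ']
    have : ∑ i ∈ Finset.range N, c (i + 1) * B ^ (i + 1) =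
        B * ∑ i ∈ Finset.range N, c (i + 1) * B ^ i := by
      rw [Finset.mul_sum]; exact Finset.sum_congr rfl fun i _ => by ring
    rw [this, pow_zero, mul_one, Nat.div_one, Nat.mul_add_mod, Nat.mod_eq_of_lt (hc 0)]
  | succ k ih =>
    obtain ⟨N, rfl⟩ : ∃ M, N = M + 1 := ⟨N - 1, by omega⟩
    rw [Finset.sum_range_succ']
    have : ∑ i ∈ Finset.range N, c (i + 1) * B ^ (i + 1) =
        B * ∑ i ∈ Finset.range N, c (i + 1) * B ^ i := by
      rw [Finset.mul_sum]; exact Finset.sum_congr rfl fun i _ => by ring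
    rw [this, pow_zero, mul_one, pow_succ', ← Nat.div_div_eq_div_mul, add_comm,
      Nat.add_mul_div_left _ _ hB, Nat.div_eq_of_lt (hc 0), zero_add,
      ih (fun i => c (i + 1)) N (fun i => hc _) (by omega)]

/-- A graph on at most nine vertices is determined by a subset of at most 45 unordered pairs. Every
class number is therefore a single digit in base `2 ^ 64`. -/
theorem ncard_isoClasses_lt {n : ℕ} (hn : n ≤ 9) (p : SimpleGraph (Fin n) → Prop) :
    (isoClasses p).ncard < 2 ^ 64 := by
  have h1 : (isoClasses p).ncard ≤ {H | p H}.ncard := Set.ncard_image_le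
  have h2 : {H | p H}.ncard ≤ Nat.card (SimpleGraph (Fin n)) := by
    rw [← Set.ncard_univ]; exact Set.ncard_le_ncard (Set.subset_univ _)
  have h3 : Nat.card (SimpleGraph (Fin n)) ≤ Nat.card (Set (Sym2 (Fin n))) :=
    Nat.card_le_card_of_injective SimpleGraph.edgeSet SimpleGraph.edgeSet_injective
  rw [Nat.card_eq_fintype_card, Nat.card_eq_fintype_card, Fintype.card_set, Sym2.card,
    Fintype.card_fin] at h3
  have h4 : (n + 1).choose 2 ≤ 45 := (Nat.choose_le_choose 2 (by omega : n + 1 ≤ 10)).trans (by decide)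
  calc _ ≤ 2 ^ (n + 1).choose 2 := h1.trans (h2.trans (by rwa [Nat.card_eq_fintype_card]))
    _ ≤ 2 ^ 45 := Nat.pow_le_pow_right (by norm_num) h4
    _ < 2 ^ 64 := by norm_num

/-! ### Rotations of intervals as representatives of the cycle types. -/

/-- Consecutive intervals with the given lengths, as pairs of a start and a length. -/
def intervals : ℕ → List ℕ → List (ℕ × ℕ)
  | _, [] => []
  | s, p :: c => (s, p) :: intervals (s + p) c

/-- The map that rotates each of the intervals. -/
def rotateNext : List (ℕ × ℕ) → ℕ → ℕ
  | [], x => x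
  | q :: cs, x =>
    bif Nat.ble q.1 x && Nat.ble (x + 1) (q.1 + q.2) then q.1 + (x - q.1 + 1) % q.2
    else rotateNext cs x

/-- The nontrivial cycles of the rotation of the intervals. -/
def rotateCycles (n : ℕ) [NeZero n] (cs : List (ℕ × ℕ)) : List (List (Fin n)) :=
  (cs.filter fun q => Nat.ble 2 q.2).map fun q => (List.range q.2).map fun i => Fin.ofNat n (q.1 + i)

/-- The permutation that rotates each of the intervals. -/
def rotatePerm (n : ℕ) [NeZero n] (cs : List (ℕ × ℕ)) : Equiv.Perm (Fin n) :=
  ((rotateCycles n cs).map List.formPerm).prod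

/-- The first `l` pairs in the orbit of `(s, t + d)` under the rotation of two intervals. -/
def pairOrbit (s p t q d l : ℕ) : List (ℕ × ℕ) :=
  (List.range l).map fun i => ordPair (s + i % p) (t + (d + i) % q)

/-- The orbits of edges under the rotation of the intervals, grouped by the first interval that
they touch. -/
def orbitGroups : List (ℕ × ℕ) → List (List (List (ℕ × ℕ)))
  | [] => []
  | (s, p) :: cs =>
    (((List.range ((p - 1) / 2)).map fun d => pairOrbit s p s p (d + 1) p) ++
      (bif Nat.beq (p % 2) 0 then [pairOrbit s p s p (p / 2) (p / 2)] else []) ++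
      cs.flatMap fun tq => (List.range (Nat.gcd p tq.2)).map fun d =>
        pairOrbit s p tq.1 tq.2 d (p * tq.2 / Nat.gcd p tq.2)) :: orbitGroups cs

/-- The partitions of `n` into parts of size at most `m` (for large `fuel`). -/
def partitionLists : ℕ → ℕ → ℕ → List (List ℕ)
  | 0, n, _ => bif Nat.beq n 0 then [[]] else []
  | fuel + 1, n, m =>
    bif Nat.beq n 0 then [[]] else
      (List.range (min n m)).flatMap fun k =>
        (partitionLists fuel (n - (k + 1)) (k + 1)).map ((k + 1) :: ·)

/-- The number of permutations of `n` points with cycle type `m`. -/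
def cycleTypeCard (n : ℕ) (m : Multiset ℕ) : ℕ :=
  n.factorial / ((n - m.sum).factorial * m.prod * ∏ k ∈ m.toFinset, (m.count k).factorial)

/-- The cycle type of the rotation of intervals with the given lengths. -/
def partsType (c : List ℕ) : Multiset ℕ := ((c.filter fun p => Nat.ble 2 p : List ℕ) : Multiset ℕ)

-- The list `ts` is not assumed to contain all cycle types. This follows from `htotal`: distinct
-- types have disjoint conjugacy classes, and class sizes that add up to `n!` leave nothing over.
open Classical in
theorem sum_classFunction {n : ℕ} {f : Equiv.Perm (Fin n) → ℕ}
    (hf : ∀ σ τ, IsConj σ τ → f σ = f τ) (ts : List (List ℕ)) (rep : List ℕ → Equiv.Perm (Fin n))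
    (hrep : ∀ t ∈ ts, (rep t).cycleType = partsType t) (hnodup : (ts.map partsType).Nodup)
    (htotal : (ts.map fun t => cycleTypeCard n (partsType t)).sum = n.factorial) :
    ∑ σ, f σ = (ts.map fun t => cycleTypeCard n (partsType t) * f (rep t)).sum := by
  have hcard : ∀ t ∈ ts, (Finset.univ.filter fun σ : Equiv.Perm (Fin n) =>
      σ.cycleType = partsType t).card = cycleTypeCard n (partsType t) := by
    intro t ht
    -- The representative shows that the class is not empty, which selects the nonzero branch of the
    -- formula for its size.
    have hpos : (Finset.univ.filter fun σ : Equiv.Perm (Fin n) =>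
      σ.cycleType = partsType t).card ≠ 0 :=
      Finset.card_ne_zero_of_mem (a := rep t) (by simp [hrep t ht])
    have hc := hpos
    rw [ne_eq, Equiv.Perm.card_of_cycleType_eq_zero_iff, not_not] at hc
    rw [Equiv.Perm.card_of_cycleType, if_pos hc, Fintype.card_fin]
    rfl
  have hnd : ts.Nodup := hnodup.of_map
  have hdisj : (ts.toFinset : Set (List ℕ)).PairwiseDisjoint
      fun t => Finset.univ.filter fun σ : Equiv.Perm (Fin n) => σ.cycleType = partsType t := by
    intro t ht u hu htu
    rw [Function.onFun, Finset.disjoint_left]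
    intro σ h1 h2
    rw [Finset.mem_filter] at h1 h2
    exact htu (List.inj_on_of_nodup_map hnodup (by simpa using ht) (by simpa using hu)
      (h1.2.symm.trans h2.2))
  have huniv : ts.toFinset.biUnion
      (fun t => Finset.univ.filter fun σ : Equiv.Perm (Fin n) => σ.cycleType = partsType t) =
      Finset.univ := by
    rw [← Finset.card_eq_iff_eq_univ, Finset.card_biUnion hdisj, Fintype.card_perm,
      Fintype.card_fin, ← htotal, List.sum_toFinset _ hnd]
    congr 1
    exact List.map_congr_left hcard
  rw [← huniv, Finset.sum_biUnion hdisj, List.sum_toFinset _ hnd]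
  congr 1
  refine List.map_congr_left fun t ht => ?_
  rw [Finset.sum_congr rfl (g := fun _ => f (rep t)), Finset.sum_const, smul_eq_mul, hcard t ht]
  intro σ hσ
  refine hf _ _ (Equiv.Perm.isConj_iff_cycleType_eq.2 ?_)
  rw [(Finset.mem_filter.1 hσ).2, hrep t ht]

theorem cycleType_prod_formPerm {α : Type*} [Fintype α] [DecidableEq α] {L : List (List α)}
    (h : ∀ l ∈ L, l.Nodup ∧ 2 ≤ l.length) (hd : L.Pairwise fun l l' => ∀ a ∈ l, a ∉ l') :
    (L.map List.formPerm).prod.cycleType = (L.map List.length : List ℕ) := by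
  rw [Equiv.Perm.cycleType_eq _ rfl]
  · rw [List.map_map]
    congr 1
    refine List.map_congr_left fun l hl => ?_
    rw [Function.comp_apply, Function.comp_apply, List.support_formPerm_of_nodup _ (h l hl).1,
      List.toFinset_card_of_nodup (h l hl).1]
    rintro x rfl
    simpa using (h _ hl).2
  · intro σ hσ
    obtain ⟨l, hl, rfl⟩ := List.mem_map.1 hσ
    exact List.isCycle_formPerm (h l hl).1 (h l hl).2
  · rw [List.pairwise_map]
    refine hd.imp_of_mem fun hl hl' hll => ?_
    exact (List.formPerm_disjoint_iff (h _ hl).1 (h _ hl').1 (h _ hl).2 (h _ hl').2).2 hll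

/-- The orbit data of a rotation: a computable form of `IsOrbitList`. -/
def OrbitCheck (n : ℕ) (nxt : ℕ → ℕ) (vs : List ℕ) (gs : List (List (List (ℕ × ℕ))))
    (F : List (ℕ × ℕ)) : Prop :=
  ValidPairs n F ∧ F.Nodup ∧ F.length < 64 ∧ (∀ j < n, ∀ i < j, (i, j) ∈ F) ∧
  (∀ o ∈ gs.flatten, o ≠ [] ∧
    o.map (fun p => ordPair (nxt p.1) (nxt p.2)) = o.rotate 1) ∧
  (∀ v ∈ vs, v < n) ∧ (∀ x < n, ∃ v ∈ vs, ∃ t < n, nxt^[t] v = x) ∧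
  Staged vs gs

/-- The conditions on the rotation of intervals with lengths `c` that are checked by computation. -/
def RotationCheck (n : ℕ) [NeZero n] (c : List ℕ) : Prop :=
  (∀ l ∈ rotateCycles n (intervals 0 c), l.Nodup ∧ 2 ≤ l.length) ∧
  ((rotateCycles n (intervals 0 c)).Pairwise fun l l' => ∀ a ∈ l, a ∉ l') ∧
  (rotateCycles n (intervals 0 c)).map List.length = c.filter (fun p => Nat.ble 2 p) ∧
  (∀ x : Fin n, (rotatePerm n (intervals 0 c) x).val = rotateNext (intervals 0 c) x.val) ∧
  OrbitCheck n (rotateNext (intervals 0 c)) ((intervals 0 c).map Prod.fst)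
    (orbitGroups (intervals 0 c)) (orbitGroups (intervals 0 c)).flatten.flatten

instance Staged.decidable : ∀ (vs : List ℕ) (gs : List (List (List (ℕ × ℕ)))),
    Decidable (Staged vs gs)
  | [], [] => .isTrue trivial
  | [], _ :: _ => .isFalse id
  | _ :: _, [] => .isFalse id
  | _ :: vs, _ :: gs =>
    have := Staged.decidable vs gs
    inferInstanceAs (Decidable (_ ∧ _))

instance (n : ℕ) (nxt : ℕ → ℕ) (vs : List ℕ) (gs : List (List (List (ℕ × ℕ))))
    (F : List (ℕ × ℕ)) : Decidable (OrbitCheck n nxt vs gs F) := by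
  unfold OrbitCheck; infer_instance

instance (n : ℕ) [NeZero n] (c : List ℕ) : Decidable (RotationCheck n c) := by
  unfold RotationCheck; infer_instance

/-- The computed value of `fixedSum` for the rotation of intervals with lengths `c`. -/
noncomputable def rotationSum (lo hi : ℕ) (c : List ℕ) : ℕ :=
  KeySum.total (KeySum.process lo hi
    (blockWeights ((intervals 0 c).map Prod.fst) (orbitGroups (intervals 0 c))) (.cons 0 1 .nil))

theorem inRange_iff (lo hi d : ℕ) : KeySum.inRange lo hi d = true ↔ lo ≤ d ∧ d ≤ hi := by
  simp [KeySum.inRange]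

theorem fixedSum_rotatePerm {n : ℕ} [NeZero n] {c : List ℕ} (h : RotationCheck n c) (lo hi : ℕ) :
    fixedSum n lo hi (rotatePerm n (intervals 0 c)) = rotationSum lo hi c := by
  obtain ⟨-, -, -, hσ, hv, hn, hl, hc, ho, hr1, hr2, hs⟩ := h
  have D : IsOrbitList n (rotateNext (intervals 0 c)) ((intervals 0 c).map Prod.fst)
    (orbitGroups (intervals 0 c)) := ⟨hv, hn, hc, ho, hr1, hr2⟩
  rw [rotationSum, total_process_blockWeights _ _ _ _ hs hl, fixedSum, D.sum_relabel_eq_self hσ]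
  refine sumSub_congr fun T hT => ?_
  have hnT : T.flatten.Nodup := hn.sublist hT.flatten
  have hvT := D.validPairs hT
  have hiff : DegreesIn lo hi (graphOf n T.flatten) ↔
      ∀ v ∈ (intervals 0 c).map Prod.fst, KeySum.inRange lo hi (touchCount v T.flatten) := by
    simp only [inRange_iff]
    exact D.forall_degree_iff hσ hvT hnT (D.relabel_graphOf hσ hT) fun d => lo ≤ d ∧ d ≤ hi
  rw [ncard_edgeSet_graphOf hvT hnT]
  simp only [hiff]

/-- Burnside's sum over the cycle types, divided by the order of the group. -/
noncomputable def burnsideSum (n lo hi : ℕ) : ℕ :=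
  ((partitionLists n n n).map fun c =>
    cycleTypeCard n (partsType c) * rotationSum lo hi c).sum / n.factorial

/-- The partitions of `n` list the cycle types, and the data of the rotations are correct. -/
def PartitionCheck (n : ℕ) [NeZero n] : Prop :=
  ((partitionLists n n n).map partsType).Nodup ∧
  ((partitionLists n n n).map fun t => cycleTypeCard n (partsType t)).sum = n.factorial ∧
  ∀ c ∈ partitionLists n n n, RotationCheck n c

instance (n : ℕ) [NeZero n] : Decidable (PartitionCheck n) := by
  unfold PartitionCheck; infer_instance

/-- The class function is `fixedSum`. Its value on each representative is computed as `rotationSum`,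
and division by `n!` leaves the number whose digits are the class numbers. -/
theorem ncard_isoClasses_eq_digit {n : ℕ} [NeZero n] (hn : n ≤ 9) (h : PartitionCheck n)
    (lo hi m : ℕ) (hm : m ≤ (n + 1).choose 2) :
    (isoClasses fun H : SimpleGraph (Fin n) =>
      DegreesIn lo hi H ∧ H.edgeSet.ncard = m).ncard =
      burnsideSum n lo hi / (2 ^ 64) ^ m % 2 ^ 64 := by
  obtain ⟨h1, h2, h3⟩ := h
  have key := sum_fixedSum n lo hi
  rw [sum_classFunction (fun _ _ => fixedSum_conj) (partitionLists n n n)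
    (fun c => rotatePerm n (intervals 0 c)) (fun c hc => ?_) h1 h2] at key
  · have : burnsideSum n lo hi = ∑ m ∈ Finset.range ((n + 1).choose 2 + 1),
        (isoClasses fun H : SimpleGraph (Fin n) =>
          DegreesIn lo hi H ∧ H.edgeSet.ncard = m).ncard * (2 ^ 64) ^ m := by
      rw [burnsideSum]
      apply Nat.div_eq_of_eq_mul_right n.factorial_pos
      rw [← key]
      congr 1
      exact List.map_congr_left fun c hc => by rw [fixedSum_rotatePerm (h3 c hc)]
    rw [this, digit_of_sum _ _ _ (fun _ => ncard_isoClasses_lt hn _) m (by omega)]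
  · obtain ⟨h4, h5, h6, -⟩ := h3 c hc
    rw [rotatePerm, cycleType_prod_formPerm h4 h5, h6, partsType]

/-! ### Growth of vertex sets, cycles, and edge bounds. -/

namespace SimpleGraph

variable {V : Type*} {H : SimpleGraph V}

/-- `H.Grows C T`: the set `T` arises from `C` by successively adding vertices that have at least
two neighbours in the set reached so far. -/
inductive Grows (H : SimpleGraph V) (C : Set V) : Set V → Prop
  | refl : Grows H C C
  | step {T : Set V} {v : V} : Grows H C T → v ∉ T → 2 ≤ (H.neighborSet v ∩ T).ncard →
      Grows H C (insert v T)

/-- `T` cannot grow: every vertex outside `T` has at most one neighbour in `T`. -/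
def IsGrowthClosed (H : SimpleGraph V) (T : Set V) : Prop :=
  ∀ v ∉ T, (H.neighborSet v ∩ T).ncard ≤ 1

/-- `C` is the vertex set of a cycle of length `k`, which is given as a periodic sequence. -/
def IsCyclicSet (H : SimpleGraph V) (k : ℕ) (C : Set V) : Prop :=
  3 ≤ k ∧ ∃ f : ℕ → V, (∀ i < k, ∀ j < k, f i = f j → i = j) ∧ (∀ i, f (i + k) = f i) ∧
    (∀ i, H.Adj (f i) (f (i + 1))) ∧ C = Set.range f

/-- The whole vertex set arises by growth from a cycle of length `k`. -/
def GrowsFromCycle (H : SimpleGraph V) (k : ℕ) : Prop :=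
  ∃ C, H.IsCyclicSet k C ∧ H.Grows C Set.univ

theorem Grows.subset {C T : Set V} (h : H.Grows C T) : C ⊆ T := by
  induction h with
  | refl => exact subset_rfl
  | step _ _ _ ih => exact ih.trans (Set.subset_insert _ _)

/-- The first vertex added outside `A` would have two neighbours in `A`. Closed sets are thus
obstructions to growth. -/
theorem Grows.subset_of_closed [Finite V] {C T A : Set V} (h : H.Grows C T) (hC : C ⊆ A)
    (hA : H.IsGrowthClosed A) : T ⊆ A := by
  induction h with
  | refl => exact hC
  | @step T v _ _ h2 ih =>
    refine Set.insert_subset ?_ ih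
    by_contra hv
    have h3 := Set.ncard_le_ncard (Set.inter_subset_inter_right (H.neighborSet v) ih)
    have h4 := hA v hv
    omega

/-- A largest set reached from `C` is closed, since any further vertex would enlarge it. -/
theorem exists_grows_isGrowthClosed [Finite V] (H : SimpleGraph V) (C : Set V) :
    ∃ T, H.Grows C T ∧ H.IsGrowthClosed T := by
  obtain ⟨T, hT, hmax⟩ := Set.Finite.exists_maximalFor (fun T : Set V => T.ncard) {T | H.Grows C T}
    (Set.toFinite _) ⟨C, .refl⟩
  refine ⟨T, hT, fun v hv => ?_⟩
  by_contra h
  have h1 := hmax (Grows.step hT hv (by omega)) (Set.ncard_le_ncard (Set.subset_insert _ _))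
  simp only [Set.ncard_insert_of_notMem hv] at h1
  omega

theorem Grows.map {W : Type*} {H' : SimpleGraph W} (e : H ≃g H') {C T : Set V}
    (h : H.Grows C T) : H'.Grows (e '' C) (e '' T) := by
  induction h with
  | refl => exact .refl
  | @step T v _ hv h2 ih =>
    rw [Set.image_insert_eq]
    refine ih.step (by simpa using hv) ?_
    have : H'.neighborSet (e v) ∩ e '' T = e '' (H.neighborSet v ∩ T) := by
      ext w
      constructor
      · rintro ⟨h1, t, ht, rfl⟩
        exact ⟨t, ⟨e.map_adj_iff.1 h1, ht⟩, rfl⟩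
      · rintro ⟨t, ⟨h1, ht⟩, rfl⟩
        exact ⟨e.map_adj_iff.2 h1, t, ht, rfl⟩
    rwa [this, Set.ncard_image_of_injective _ e.injective]

theorem IsCyclicSet.map {W : Type*} {H' : SimpleGraph W} (e : H ≃g H') {k : ℕ} {C : Set V}
    (h : H.IsCyclicSet k C) : H'.IsCyclicSet k (e '' C) := by
  obtain ⟨hk, f, h1, h2, h3, rfl⟩ := h
  refine ⟨hk, e ∘ f, fun i hi j hj h => h1 i hi j hj (e.injective h), fun i => ?_, fun i => ?_, ?_⟩
  · simp [h2]
  · exact e.map_adj_iff.2 (h3 i)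
  · rw [Set.range_comp]

theorem GrowsFromCycle.map {W : Type*} {H' : SimpleGraph W} (e : H ≃g H') {k : ℕ}
    (h : H.GrowsFromCycle k) : H'.GrowsFromCycle k := by
  obtain ⟨C, hC, hg⟩ := h
  refine ⟨e '' C, hC.map e, ?_⟩
  have := hg.map e
  rwa [Set.image_univ, e.surjective.range_eq] at this

namespace IsCyclicSet

theorem eq_mod {k : ℕ} {f : ℕ → V} (h1 : ∀ i < k, ∀ j < k, f i = f j → i = j)
    (h2 : ∀ i, f (i + k) = f i) (hk : 0 < k) {i j : ℕ} (h : f i = f j) : i % k = j % k := by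
  have hp : Function.Periodic f k := h2
  rw [← hp.map_mod_nat i, ← hp.map_mod_nat j] at h
  exact h1 _ (Nat.mod_lt _ hk) _ (Nat.mod_lt _ hk) h

/-- Otherwise `k` would divide 2. The consequence used is that the two neighbours of a vertex on a
cycle are distinct. -/
theorem ne_add_two {k : ℕ} {f : ℕ → V} (h1 : ∀ i < k, ∀ j < k, f i = f j → i = j)
    (h2 : ∀ i, f (i + k) = f i) (hk : 3 ≤ k) (i : ℕ) : f i ≠ f (i + 2) := by
  intro h
  have := eq_mod h1 h2 (by omega) h
  have h3 : i ≡ i + 2 [MOD k] := this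
  have h4 : k ∣ 2 := by simpa using (Nat.modEq_iff_dvd' (by omega)).1 h3
  have := Nat.le_of_dvd (by omega) h4
  omega

variable {k : ℕ} {C : Set V}

theorem finite (h : H.IsCyclicSet k C) : C.Finite := by
  obtain ⟨hk, f, h1, h2, h3, rfl⟩ := h
  have hp : Function.Periodic f k := h2
  have : Set.range f ⊆ f '' Set.Iio k := by
    rintro _ ⟨i, rfl⟩
    exact ⟨i % k, Nat.mod_lt _ (by omega), hp.map_mod_nat i⟩
  exact ((Set.finite_Iio k).image f).subset this

theorem ncard_eq (h : H.IsCyclicSet k C) : C.ncard = k := by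
  obtain ⟨hk, f, h1, h2, h3, rfl⟩ := h
  have hp : Function.Periodic f k := h2
  have : Set.range f = f '' Set.Iio k := by
    ext v
    constructor
    · rintro ⟨i, rfl⟩
      exact ⟨i % k, Nat.mod_lt _ (by omega), hp.map_mod_nat i⟩
    · rintro ⟨i, -, rfl⟩
      exact ⟨i, rfl⟩
  have hinj : Set.InjOn f (Set.Iio k) := fun i hi j hj h => h1 i hi j hj h
  rw [this, hinj.ncard_image]
  simp [Set.ncard_eq_toFinset_card']

theorem two_le_ncard (h : H.IsCyclicSet k C) {v : V} (hv : v ∈ C) :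
    2 ≤ (H.neighborSet v ∩ C).ncard := by
  have hfin := h.finite
  obtain ⟨hk, f, h1, h2, h3, rfl⟩ := h
  obtain ⟨i, rfl⟩ := hv
  -- The predecessor of `f i` is written with index `i + k - 1`, so that the subtraction is not
  -- truncated at `i = 0`.
  have hs : {f (i + k - 1), f (i + 1)} ⊆ H.neighborSet (f i) ∩ Set.range f := by
    rintro _ (rfl | rfl)
    · refine ⟨?_, _, rfl⟩
      have := h3 (i + k - 1)
      rw [show i + k - 1 + 1 = i + k by omega, h2] at this
      exact this.symm
    · exact ⟨h3 i, _, rfl⟩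
  have hne : f (i + k - 1) ≠ f (i + 1) := by
    have := ne_add_two h1 h2 hk (i + k - 1)
    rwa [show i + k - 1 + 2 = i + 1 + k by omega, h2] at this
  rw [← Set.ncard_pair hne]
  exact Set.ncard_le_ncard hs (hfin.subset Set.inter_subset_right)

theorem connected (h : H.IsCyclicSet k C) : (H.induce C).Connected := by
  obtain ⟨hk, f, h1, h2, h3, rfl⟩ := h
  rw [connected_iff_exists_forall_reachable]
  refine ⟨⟨f 0, 0, rfl⟩, ?_⟩
  rintro ⟨_, i, rfl⟩
  induction i with
  | zero => exact Reachable.refl _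
  | succ i ih =>
    refine ih.trans (Adj.reachable ?_)
    exact h3 i

end IsCyclicSet

theorem isCyclicSet_three {a b c : V} (hab : H.Adj a b) (hbc : H.Adj b c) (hca : H.Adj c a) :
    H.IsCyclicSet 3 {a, b, c} := by
  refine ⟨le_rfl, fun i => if i % 3 = 0 then a else if i % 3 = 1 then b else c, ?_, ?_, ?_, ?_⟩
  · intro i hi j hj
    interval_cases i <;> interval_cases j <;>
      simp [hab.ne, hbc.ne, hca.ne, hab.ne.symm, hbc.ne.symm, hca.ne.symm]
  · intro i; simp
  · intro i
    have : i % 3 = 0 ∨ i % 3 = 1 ∨ i % 3 = 2 := by omega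
    rcases this with h | h | h <;> simp [h, Nat.add_mod, hab, hbc, hca]
  · ext v
    constructor
    · rintro (rfl | rfl | rfl)
      · exact ⟨0, by simp⟩
      · exact ⟨1, by simp⟩
      · exact ⟨2, by simp⟩
    · rintro ⟨i, rfl⟩
      simp only
      split_ifs <;> simp

theorem Grows.connected [Finite V] {C T : Set V} (h : H.Grows C T) (hC : (H.induce C).Connected) :
    (H.induce T).Connected := by
  induction h with
  | refl => exact hC
  | @step T v _ _ h2 ih =>
    obtain ⟨w, hw⟩ : (H.neighborSet v ∩ T).Nonempty := by
      rw [← Set.ncard_pos]; omega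
    rw [Set.insert_eq]
    have hv : (H.induce {v}).Preconnected := by
      rintro ⟨a, rfl⟩ ⟨b, rfl⟩
      exact Reachable.refl _
    exact connected_induce_union hv ih.preconnected rfl hw.2 hw.1

theorem ncard_neighborSet_eq_degree (H : SimpleGraph V) (v : V) [Fintype (H.neighborSet v)] :
    (H.neighborSet v).ncard = H.degree v := by
  rw [Set.ncard_eq_toFinset_card', Set.toFinset_card, card_neighborSet_eq_degree]

theorem sum_ncard_neighborSet [Fintype V] (H : SimpleGraph V) :
    ∑ v, (H.neighborSet v).ncard = 2 * H.edgeSet.ncard := by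
  classical
  simp only [ncard_neighborSet_eq_degree]
  rw [sum_degrees_eq_twice_card_edges, ← coe_edgeFinset, Set.ncard_coe_finset]

/-- A bound for the number of edges, if each vertex outside `T` has few neighbours in `T`. -/
theorem two_mul_ncard_edgeSet_le [Fintype V] (H : SimpleGraph V) (T : Set V) (d : ℕ)
    (h : ∀ v ∉ T, (H.neighborSet v ∩ T).ncard ≤ d) :
    2 * H.edgeSet.ncard ≤ T.ncard * (T.ncard - 1) + 2 * (d * Tᶜ.ncard) +
      Tᶜ.ncard * (Tᶜ.ncard - 1) := by
  classical
  obtain ⟨T, rfl⟩ : ∃ S : Finset V, T = S := ⟨T.toFinset, by simp⟩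
  have hN : ∀ (v : V) (S : Finset V), (H.neighborSet v ∩ S).ncard = (S.filter (H.Adj v)).card := by
    intro v S
    rw [← Set.ncard_coe_finset]
    congr 1
    ext w
    simp [and_comm]
  have hin : ∀ (S : Finset V), ∑ v ∈ S, (S.filter (H.Adj v)).card ≤ S.card * (S.card - 1) := by
    intro S
    refine Finset.sum_le_card_nsmul _ _ _ fun v hv => ?_
    rw [← Finset.card_erase_of_mem hv]
    refine Finset.card_le_card fun w hw => ?_
    rw [Finset.mem_filter] at hw
    exact Finset.mem_erase.2 ⟨hw.2.ne', hw.1⟩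
  have hdeg : ∀ v, (H.neighborSet v).ncard = (T.filter (H.Adj v)).card +
      (Tᶜ.filter (H.Adj v)).card := by
    intro v
    rw [← hN, ← hN, Finset.coe_compl, ← Set.sdiff_eq, Set.ncard_inter_add_ncard_sdiff_eq_ncard]
  -- Each edge between `T` and its complement is counted once from each side. This is the source of
  -- the factor 2 in front of `d` in the bound.
  have hcross : ∑ v ∈ T, (Tᶜ.filter (H.Adj v)).card = ∑ v ∈ Tᶜ, (T.filter (H.Adj v)).card := by
    have := Finset.sum_card_bipartiteAbove_eq_sum_card_bipartiteBelow (s := T) (t := Tᶜ) H.Adj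
    simp only [Finset.bipartiteAbove, Finset.bipartiteBelow] at this
    rw [this]
    simp only [H.adj_comm]
  have hout : ∑ v ∈ Tᶜ, (T.filter (H.Adj v)).card ≤ d * Tᶜ.card := by
    rw [mul_comm, ← smul_eq_mul]
    refine Finset.sum_le_card_nsmul _ _ _ fun v hv => ?_
    rw [← hN]
    exact h v (by simpa using hv)
  rw [← sum_ncard_neighborSet, ← Finset.sum_add_sum_compl T, ← Finset.coe_compl,
    Set.ncard_coe_finset, Set.ncard_coe_finset]
  simp only [hdeg, Finset.sum_add_distrib]
  have h1 := hin T
  have h2 := hin Tᶜ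
  omega

/-- Turán's theorem for triangles: a triangle-free graph on `n` vertices has at most `n² / 4` edges.
-/
theorem exists_isCyclicSet_three [Fintype V]
    (h : Fintype.card V ^ 2 < 4 * H.edgeSet.ncard) : ∃ C, H.IsCyclicSet 3 C := by
  classical
  by_contra! hC
  have hf : H.CliqueFree (2 + 1) := by
    intro s hs
    obtain ⟨a, b, c, hab, hac, hbc, -⟩ := is3Clique_iff.1 hs
    exact hC _ (isCyclicSet_three hab hbc hac.symm)
  have h1 := hf.card_edgeFinset_le
  simp only at h1
  rw [← Set.ncard_coe_finset, coe_edgeFinset] at h1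
  -- The correction term in the Turán number vanishes, since the remainder modulo 2 is less than 2.
  have h2 : (Fintype.card V % 2).choose 2 = 0 := Nat.choose_eq_zero_of_lt (Nat.mod_lt _ two_pos)
  rw [h2] at h1
  omega

end SimpleGraph

/-! ### Consequences of high density: connectedness and growth from triangles. -/

namespace SimpleGraph

variable {V : Type*} {H : SimpleGraph V}

/-- Without connectedness there are two parts with no edges between them, each of at least three
vertices because degrees are at least 2. Such a graph on at most nine vertices has too few edges. -/
theorem connected_of_dense [Fintype V] [Nonempty V] (hn : Fintype.card V ≤ 9)
    (hd : DegreesIn 2 6 H) (he : 6 * Fintype.card V ≤ 2 * H.edgeSet.ncard + 10) :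
    H.Connected := by
  refine ⟨fun u v => ?_⟩
  by_contra huv
  set A : Set V := {w | H.Reachable u w} with hA
  have hclosed : ∀ a b, H.Adj a b → (a ∈ A ↔ b ∈ A) := fun a b hab =>
    ⟨fun h => h.trans hab.reachable, fun h => h.trans hab.symm.reachable⟩
  have three : ∀ (B : Set V) (a : V), a ∈ B → (∀ b, H.Adj a b → b ∈ B) → 3 ≤ B.ncard := by
    intro B a ha hb
    have h1 : insert a (H.neighborSet a) ⊆ B := Set.insert_subset ha hb
    have h2 := Set.ncard_le_ncard h1
    rw [Set.ncard_insert_of_notMem (by simp)] at h2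
    have := (hd a).1
    omega
  have h1 := three A u (Reachable.refl _) fun b hb => hb.reachable
  have h2 := three Aᶜ v huv fun b hb h => huv ((hclosed v b hb).2 h)
  have h3 := two_mul_ncard_edgeSet_le H A 0 fun v hv => by
    rw [Nat.le_zero, Set.ncard_eq_zero, Set.eq_empty_iff_forall_notMem]
    rintro b ⟨hb, hbA⟩
    exact hv ((hclosed v b hb).2 hbA)
  have h4 := Set.ncard_add_ncard_compl A
  rw [Nat.card_eq_fintype_card] at h4
  have h5 : A.ncard ≤ 6 := by omega
  have h6 : Aᶜ.ncard ≤ 6 := by omega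
  generalize A.ncard = k at *
  generalize Aᶜ.ncard = l at *
  interval_cases k <;> interval_cases l <;> omega

/-- A single vertex outside `T` would have all of its at least two neighbours in `T`. -/
theorem two_le_ncard_compl [Finite V] {T : Set V} (hd : DegreesIn 2 6 H) (hT : H.IsGrowthClosed T)
    (hne : T ≠ Set.univ) : 2 ≤ Tᶜ.ncard := by
  obtain ⟨v, hv⟩ := (Set.ne_univ_iff_exists_notMem T).1 hne
  by_contra h
  have h1 : 0 < Tᶜ.ncard := (Set.ncard_pos).2 ⟨v, hv⟩
  obtain ⟨w, hw⟩ := Set.ncard_eq_one.1 (show Tᶜ.ncard = 1 by omega)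
  have h2 := hT v hv
  have h3 := (hd v).1
  have : H.neighborSet v ∩ T = H.neighborSet v := by
    rw [Set.inter_eq_left]
    intro b hb
    by_contra hbT
    have e1 : v = w := by simpa [hw] using (show v ∈ Tᶜ from hv)
    have e2 : b = w := by simpa [hw] using (show b ∈ Tᶜ from hbT)
    exact H.ne_of_adj hb (e1.trans e2.symm)
  rw [this] at h2
  omega

/-- Let `k` and `l` be the sizes of `T` and its complement. The bound `k(k-1) + 2l + l(l-1)` for
twice the number of edges reaches `6(k+l) - 10` only for `(k, l) = (3, 6)` and `(7, 2)`, where it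
equals 48 against the required 44. -/
theorem card_of_isGrowthClosed [Fintype V] (hn : Fintype.card V ≤ 9)
    (hd : DegreesIn 2 6 H) (he : 6 * Fintype.card V ≤ 2 * H.edgeSet.ncard + 10)
    {T : Set V} (hT : H.IsGrowthClosed T) (h3 : 3 ≤ T.ncard) (hne : T ≠ Set.univ) :
    Fintype.card V = 9 ∧ (T.ncard = 3 ∨ T.ncard = 7) := by
  have h2 := two_le_ncard_compl hd hT hne
  have h4 := Set.ncard_add_ncard_compl T
  rw [Nat.card_eq_fintype_card] at h4
  have h5 := two_mul_ncard_edgeSet_le H T 1 hT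
  have h6 : T.ncard ≤ 7 := by omega
  have h7 : Tᶜ.ncard ≤ 6 := by omega
  generalize T.ncard = k at *
  generalize Tᶜ.ncard = l at *
  interval_cases k <;> interval_cases l <;> omega

/-- The edge number exceeds the Turán bound, so a triangle exists. The set where growth from it
stops is not the whole vertex set. -/
theorem exists_isGrowthClosed_of_not_growsFromCycle [Fintype V] (h5 : 5 ≤ Fintype.card V)
    (hn : Fintype.card V ≤ 9) (he : 6 * Fintype.card V ≤ 2 * H.edgeSet.ncard + 10)
    (h : ¬ H.GrowsFromCycle 3) :
    ∃ T, H.IsGrowthClosed T ∧ 3 ≤ T.ncard ∧ T ≠ Set.univ := by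
  have ht : Fintype.card V ^ 2 < 4 * H.edgeSet.ncard := by
    generalize Fintype.card V = n at *
    interval_cases n <;> omega
  obtain ⟨C, hC⟩ := exists_isCyclicSet_three ht
  obtain ⟨T, hT, hcl⟩ := exists_grows_isGrowthClosed H C
  refine ⟨T, hcl, ?_, ?_⟩
  · rw [← hC.ncard_eq]; exact Set.ncard_le_ncard hT.subset
  · rintro rfl
    exact h ⟨C, hC, hT⟩

theorem growsFromCycle_three [Fintype V] (h5 : 5 ≤ Fintype.card V) (hn : Fintype.card V ≤ 8)
    (hd : DegreesIn 2 6 H) (he : 6 * Fintype.card V ≤ 2 * H.edgeSet.ncard + 10) :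
    H.GrowsFromCycle 3 := by
  by_contra h
  obtain ⟨T, h1, h2, h3⟩ := exists_isGrowthClosed_of_not_growsFromCycle h5 (by omega) he h
  have := (card_of_isGrowthClosed (by omega) hd he h1 h2 h3).1
  omega

/-- The graph of the pairs of distinct vertices in `B` that are not adjacent in `H`. -/
def missing (H : SimpleGraph V) (B : Set V) : SimpleGraph V where
  Adj a b := a ≠ b ∧ a ∈ B ∧ b ∈ B ∧ ¬ H.Adj a b
  symm := ⟨fun _ _ ⟨h1, h2, h3, h4⟩ => ⟨h1.symm, h3, h2, fun h => h4 h.symm⟩⟩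
  loopless := ⟨fun _ h => h.1 rfl⟩

theorem ncard_edgeSet_sup_missing [Finite V] (H : SimpleGraph V) (B : Set V) :
    (H ⊔ H.missing B).edgeSet.ncard = H.edgeSet.ncard + (H.missing B).edgeSet.ncard := by
  rw [edgeSet_sup, Set.ncard_union_eq]
  rw [Set.disjoint_left]
  intro e
  induction e with
  | _ a b => exact fun h1 h2 => h2.2.2.2 h1

theorem ncard_neighborSet_sup_missing [Finite V] (H : SimpleGraph V) (B : Set V) (v : V) :
    ((H ⊔ H.missing B).neighborSet v).ncard =
      (H.neighborSet v).ncard + ((H.missing B).neighborSet v).ncard := by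
  have : (H ⊔ H.missing B).neighborSet v = H.neighborSet v ∪ (H.missing B).neighborSet v := rfl
  rw [this, Set.ncard_union_eq]
  rw [Set.disjoint_left]
  exact fun w h1 h2 => h2.2.2.2 h1

/-- If a closed set has only three vertices, the other six span almost a complete graph. A triangle
among these six grows to contain them all, and the closed set that it reaches has seven vertices. -/
theorem exists_isGrowthClosed_seven [Fintype V] (hn : Fintype.card V = 9)
    (hd : DegreesIn 2 6 H) (he : 44 ≤ 2 * H.edgeSet.ncard) (h : ¬ H.GrowsFromCycle 3) :
    ∃ T, H.IsGrowthClosed T ∧ T.ncard = 7 := by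
  obtain ⟨T, h1, h2, h3⟩ := exists_isGrowthClosed_of_not_growsFromCycle (by omega) (by omega)
    (by omega) h
  rcases (card_of_isGrowthClosed (by omega) hd (by omega) h1 h2 h3).2 with h7 | h7
  swap
  · exact ⟨T, h1, h7⟩
  have hc := Set.ncard_add_ncard_compl T
  rw [Nat.card_eq_fintype_card] at hc
  have hc6 : Tᶜ.ncard = 6 := by omega
  set K := H.missing Tᶜ with hK
  -- Filling in the missing pairs outside `T` does not alter the adjacencies to `T`, so the bound 48
  -- still holds for twice the enlarged edge number. At least 44 of it is already used by `H`.
  have hKe : K.edgeSet.ncard ≤ 2 := by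
    have := two_mul_ncard_edgeSet_le (H ⊔ K) T 1 fun v hv => by
      have : (H ⊔ K).neighborSet v ∩ T = H.neighborSet v ∩ T := by
        ext w
        constructor
        · rintro ⟨h4 | h4, h5⟩
          · exact ⟨h4, h5⟩
          · exact (h4.2.2.1 h5).elim
        · exact fun h4 => ⟨Or.inl h4.1, h4.2⟩
      rw [this]
      exact h1 v hv
    rw [hK, ncard_edgeSet_sup_missing, h7, hc6, ← hK] at this
    omega
  have hdeg := sum_ncard_neighborSet K
  classical
  -- `B` consists of the vertices outside `T` that are adjacent to all others outside `T`. At most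
  -- two missing pairs spoil at most four of the six vertices.
  set B : Finset V := Finset.univ.filter fun v => v ∈ Tᶜ ∧ K.neighborSet v = ∅ with hB
  have hB2 : 2 ≤ B.card := by
    have hBc : (Tᶜ.toFinset \ B).card ≤ 4 := by
      calc (Tᶜ.toFinset \ B).card = ∑ v ∈ Tᶜ.toFinset \ B, 1 := by simp
        _ ≤ ∑ v ∈ Tᶜ.toFinset \ B, (K.neighborSet v).ncard := by
          refine Finset.sum_le_sum fun v hv => ?_
          rw [Nat.succ_le_iff, Set.ncard_pos, Set.nonempty_iff_ne_empty]
          intro h0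
          rw [Finset.mem_sdiff, Set.mem_toFinset] at hv
          exact hv.2 (Finset.mem_filter.2 ⟨Finset.mem_univ _, hv.1, h0⟩)
        _ ≤ ∑ v, (K.neighborSet v).ncard :=
          Finset.sum_le_sum_of_subset (Finset.subset_univ _)
        _ ≤ 4 := by omega
    have : Tᶜ.toFinset.card ≤ (Tᶜ.toFinset \ B).card + B.card :=
      Finset.card_le_card_sdiff_add_card
    rw [← Set.ncard_eq_toFinset_card', hc6] at this
    omega
  obtain ⟨b₀, hb₀, b₁, hb₁, hne⟩ := Finset.one_lt_card.1 (show 1 < B.card by omega)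
  have full : ∀ b ∈ B, ∀ v ∈ Tᶜ, v ≠ b → H.Adj v b := by
    intro b hb v hv hvb
    by_contra hadj
    obtain ⟨hb1, hb2⟩ := (Finset.mem_filter.1 hb).2
    have : v ∈ K.neighborSet b := ⟨hvb.symm, hb1, hv, fun h => hadj h.symm⟩
    rw [hb2] at this
    exact this
  have mem : ∀ b ∈ B, b ∈ Tᶜ := fun b hb => (Finset.mem_filter.1 hb).2.1
  obtain ⟨b₂, hb₂, hb₂'⟩ : ∃ b₂ ∈ Tᶜ, b₂ ∉ ({b₀, b₁} : Set V) := by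
    refine Set.exists_mem_notMem_of_ncard_lt_ncard ?_
    rw [Set.ncard_pair hne]; omega
  simp only [Set.mem_insert_iff, Set.mem_singleton_iff, not_or] at hb₂'
  have hC : H.IsCyclicSet 3 {b₀, b₁, b₂} :=
    isCyclicSet_three (full b₁ hb₁ _ (mem b₀ hb₀) hne) (full b₁ hb₁ _ hb₂ hb₂'.2).symm
      (full b₀ hb₀ _ hb₂ hb₂'.1)
  obtain ⟨T', hT', hcl⟩ := exists_grows_isGrowthClosed H {b₀, b₁, b₂}
  -- Every vertex outside `T` other than `b₀`, `b₁` is adjacent to both of them, so a closed set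
  -- that contains these two contains all of the complement.
  have hsub : Tᶜ ⊆ T' := by
    intro v hv
    by_contra hvT
    have hm : ∀ b ∈ ({b₀, b₁, b₂} : Set V), b ∈ T' := fun b hb => hT'.subset hb
    have hp : {b₀, b₁} ⊆ H.neighborSet v ∩ T' := by
      rintro b (rfl | rfl)
      · exact ⟨full _ hb₀ v hv (fun e => hvT (e ▸ hm _ (by simp))), hm _ (by simp)⟩
      · exact ⟨full _ hb₁ v hv (fun e => hvT (e ▸ hm _ (by simp))), hm _ (by simp)⟩
    have := Set.ncard_le_ncard hp
    rw [Set.ncard_pair hne] at this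
    have := hcl v hvT
    omega
  -- Having at least six vertices, `T'` cannot be of size 3.
  have hcard := Set.ncard_le_ncard hsub
  rcases (card_of_isGrowthClosed (by omega) hd (by omega) hcl (by omega) (by
    rintro rfl; exact h ⟨_, hC, hT'⟩)).2 with h8 | h8
  · omega
  · exact ⟨T', hcl, h8⟩

end SimpleGraph

/-! ### Graphs with a closed set of seven vertices among nine. -/

/-- This numbers the vertices so that the distinguished ones become `0, 1, 2, ...`. It is used to
move a graph onto a fixed model on `Fin 9`. -/
theorem exists_equiv_fin {V : Type*} [Fintype V] {n : ℕ} (hn : Fintype.card V = n) {l : List V}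
    (hl : l.Nodup) : ∃ φ : V ≃ Fin n, ∀ (i : ℕ) (h : i < l.length), (φ l[i]).val = i := by
  classical
  set l' := l ++ (Finset.univ \ l.toFinset).toList with hl'
  have hnd : l'.Nodup := by
    rw [hl', List.nodup_append]
    refine ⟨hl, Finset.nodup_toList _, ?_⟩
    rintro a ha _ hb rfl
    simp [ha] at hb
  have hmem : ∀ a, a ∈ l' := by
    intro a
    by_cases h : a ∈ l <;> simp [hl', h]
  have hlen : l'.length = n := by
    rw [← hn, ← List.toFinset_card_of_nodup hnd]
    congr 1
    ext a; simp [hmem]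
  refine ⟨(hnd.getEquivOfForallMemList l' hmem).symm.trans (finCongr hlen), fun i h => ?_⟩
  have hi : i < l'.length := by rw [hl', List.length_append]; omega
  have : l[i] = (hnd.getEquivOfForallMemList l' hmem) ⟨i, hi⟩ := by
    simp [hl', List.getElem_append_left h]
  rw [this]
  simpa using hnd.idxOf_getElem i hi

namespace SimpleGraph

/-- The vertices `u`, `w` are joined to each other, to `x` and to `y`, respectively; all other pairs
except `{p, q}` and `{r, t}` are adjacent. -/
def excGraph {V : Type*} (u w x y p q r t : V) : SimpleGraph V :=
  fromRel fun a b => (a ≠ u ∧ a ≠ w ∧ b ≠ u ∧ b ≠ w ∧ s(a, b) ≠ s(p, q) ∧ s(a, b) ≠ s(r, t)) ∨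
    (a = u ∧ b = w) ∨ (a = u ∧ b = x) ∨ (a = w ∧ b = y)

instance {V : Type*} [DecidableEq V] (u w x y p q r t : V) :
    DecidableRel (excGraph u w x y p q r t).Adj := by
  unfold excGraph; infer_instance

/-- Renaming the vertices of `excGraph`. -/
def excGraphIso {V W : Type*} (e : V ≃ W) (u w x y p q r t : V) :
    excGraph u w x y p q r t ≃g
      excGraph (e u) (e w) (e x) (e y) (e p) (e q) (e r) (e t) where
  toEquiv := e
  map_rel_iff' := by
    intro a b
    simp [excGraph, e.injective.eq_iff]

/-- The models on `Fin 9` of the graphs with growth closed sets of seven vertices. -/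
def excModel (x y p q r t : Fin 9) : SimpleGraph (Fin 9) := excGraph 0 1 x y p q r t

instance (x y p q r t : Fin 9) : DecidableRel (excModel x y p q r t).Adj := by
  unfold excModel; infer_instance

section Classification

variable {V : Type*} {H : SimpleGraph V}

/-- The tuple of parameters on a set with seven vertices whose complement can reach it only
through two edges. -/
structure IsPendantPair (H : SimpleGraph V) (u w x y : V) : Prop where
  ne_uw : u ≠ w
  ne_ux : u ≠ x
  ne_wx : w ≠ x
  ne_uy : u ≠ y
  ne_wy : w ≠ y
  adj_left : ∀ a, H.Adj u a ↔ a = w ∨ a = x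
  adj_right : ∀ a, H.Adj w a ↔ a = u ∨ a = y

/-- An outer vertex has degree at least 2 but at most one neighbour in `T`. It is therefore adjacent
to the other outer vertex and to exactly one vertex of `T`. -/
theorem exists_isPendantPair [Fintype V] (hn : Fintype.card V = 9) (hd : DegreesIn 2 6 H) {T : Set V}
    (hT : H.IsGrowthClosed T) (h7 : T.ncard = 7) :
    ∃ u w x y, H.IsPendantPair u w x y := by
  have hc := Set.ncard_add_ncard_compl T
  rw [Nat.card_eq_fintype_card] at hc
  obtain ⟨u, w, huw, hTc⟩ := Set.ncard_eq_two.1 (show Tᶜ.ncard = 2 by omega)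
  have hmem : ∀ a, a ∉ T ↔ a = u ∨ a = w := fun a => by
    rw [← Set.mem_compl_iff, hTc]; simp
  have key : ∀ a b, a ∉ T → (∀ c, c ∉ T → c = a ∨ c = b) →
      ∃ x ∈ T, ∀ c, H.Adj a c ↔ c = b ∨ c = x := by
    intro a b ha hb
    have h1 := hT a ha
    have h2 := (hd a).1
    have hsub : H.neighborSet a ⊆ insert b (H.neighborSet a ∩ T) := by
      intro c hc
      by_cases hcT : c ∈ T
      · exact Or.inr ⟨hc, hcT⟩
      · rcases hb c hcT with rfl | rfl
        · exact (H.irrefl hc).elim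
        · exact Or.inl rfl
    have h3 := Set.ncard_le_ncard hsub
    have h4 := Set.ncard_insert_le b (H.neighborSet a ∩ T)
    obtain ⟨x, hx⟩ := Set.ncard_eq_one.1 (show (H.neighborSet a ∩ T).ncard = 1 by omega)
    have hxm : x ∈ H.neighborSet a ∩ T := by rw [hx]; rfl
    rw [hx] at hsub h3
    have heq : H.neighborSet a = {b, x} :=
      Set.eq_of_subset_of_ncard_le hsub ((Set.ncard_insert_le _ _).trans (by simpa using h2))
    refine ⟨x, hxm.2, fun c => ?_⟩
    rw [← mem_neighborSet, heq]; simp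
  obtain ⟨x, hx, hux⟩ := key u w ((hmem u).2 (Or.inl rfl)) fun c hc => (hmem c).1 hc
  obtain ⟨y, hy, hwy⟩ := key w u ((hmem w).2 (Or.inr rfl)) fun c hc => ((hmem c).1 hc).symm
  have hne : ∀ a ∈ T, u ≠ a ∧ w ≠ a := fun a ha =>
    ⟨fun e => (hmem a).2 (Or.inl e.symm) ha, fun e => (hmem a).2 (Or.inr e.symm) ha⟩
  exact ⟨u, w, x, y, huw, (hne x hx).1, (hne x hx).2, (hne y hy).1, (hne y hy).2, hux, hwy⟩

namespace IsPendantPair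

variable {u w x y : V} (P : H.IsPendantPair u w x y)

include P

theorem swap : H.IsPendantPair w u y x :=
  ⟨P.ne_uw.symm, P.ne_wy, P.ne_uy, P.ne_wx, P.ne_ux, P.adj_right, P.adj_left⟩

/-- The pairs `{p, q}` and `{r, t}` may coincide, which describes a single missing pair, or be
degenerate, which describes none. -/
theorem eq_excGraph {p q r t : V}
    (hK : ∀ a b, a ≠ b →
      ((H.missing {u, w}ᶜ).Adj a b ↔ s(a, b) = s(p, q) ∨ s(a, b) = s(r, t))) :
    H = excGraph u w x y p q r t := by
  have e1 := P.adj_left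
  have e2 := P.adj_right
  have e1' : ∀ a, H.Adj a u ↔ a = w ∨ a = x := fun a => by rw [H.adj_comm, e1]
  have e2' : ∀ a, H.Adj a w ↔ a = u ∨ a = y := fun a => by rw [H.adj_comm, e2]
  have n1 := P.ne_uw
  have n2 := P.ne_ux
  have n3 := P.ne_wx
  have n4 := P.ne_uy
  have n5 := P.ne_wy
  ext a b
  by_cases hau : a = u
  · subst hau
    rw [e1]
    simp only [excGraph, fromRel_adj]
    grind
  by_cases haw : a = w
  · subst haw
    rw [e2]
    simp only [excGraph, fromRel_adj]
    grind
  by_cases hbu : b = u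
  · subst hbu
    rw [e1']
    simp only [excGraph, fromRel_adj]
    grind
  by_cases hbw : b = w
  · subst hbw
    rw [e2']
    simp only [excGraph, fromRel_adj]
    grind
  by_cases hne : a = b
  · subst hne; simp
  have hab := hK a b hne
  simp only [missing, Set.mem_compl_iff, Set.mem_insert_iff, Set.mem_singleton_iff, hau, haw, hbu,
    hbw, or_self, not_false_eq_true, true_and, ne_eq, hne] at hab
  simp only [excGraph, fromRel_adj, hau, haw, hbu, hbw, ne_eq, not_false_eq_true, true_and,
    false_and, or_false, hne, Sym2.eq_swap (a := b) (b := a), or_self]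
  tauto

/-- With the missing pairs filled in, the inner part is complete. The parameters `u u u u` stand for
no missing pair, because `s(u, u)` is never an edge. -/
theorem sup_missing : H ⊔ H.missing {u, w}ᶜ = excGraph u w x y u u u u := by
  have P' : (H ⊔ H.missing {u, w}ᶜ).IsPendantPair u w x y := by
    refine ⟨P.ne_uw, P.ne_ux, P.ne_wx, P.ne_uy, P.ne_wy, fun a => ?_, fun a => ?_⟩
    · rw [← P.adj_left]
      exact ⟨fun h => h.resolve_right fun h => h.2.1 (by simp), Or.inl⟩
    · rw [← P.adj_right]
      exact ⟨fun h => h.resolve_right fun h => h.2.1 (by simp), Or.inl⟩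
  refine P'.eq_excGraph fun a b hab => ?_
  constructor
  · rintro ⟨-, ha, hb, h⟩
    exact (h (by
      by_cases h' : H.Adj a b
      · exact Or.inl h'
      · exact Or.inr ⟨hab, ha, hb, h'⟩)).elim
  · rw [or_self, Sym2.eq_iff]
    rintro (⟨rfl, rfl⟩ | ⟨rfl, rfl⟩) <;> exact (hab rfl).elim

variable [Fintype V] (hn : Fintype.card V = 9)

include hn

/-- The filled graph has the 21 edges of a complete graph on seven vertices and the three edges
`uw`, `ux`, `wy`. If `x = y` the model is different but has the same number of edges. -/
theorem ncard_edgeSet_add : H.edgeSet.ncard + (H.missing {u, w}ᶜ).edgeSet.ncard = 24 := by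
  rw [← ncard_edgeSet_sup_missing, P.sup_missing]
  by_cases hxy : x = y
  · subst hxy
    obtain ⟨φ, hφ⟩ := exists_equiv_fin hn (l := [u, w, x])
      (by simp [P.ne_uw, P.ne_ux, P.ne_wx])
    have h0 : φ u = 0 := Fin.ext (hφ 0 (by simp))
    have h1 : φ w = 1 := Fin.ext (hφ 1 (by simp))
    have h2 : φ x = 2 := Fin.ext (hφ 2 (by simp))
    have e := excGraphIso φ u w x x u u u u
    rw [h0, h1, h2] at e
    rw [← e.ncard_edgeSet, ← coe_edgeFinset, Set.ncard_coe_finset]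
    decide +kernel
  · obtain ⟨φ, hφ⟩ := exists_equiv_fin hn (l := [u, w, x, y])
      (by simp [P.ne_uw, P.ne_ux, P.ne_wx, P.ne_uy, P.ne_wy, hxy])
    have h0 : φ u = 0 := Fin.ext (hφ 0 (by simp))
    have h1 : φ w = 1 := Fin.ext (hφ 1 (by simp))
    have h2 : φ x = 2 := Fin.ext (hφ 2 (by simp))
    have h3 : φ y = 3 := Fin.ext (hφ 3 (by simp))
    have e := excGraphIso φ u w x y u u u u
    rw [h0, h1, h2, h3] at e
    rw [← e.ncard_edgeSet, ← coe_edgeFinset, Set.ncard_coe_finset]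
    decide +kernel

/-- In the filled graph `x` is adjacent to the six other inner vertices and to `u`. The degree bound
6 thus forces a missing pair at `x`. -/
theorem ncard_neighborSet_add (hxy : x ≠ y) :
    (H.neighborSet x).ncard + ((H.missing {u, w}ᶜ).neighborSet x).ncard = 7 := by
  rw [← ncard_neighborSet_sup_missing, P.sup_missing]
  obtain ⟨φ, hφ⟩ := exists_equiv_fin hn (l := [u, w, x, y])
    (by simp [P.ne_uw, P.ne_ux, P.ne_wx, P.ne_uy, P.ne_wy, hxy])
  have h0 : φ u = 0 := Fin.ext (hφ 0 (by simp))
  have h1 : φ w = 1 := Fin.ext (hφ 1 (by simp))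
  have h2 : φ x = 2 := Fin.ext (hφ 2 (by simp))
  have h3 : φ y = 3 := Fin.ext (hφ 3 (by simp))
  have key : ((excGraph (φ u) (φ w) (φ x) (φ y) (φ u) (φ u) (φ u) (φ u)).neighborSet
    (φ x)).ncard = _ := (excGraphIso φ u w x y u u u u).ncard_neighborSet x
  rw [← key, h0, h1, h2, h3, ncard_neighborSet_eq_degree]
  decide +kernel

/-- Here `x` is joined to both outer vertices, so the degree bound 6 forces two missing pairs at
`x`. -/
theorem ncard_neighborSet_add_of_eq (hxy : x = y) :
    (H.neighborSet x).ncard + ((H.missing {u, w}ᶜ).neighborSet x).ncard = 8 := by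
  rw [← ncard_neighborSet_sup_missing, P.sup_missing]
  subst hxy
  obtain ⟨φ, hφ⟩ := exists_equiv_fin hn (l := [u, w, x])
    (by simp [P.ne_uw, P.ne_ux, P.ne_wx])
  have h0 : φ u = 0 := Fin.ext (hφ 0 (by simp))
  have h1 : φ w = 1 := Fin.ext (hφ 1 (by simp))
  have h2 : φ x = 2 := Fin.ext (hφ 2 (by simp))
  have key : ((excGraph (φ u) (φ w) (φ x) (φ x) (φ u) (φ u) (φ u) (φ u)).neighborSet
    (φ x)).ncard = _ := (excGraphIso φ u w x x u u u u).ncard_neighborSet x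
  rw [← key, h0, h1, h2, ncard_neighborSet_eq_degree]
  decide +kernel

end IsPendantPair

end Classification

end SimpleGraph

/-! ### Isomorphism types with one or two missing pairs. -/

namespace SimpleGraph

theorem ne_of_missing_adj {V : Type*} {H : SimpleGraph V} {u w a b : V}
    (h : (H.missing {u, w}ᶜ).Adj a b) :
    u ≠ a ∧ w ≠ a ∧ u ≠ b ∧ w ≠ b ∧ a ≠ b := by
  obtain ⟨h1, h2, h3, -⟩ := h
  simp only [Set.mem_compl_iff, Set.mem_insert_iff, Set.mem_singleton_iff, not_or] at h2 h3
  exact ⟨Ne.symm h2.1, Ne.symm h2.2, Ne.symm h3.1, Ne.symm h3.2, h1⟩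

namespace IsPendantPair

variable {V : Type*} {H : SimpleGraph V} {u w x y : V} (P : H.IsPendantPair u w x y)
  [Fintype V] (hn : Fintype.card V = 9)

include P hn

/-- This is the case of two missing pairs in which one is `{x, y}` and the other also contains `x`.
The mirror case at `y` is obtained from `IsPendantPair.swap`. -/
theorem iso_of_adj_left {z : V} (hxy : x ≠ y) (hz : z ≠ y)
    (hK : (H.missing {u, w}ᶜ).edgeSet = {s(x, y), s(x, z)}) :
    Nonempty (H ≃g excModel 2 3 2 3 2 4) := by
  have hxz : (H.missing {u, w}ᶜ).Adj x z := by rw [← mem_edgeSet, hK]; simp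
  obtain ⟨-, -, h3, h4, h5⟩ := ne_of_missing_adj hxz
  obtain ⟨φ, hφ⟩ := exists_equiv_fin hn (l := [u, w, x, y, z])
    (by simp [P.ne_uw, P.ne_ux, P.ne_wx, P.ne_uy, P.ne_wy, hxy, h3, h4, h5, hz.symm])
  have g0 : φ u = 0 := Fin.ext (hφ 0 (by simp))
  have g1 : φ w = 1 := Fin.ext (hφ 1 (by simp))
  have g2 : φ x = 2 := Fin.ext (hφ 2 (by simp))
  have g3 : φ y = 3 := Fin.ext (hφ 3 (by simp))
  have g4 : φ z = 4 := Fin.ext (hφ 4 (by simp))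
  have e := excGraphIso φ u w x y x y x z
  rw [g0, g1, g2, g3, g4] at e
  rw [P.eq_excGraph (p := x) (q := y) (r := x) (t := z) fun a b _ => by
    rw [← mem_edgeSet, hK]; simp]
  exact ⟨e⟩

/-- The isomorphism types with a single missing pair. -/
theorem iso_of_ncard_eq_one (hd : DegreesIn 2 6 H)
    (hK : (H.missing {u, w}ᶜ).edgeSet.ncard = 1) : Nonempty (H ≃g excModel 2 3 2 3 2 3) := by
  obtain ⟨e, he⟩ := Set.ncard_eq_one.1 hK
  have hx := (hd x).2
  have hy := (hd y).2
  have huniq : ∀ a b, (H.missing {u, w}ᶜ).Adj a b → s(a, b) = e := by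
    intro a b hab
    rw [← mem_edgeSet, he] at hab
    exact hab
  by_cases hxy : x = y
  -- For `x = y` two missing pairs are needed at `x`, but there is only one.
  · have h8 := P.ncard_neighborSet_add_of_eq hn hxy
    obtain ⟨p, q, hp, hq, hpq⟩ := (Set.one_lt_ncard_iff (Set.toFinite _)).1
      (show 1 < ((H.missing {u, w}ᶜ).neighborSet x).ncard by omega)
    have h1 := (huniq _ _ hp).trans (huniq _ _ hq).symm
    rw [Sym2.eq_iff] at h1
    rcases h1 with h1 | h1
    · exact (hpq h1.2).elim
    · exact (hpq (h1.2.trans h1.1)).elim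
  · have h7 := P.ncard_neighborSet_add hn hxy
    have h7' := P.swap.ncard_neighborSet_add hn (Ne.symm hxy)
    rw [Set.pair_comm] at h7'
    obtain ⟨p, hp⟩ := (Set.ncard_pos (Set.toFinite _)).1
      (show 0 < ((H.missing {u, w}ᶜ).neighborSet x).ncard by omega)
    obtain ⟨q, hq⟩ := (Set.ncard_pos (Set.toFinite _)).1
      (show 0 < ((H.missing {u, w}ᶜ).neighborSet y).ncard by omega)
    have h1 := huniq _ _ hp
    have h2 := huniq _ _ hq
    -- The only missing pair must contain both `x` and `y`.
    have h3 : s(x, y) = e := by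
      rw [← h1]
      rw [← h1, Sym2.eq_iff] at h2
      rcases h2 with h2 | h2
      · exact (hxy h2.1.symm).elim
      · rw [h2.1]
    obtain ⟨φ, hφ⟩ := exists_equiv_fin hn (l := [u, w, x, y])
      (by simp [P.ne_uw, P.ne_ux, P.ne_wx, P.ne_uy, P.ne_wy, hxy])
    have g0 : φ u = 0 := Fin.ext (hφ 0 (by simp))
    have g1 : φ w = 1 := Fin.ext (hφ 1 (by simp))
    have g2 : φ x = 2 := Fin.ext (hφ 2 (by simp))
    have g3 : φ y = 3 := Fin.ext (hφ 3 (by simp))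
    have e' := excGraphIso φ u w x y x y x y
    rw [g0, g1, g2, g3] at e'
    rw [P.eq_excGraph (p := x) (q := y) (r := x) (t := y) fun a b _ => by
      rw [← mem_edgeSet, he, h3]; simp]
    exact ⟨e'⟩

/-- The isomorphism types with two missing pairs. -/
theorem iso_of_ncard_eq_two (hd : DegreesIn 2 6 H)
    (hK : (H.missing {u, w}ᶜ).edgeSet.ncard = 2) :
    Nonempty (H ≃g excModel 2 3 2 3 2 4) ∨ Nonempty (H ≃g excModel 2 3 2 3 4 5) ∨
    Nonempty (H ≃g excModel 2 3 2 4 3 4) ∨ Nonempty (H ≃g excModel 2 3 2 4 3 5) ∨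
    Nonempty (H ≃g excModel 2 2 2 3 2 4) := by
  have hx := (hd x).2
  have hy := (hd y).2
  have hfin : (H.missing {u, w}ᶜ).edgeSet.Finite := Set.toFinite _
  have hpair : ∀ a b c d, (H.missing {u, w}ᶜ).Adj a b → (H.missing {u, w}ᶜ).Adj c d →
      s(a, b) ≠ s(c, d) → (H.missing {u, w}ᶜ).edgeSet = {s(a, b), s(c, d)} := by
    intro a b c d hab hcd hne
    symm
    refine Set.eq_of_subset_of_ncard_le ?_ (by rw [hK, Set.ncard_pair hne]) hfin
    rintro _ (rfl | rfl)
    · exact hab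
    · exact hcd
  -- For `x = y` both missing pairs contain `x`, and their other ends differ.
  by_cases hxy : x = y
  · have h8 := P.ncard_neighborSet_add_of_eq hn hxy
    obtain ⟨p, q, hp, hq, hpq⟩ := (Set.one_lt_ncard_iff (Set.toFinite _)).1
      (show 1 < ((H.missing {u, w}ᶜ).neighborSet x).ncard by omega)
    have hK2 := hpair _ _ _ _ hp hq (by
      rw [ne_eq, Sym2.eq_iff]
      rintro (⟨-, h⟩ | ⟨h, h'⟩)
      · exact hpq h
      · exact hpq (h'.trans h))
    subst hxy
    obtain ⟨-, -, h3, h4, h5⟩ := ne_of_missing_adj hp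
    obtain ⟨-, -, h3', h4', h5'⟩ := ne_of_missing_adj hq
    obtain ⟨φ, hφ⟩ := exists_equiv_fin hn (l := [u, w, x, p, q])
      (by simp [P.ne_uw, P.ne_ux, P.ne_wx, h3, h4, h5, h3', h4', h5', hpq])
    have g0 : φ u = 0 := Fin.ext (hφ 0 (by simp))
    have g1 : φ w = 1 := Fin.ext (hφ 1 (by simp))
    have g2 : φ x = 2 := Fin.ext (hφ 2 (by simp))
    have g3 : φ p = 3 := Fin.ext (hφ 3 (by simp))
    have g4 : φ q = 4 := Fin.ext (hφ 4 (by simp))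
    have e' := excGraphIso φ u w x x x p x q
    rw [g0, g1, g2, g3, g4] at e'
    rw [P.eq_excGraph (p := x) (q := p) (r := x) (t := q) fun a b _ => by
      rw [← mem_edgeSet, hK2]; simp]
    exact Or.inr (Or.inr (Or.inr (Or.inr ⟨e'⟩)))
  have h7 := P.ncard_neighborSet_add hn hxy
  have h7' := P.swap.ncard_neighborSet_add hn (Ne.symm hxy)
  rw [Set.pair_comm] at h7'
  -- If `{x, y}` is missing it serves both degree bounds, and the second pair meets it in `x`, in
  -- `y`, or not at all. Otherwise `x` and `y` lie in separate missing pairs, whose other ends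
  -- either coincide or differ.
  by_cases hadj : (H.missing {u, w}ᶜ).Adj x y
  · obtain ⟨e, he, hne⟩ := Set.exists_ne_of_one_lt_ncard
      (show 1 < (H.missing {u, w}ᶜ).edgeSet.ncard by omega) s(x, y)
    induction e using Sym2.ind with
    | _ p q =>
      have hK2 := hpair x y p q hadj he hne.symm
      by_cases hpx : p = x
      · subst hpx
        exact Or.inl (P.iso_of_adj_left hn hxy (fun h => hne (by rw [h])) hK2)
      by_cases hqx : q = x
      · subst hqx
        refine Or.inl (P.iso_of_adj_left hn hxy (z := p) (fun h => hne (by rw [h, Sym2.eq_swap])) ?_)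
        rw [hK2, Sym2.eq_swap (a := p)]
      by_cases hpy : p = y
      · subst hpy
        refine Or.inl (P.swap.iso_of_adj_left hn (Ne.symm hxy) (z := q) hqx ?_)
        rw [Set.pair_comm w u, hK2, Sym2.eq_swap (a := x)]
      by_cases hqy : q = y
      · subst hqy
        refine Or.inl (P.swap.iso_of_adj_left hn (Ne.symm hxy) (z := p) hpx ?_)
        rw [Set.pair_comm w u, hK2, Sym2.eq_swap (a := x), Sym2.eq_swap (a := p)]
      obtain ⟨h1, h2, h3, h4, h5⟩ := ne_of_missing_adj he
      obtain ⟨φ, hφ⟩ := exists_equiv_fin hn (l := [u, w, x, y, p, q])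
        (by simp [P.ne_uw, P.ne_ux, P.ne_wx, P.ne_uy, P.ne_wy, hxy, h1, h2, h3, h4, h5,
              Ne.symm hpx, Ne.symm hqx, Ne.symm hpy, Ne.symm hqy])
      have g0 : φ u = 0 := Fin.ext (hφ 0 (by simp))
      have g1 : φ w = 1 := Fin.ext (hφ 1 (by simp))
      have g2 : φ x = 2 := Fin.ext (hφ 2 (by simp))
      have g3 : φ y = 3 := Fin.ext (hφ 3 (by simp))
      have g4 : φ p = 4 := Fin.ext (hφ 4 (by simp))
      have g5 : φ q = 5 := Fin.ext (hφ 5 (by simp))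
      have e' := excGraphIso φ u w x y x y p q
      rw [g0, g1, g2, g3, g4, g5] at e'
      rw [P.eq_excGraph (p := x) (q := y) (r := p) (t := q) fun a b _ => by
        rw [← mem_edgeSet, hK2]; simp]
      exact Or.inr (Or.inl ⟨e'⟩)
  obtain ⟨p, hp⟩ := (Set.ncard_pos (Set.toFinite _)).1
    (show 0 < ((H.missing {u, w}ᶜ).neighborSet x).ncard by omega)
  obtain ⟨q, hq⟩ := (Set.ncard_pos (Set.toFinite _)).1
    (show 0 < ((H.missing {u, w}ᶜ).neighborSet y).ncard by omega)
  have hpy : p ≠ y := by rintro rfl; exact hadj hp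
  have hqx : q ≠ x := by rintro rfl; exact hadj hq.symm
  have hK2 := hpair _ _ _ _ hp hq (by
    rw [ne_eq, Sym2.eq_iff]
    rintro (⟨h, -⟩ | ⟨h, -⟩)
    · exact hxy h
    · exact hqx h.symm)
  obtain ⟨-, -, h3, h4, h5⟩ := ne_of_missing_adj hp
  obtain ⟨-, -, h3', h4', h5'⟩ := ne_of_missing_adj hq
  have heq := P.eq_excGraph (p := x) (q := p) (r := y) (t := q) fun a b _ => by
    rw [← mem_edgeSet, hK2]; simp
  by_cases hpq : p = q
  · subst hpq
    obtain ⟨φ, hφ⟩ := exists_equiv_fin hn (l := [u, w, x, y, p])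
      (by simp [P.ne_uw, P.ne_ux, P.ne_wx, P.ne_uy, P.ne_wy, hxy, h3, h4, h5, h5'])
    have g0 : φ u = 0 := Fin.ext (hφ 0 (by simp))
    have g1 : φ w = 1 := Fin.ext (hφ 1 (by simp))
    have g2 : φ x = 2 := Fin.ext (hφ 2 (by simp))
    have g3 : φ y = 3 := Fin.ext (hφ 3 (by simp))
    have g4 : φ p = 4 := Fin.ext (hφ 4 (by simp))
    have e' := excGraphIso φ u w x y x p y p
    rw [g0, g1, g2, g3, g4] at e'
    rw [heq]
    exact Or.inr (Or.inr (Or.inl ⟨e'⟩))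
  · obtain ⟨φ, hφ⟩ := exists_equiv_fin hn (l := [u, w, x, y, p, q])
      (by simp [P.ne_uw, P.ne_ux, P.ne_wx, P.ne_uy, P.ne_wy, hxy, h3, h4, h5, h3', h4', h5', hpq,
        hpy.symm, hqx.symm])
    have g0 : φ u = 0 := Fin.ext (hφ 0 (by simp))
    have g1 : φ w = 1 := Fin.ext (hφ 1 (by simp))
    have g2 : φ x = 2 := Fin.ext (hφ 2 (by simp))
    have g3 : φ y = 3 := Fin.ext (hφ 3 (by simp))
    have g4 : φ p = 4 := Fin.ext (hφ 4 (by simp))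
    have g5 : φ q = 5 := Fin.ext (hφ 5 (by simp))
    have e' := excGraphIso φ u w x y x p y q
    rw [g0, g1, g2, g3, g4, g5] at e'
    rw [heq]
    exact Or.inr (Or.inr (Or.inr (Or.inl ⟨e'⟩)))

end IsPendantPair

end SimpleGraph

/-! ### Growth certificates and lower bounds for the generating cycles. -/

namespace SimpleGraph

section

variable {V : Type*} {H : SimpleGraph V}

theorem isCyclicSet_image {k : ℕ} (hk : 3 ≤ k) (g : ℕ → V)
    (hinj : ∀ i < k, ∀ j < k, g i = g j → i = j) (hadj : ∀ i < k, H.Adj (g i) (g ((i + 1) % k))) :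
    H.IsCyclicSet k (g '' Set.Iio k) := by
  have hlt : ∀ i, i % k < k := fun i => Nat.mod_lt _ (by omega)
  refine ⟨hk, fun i => g (i % k), fun i hi j hj h => ?_, fun i => by simp, fun i => ?_, ?_⟩
  · simp only [Nat.mod_eq_of_lt hi, Nat.mod_eq_of_lt hj] at h
    exact hinj i hi j hj h
  · have := hadj (i % k) (hlt i)
    rwa [Nat.mod_add_mod] at this
  · ext v
    constructor
    · rintro ⟨i, hi, rfl⟩
      exact ⟨i, by simp only [Nat.mod_eq_of_lt (Set.mem_Iio.1 hi)]⟩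
    · rintro ⟨i, rfl⟩
      exact ⟨i % k, hlt i, rfl⟩

/-- The vertices of the list can be added one after the other. -/
def CanGrow (H : SimpleGraph V) [DecidableEq V] [DecidableRel H.Adj] : Finset V → List V → Prop
  | _, [] => True
  | S, v :: l => v ∉ S ∧ 2 ≤ (S.filter (H.Adj v)).card ∧ CanGrow H (insert v S) l

instance CanGrow.decidable (H : SimpleGraph V) [DecidableEq V] [DecidableRel H.Adj] :
    ∀ (S : Finset V) (l : List V), Decidable (H.CanGrow S l)
  | _, [] => .isTrue trivial
  | S, v :: l =>
    have := CanGrow.decidable H (insert v S) l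
    inferInstanceAs (Decidable (_ ∧ _ ∧ _))

theorem Grows.of_canGrow [DecidableEq V] [DecidableRel H.Adj] {C : Set V} {S : Finset V}
    (h : H.Grows C S) {l : List V} (hl : H.CanGrow S l) :
    H.Grows C (l.foldl (fun S v => insert v S) S : Finset V) := by
  induction l generalizing S with
  | nil => exact h
  | cons v l ih =>
    obtain ⟨h1, h2, h3⟩ := hl
    refine ih (S := insert v S) ?_ h3
    rw [Finset.coe_insert]
    refine h.step (by simpa using h1) ?_
    have : H.neighborSet v ∩ S = (S.filter (H.Adj v) : Finset V) := by
      ext w; simp [and_comm]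
    rwa [this, Set.ncard_coe_finset]

/-- A decidable certificate: `g` lists the cycle, and `l` lists the remaining vertices in an order
in which they can be added. -/
theorem growsFromCycle_of_lists [Fintype V] [DecidableEq V] [DecidableRel H.Adj] {k : ℕ}
    (hk : 3 ≤ k) (g : ℕ → V) (l : List V) (hinj : ∀ i < k, ∀ j < k, g i = g j → i = j)
    (hadj : ∀ i < k, H.Adj (g i) (g ((i + 1) % k)))
    (hl : H.CanGrow ((Finset.range k).image g) l)
    (huniv : l.foldl (fun S v => insert v S) ((Finset.range k).image g) = Finset.univ) :
    H.GrowsFromCycle k := by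
  refine ⟨_, isCyclicSet_image hk g hinj hadj, ?_⟩
  have : g '' Set.Iio k = ((Finset.range k).image g : Finset V) := by ext; simp
  rw [this]
  have := Grows.of_canGrow (.refl : H.Grows (((Finset.range k).image g : Finset V) : Set V) _) hl
  rwa [huniv, Finset.coe_univ] at this

/-- Twice the least length of a cycle from which the whole vertex set grows. -/
noncomputable def growthType (H : SimpleGraph V) : ℕ∞ :=
  ⨅ (k : ℕ) (_ : H.GrowsFromCycle k), ((2 * k : ℕ) : ℕ∞)

theorem GrowsFromCycle.three_le {k : ℕ} (h : H.GrowsFromCycle k) : 3 ≤ k := by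
  obtain ⟨C, hC, -⟩ := h
  exact hC.1

theorem growthType_iso {W : Type*} {H' : SimpleGraph W} (e : H ≃g H') :
    H'.growthType = H.growthType := by
  unfold growthType
  have : ∀ k, H'.GrowsFromCycle k ↔ H.GrowsFromCycle k := fun k =>
    ⟨fun h => h.map e.symm, fun h => h.map e⟩
  simp only [this]

theorem growthType_eq {k : ℕ} (h : H.GrowsFromCycle k) (h' : ∀ l < k, ¬ H.GrowsFromCycle l) :
    H.growthType = (2 * k : ℕ) := by
  apply le_antisymm
  · exact iInf₂_le k h
  · refine le_iInf₂ fun l hl => ?_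
    have : k ≤ l := not_lt.1 fun hlt => h' l hlt hl
    exact_mod_cast Nat.mul_le_mul_left 2 this

theorem growthType_eq_top (h : ∀ k, ¬ H.GrowsFromCycle k) : H.growthType = ⊤ := by
  simp [growthType, h]

theorem GrowsFromCycle.growthType_eq_six (h : H.GrowsFromCycle 3) : H.growthType = 6 :=
  growthType_eq h fun l hl hg => by have := hg.three_le; omega

namespace IsPendantPair

variable {u w x y : V} (P : H.IsPendantPair u w x y)

include P

theorem isGrowthClosed : H.IsGrowthClosed {u, w}ᶜ := by
  intro v hv
  have hv : v = u ∨ v = w := by rwa [Set.notMem_compl_iff] at hv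
  rcases hv with rfl | rfl
  · rw [← Set.ncard_singleton x]
    refine Set.ncard_le_ncard ?_
    rintro c ⟨h1, h2⟩
    rcases (P.adj_left c).1 h1 with rfl | rfl
    · simp at h2
    · rfl
  · rw [← Set.ncard_singleton y]
    refine Set.ncard_le_ncard ?_
    rintro c ⟨h1, h2⟩
    rcases (P.adj_right c).1 h1 with rfl | rfl
    · simp at h2
    · rfl

/-- A cycle through a vertex of degree 2 uses both of its neighbours. -/
theorem mem_of_mem_left {k : ℕ} {C : Set V} (hC : H.IsCyclicSet k C) (hu : u ∈ C) :
    w ∈ C ∧ x ∈ C := by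
  have h := hC.two_le_ncard hu
  have hN : H.neighborSet u = {w, x} := by ext c; simp [P.adj_left]
  rw [hN] at h
  have hsub : ({w, x} : Set V) ∩ C = {w, x} :=
    Set.eq_of_subset_of_ncard_le Set.inter_subset_left ((Set.ncard_insert_le _ _).trans (by simpa using h))
  have hsub : ({w, x} : Set V) ⊆ C := Set.inter_eq_left.1 hsub
  exact ⟨hsub (by simp), hsub (by simp)⟩

variable [Finite V]

/-- The seven inner vertices form a closed set, so growth that starts inside never leaves them. -/
theorem mem_or_mem {C : Set V} (hg : H.Grows C Set.univ) : u ∈ C ∨ w ∈ C := by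
  by_contra! h
  have hsub : C ⊆ {u, w}ᶜ := by
    rintro c hc (rfl | rfl)
    · exact h.1 hc
    · exact h.2 hc
  exact hg.subset_of_closed hsub P.isGrowthClosed (Set.mem_univ u) (by simp)

theorem subset_of_grows {k : ℕ} {C : Set V} (hC : H.IsCyclicSet k C) (hg : H.Grows C Set.univ) :
    {u, w, x, y} ⊆ C := by
  have key : u ∈ C ∧ w ∈ C := by
    rcases P.mem_or_mem hg with h | h
    · exact ⟨h, (P.mem_of_mem_left hC h).1⟩
    · exact ⟨(P.swap.mem_of_mem_left hC h).1, h⟩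
  have h1 := (P.mem_of_mem_left hC key.1).2
  have h2 := (P.swap.mem_of_mem_left hC key.2).2
  rintro c (rfl | rfl | rfl | rfl)
  exacts [key.1, key.2, h1, h2]

theorem ncard_four (hxy : x ≠ y) : ({u, w, x, y} : Set V).ncard = 4 := by
  rw [Set.ncard_insert_of_notMem (by simp [P.ne_uw, P.ne_ux, P.ne_uy]),
    Set.ncard_insert_of_notMem (by simp [P.ne_wx, P.ne_wy]), Set.ncard_pair hxy]

theorem four_le_of_growsFromCycle (hxy : x ≠ y) {k : ℕ} (h : H.GrowsFromCycle k) : 4 ≤ k := by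
  obtain ⟨C, hC, hg⟩ := h
  rw [← hC.ncard_eq, ← P.ncard_four hxy]
  exact Set.ncard_le_ncard (P.subset_of_grows hC hg)

/-- A cycle of length 4 would have exactly the vertices `u`, `w`, `x`, `y`. Among these `x` has only
the neighbour `u`. -/
theorem five_le_of_growsFromCycle (hxy : x ≠ y) (hadj : ¬ H.Adj x y) {k : ℕ}
    (h : H.GrowsFromCycle k) : 5 ≤ k := by
  have h4 := P.four_le_of_growsFromCycle hxy h
  obtain ⟨C, hC, hg⟩ := h
  by_contra h5
  have hsub := P.subset_of_grows hC hg
  have heq : {u, w, x, y} = C :=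
    Set.eq_of_subset_of_ncard_le hsub (by rw [hC.ncard_eq, P.ncard_four hxy]; omega)
  have h2 := hC.two_le_ncard (hsub (by simp : x ∈ ({u, w, x, y} : Set V)))
  have : H.neighborSet x ∩ C ⊆ {u} := by
    rw [← heq]
    rintro c ⟨h1, rfl | rfl | rfl | rfl⟩
    · rfl
    · have := (P.adj_right x).1 h1.symm
      rcases this with h | h
      · exact (P.ne_ux h.symm).elim
      · exact (hxy h).elim
    · exact (H.irrefl h1).elim
    · exact (hadj h1).elim
  have := Set.ncard_le_ncard this
  rw [Set.ncard_singleton] at this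
  omega

/-- The cycle must contain `u` and `w`, hence passes through `x, u, w, x` and is a triangle. That
triangle is closed: a vertex outside it can be adjacent only to `x`. -/
theorem not_growsFromCycle (hxy : x = y) (h4 : 4 ≤ Nat.card V) (k : ℕ) :
    ¬ H.GrowsFromCycle k := by
  subst hxy
  rintro ⟨C, hC, hg⟩
  have hsub := P.subset_of_grows hC hg
  have hCn := hC.ncard_eq
  have h3 : k = 3 := by
    obtain ⟨hk, f, h1, h2, hadj, rfl⟩ := hC
    -- If `u` and `w` are consecutive at positions `j + 1` and `j + 2`, their other neighbours at
    -- `j` and `j + 3` are both `x`. Hence the period divides 3.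
    have main : ∀ j, (f (j + 1) = u ∧ f (j + 2) = w ∨ f (j + 1) = w ∧ f (j + 2) = u) →
        k = 3 := by
      intro j hj
      have e0 := hadj j
      have e2 := hadj (j + 2)
      have n1 := IsCyclicSet.ne_add_two h1 h2 hk j
      have n2 := IsCyclicSet.ne_add_two h1 h2 hk (j + 1)
      have : f j = f (j + 3) := by
        rcases hj with ⟨ha, hb⟩ | ⟨ha, hb⟩
        · rw [ha] at e0 n2
          rw [hb] at e2 n1
          have q0 := ((P.adj_left _).1 e0.symm).resolve_left n1
          have q2 := ((P.adj_right _).1 e2).resolve_left (Ne.symm n2)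
          exact q0.trans q2.symm
        · rw [ha] at e0 n2
          rw [hb] at e2 n1
          have q0 := ((P.adj_right _).1 e0.symm).resolve_left n1
          have q2 := ((P.adj_left _).1 e2).resolve_left (Ne.symm n2)
          exact q0.trans q2.symm
      have h3 : j ≡ j + 3 [MOD k] := IsCyclicSet.eq_mod h1 h2 (by omega) this
      have h4 : k ∣ 3 := by simpa using (Nat.modEq_iff_dvd' (by omega)).1 h3
      have := Nat.le_of_dvd (by omega) h4
      omega
    obtain ⟨i, hi⟩ := hsub (by simp : u ∈ ({u, w, x, x} : Set V))
    have hi' : f (i + k) = u := (h2 i).trans hi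
    have en := hadj (i + k)
    have ep := hadj (i + k - 1)
    rw [show i + k - 1 + 1 = i + k by omega, hi'] at ep
    rw [hi'] at en
    have nn := IsCyclicSet.ne_add_two h1 h2 hk (i + k - 1)
    rw [show i + k - 1 + 2 = i + k + 1 by omega] at nn
    rcases (P.adj_left _).1 en with h | h
    · refine main (i + k - 1) (Or.inl ⟨?_, ?_⟩)
      · rwa [show i + k - 1 + 1 = i + k by omega]
      · rwa [show i + k - 1 + 2 = i + k + 1 by omega]
    · rcases (P.adj_left _).1 ep.symm with h' | h'
      · refine main (i + k - 2) (Or.inr ⟨?_, ?_⟩)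
        · rwa [show i + k - 2 + 1 = i + k - 1 by omega]
        · rwa [show i + k - 2 + 2 = i + k by omega]
      -- Both neighbours of `u` on the cycle would be `x`, although they are distinct.
      · exact (nn (h'.trans h.symm)).elim
  have hthree : ({u, w, x} : Set V).ncard = 3 := by
    rw [Set.ncard_insert_of_notMem (by simp [P.ne_uw, P.ne_ux]), Set.ncard_pair P.ne_wx]
  have heq : {u, w, x} = C := by
    refine Set.eq_of_subset_of_ncard_le (fun c hc => hsub ?_) (by rw [hthree, hCn, h3])
    rcases hc with rfl | rfl | rfl <;> simp
  have hclosed : H.IsGrowthClosed {u, w, x} := by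
    intro v hv
    simp only [Set.mem_insert_iff, Set.mem_singleton_iff, not_or] at hv
    rw [← Set.ncard_singleton x]
    refine Set.ncard_le_ncard ?_
    rintro c ⟨h1, rfl | rfl | rfl⟩
    · rcases (P.adj_left _).1 h1.symm with h | h
      · exact (hv.2.1 h).elim
      · exact (hv.2.2 h).elim
    · rcases (P.adj_right _).1 h1.symm with h | h
      · exact (hv.1 h).elim
      · exact (hv.2.2 h).elim
    · rfl
  have := hg.subset_of_closed heq.ge hclosed
  have := Set.ncard_le_ncard this
  rw [hthree, Set.ncard_univ] at this
  omega

end IsPendantPair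

end

end SimpleGraph

/-! ### The six exceptional graphs and their types. -/

namespace SimpleGraph

theorem isPendantPair_excModel {x y p q r t : Fin 9} (hx : (0 : Fin 9) ≠ x ∧ (1 : Fin 9) ≠ x)
    (hy : (0 : Fin 9) ≠ y ∧ (1 : Fin 9) ≠ y) : (excModel x y p q r t).IsPendantPair 0 1 x y := by
  obtain ⟨h1, h2⟩ := hx
  obtain ⟨h3, h4⟩ := hy
  refine ⟨by decide, h1, h2, h3, h4, fun a => ?_, fun a => ?_⟩
  · simp only [excModel, excGraph, fromRel_adj]
    grind
  · simp only [excModel, excGraph, fromRel_adj]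
    grind

theorem degreesIn_iff_of_fintype {V : Type*} [Fintype V] (H : SimpleGraph V) [DecidableRel H.Adj]
    (lo hi : ℕ) : DegreesIn lo hi H ↔ ∀ v, lo ≤ H.degree v ∧ H.degree v ≤ hi := by
  simp only [DegreesIn, ncard_neighborSet_eq_degree]

/-- The degrees and the number of edges of a graph, checked by computation. -/
theorem degreesIn_and_ncard_edgeSet {V : Type*} [Fintype V] [DecidableEq V] (H : SimpleGraph V)
    [DecidableRel H.Adj] {lo hi m : ℕ} (h1 : ∀ v, lo ≤ H.degree v ∧ H.degree v ≤ hi)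
    (h2 : ∑ v, H.degree v = 2 * m) : DegreesIn lo hi H ∧ H.edgeSet.ncard = m := by
  refine ⟨(degreesIn_iff_of_fintype H lo hi).2 h1, ?_⟩
  have := sum_ncard_neighborSet H
  simp only [ncard_neighborSet_eq_degree] at this
  omega

/-- The type `10` graph with `23` edges. -/
abbrev model23 : SimpleGraph (Fin 9) := excModel 2 3 2 3 2 3

/-- The first graph with `22` edges and type `10`. -/
abbrev model22a : SimpleGraph (Fin 9) := excModel 2 3 2 3 2 4

/-- The second graph with `22` edges and type `10`. -/
abbrev model22b : SimpleGraph (Fin 9) := excModel 2 3 2 3 4 5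

/-- The first graph with `22` edges and type `8`. -/
abbrev model22c : SimpleGraph (Fin 9) := excModel 2 3 2 4 3 4

/-- The second graph with `22` edges and type `8`. -/
abbrev model22d : SimpleGraph (Fin 9) := excModel 2 3 2 4 3 5

/-- The graph with `22` edges that does not grow from any cycle. -/
abbrev model22e : SimpleGraph (Fin 9) := excModel 2 2 2 3 2 4

theorem model23_mem : DegreesIn 2 6 model23 ∧ model23.edgeSet.ncard = 23 :=
  degreesIn_and_ncard_edgeSet _ (by decide +kernel) (by decide +kernel)

theorem model22a_mem : DegreesIn 2 6 model22a ∧ model22a.edgeSet.ncard = 22 :=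
  degreesIn_and_ncard_edgeSet _ (by decide +kernel) (by decide +kernel)

theorem model22b_mem : DegreesIn 2 6 model22b ∧ model22b.edgeSet.ncard = 22 :=
  degreesIn_and_ncard_edgeSet _ (by decide +kernel) (by decide +kernel)

theorem model22c_mem : DegreesIn 2 6 model22c ∧ model22c.edgeSet.ncard = 22 :=
  degreesIn_and_ncard_edgeSet _ (by decide +kernel) (by decide +kernel)

theorem model22d_mem : DegreesIn 2 6 model22d ∧ model22d.edgeSet.ncard = 22 :=
  degreesIn_and_ncard_edgeSet _ (by decide +kernel) (by decide +kernel)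

theorem model22e_mem : DegreesIn 2 6 model22e ∧ model22e.edgeSet.ncard = 22 :=
  degreesIn_and_ncard_edgeSet _ (by decide +kernel) (by decide +kernel)

theorem growthType_of_not_adj {p q r t : Fin 9} (hadj : ¬ (excModel 2 3 p q r t).Adj 2 3)
    (h : (excModel 2 3 p q r t).GrowsFromCycle 5) : (excModel 2 3 p q r t).growthType = 10 :=
  growthType_eq h fun l hl hg => by
    have := (isPendantPair_excModel (by decide) (by decide)).five_le_of_growsFromCycle
      (by decide) hadj hg
    omega

theorem growthType_of_adj {p q r t : Fin 9}
    (h : (excModel 2 3 p q r t).GrowsFromCycle 4) : (excModel 2 3 p q r t).growthType = 8 :=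
  growthType_eq h fun l hl hg => by
    have := (isPendantPair_excModel (by decide) (by decide)).four_le_of_growsFromCycle
      (by decide) hg
    omega

/-- The cycle is `u, x, 8, y, w`, where `8` is a common neighbour of the nonadjacent vertices `x =
2` and `y = 3`. The default value of `getD` is never used within the cycle. -/
theorem growthType_model23 : model23.growthType = 10 :=
  growthType_of_not_adj (by decide +kernel) (growsFromCycle_of_lists (by decide)
    (fun i => ([0, 2, 8, 3, 1] : List (Fin 9)).getD i 0) [4, 5, 6, 7]
    (by decide) (by decide +kernel) (by decide +kernel) (by decide +kernel))

theorem growthType_model22a : model22a.growthType = 10 :=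
  growthType_of_not_adj (by decide +kernel) (growsFromCycle_of_lists (by decide)
    (fun i => ([0, 2, 8, 3, 1] : List (Fin 9)).getD i 0) [5, 6, 7, 4]
    (by decide) (by decide +kernel) (by decide +kernel) (by decide +kernel))

theorem growthType_model22b : model22b.growthType = 10 :=
  growthType_of_not_adj (by decide +kernel) (growsFromCycle_of_lists (by decide)
    (fun i => ([0, 2, 8, 3, 1] : List (Fin 9)).getD i 0) [4, 5, 6, 7]
    (by decide) (by decide +kernel) (by decide +kernel) (by decide +kernel))

/-- Here `x = 2` and `y = 3` are adjacent, and `0, 2, 3, 1` is a 4-cycle. Vertex `4` is adjacent to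
neither `2` nor `3`, so it is added after other inner vertices. -/
theorem growthType_model22c : model22c.growthType = 8 :=
  growthType_of_adj (growsFromCycle_of_lists (by decide)
    (fun i => ([0, 2, 3, 1] : List (Fin 9)).getD i 0) [5, 6, 7, 8, 4]
    (by decide) (by decide +kernel) (by decide +kernel) (by decide +kernel))

theorem growthType_model22d : model22d.growthType = 8 :=
  growthType_of_adj (growsFromCycle_of_lists (by decide)
    (fun i => ([0, 2, 3, 1] : List (Fin 9)).getD i 0) [6, 7, 8, 4, 5]
    (by decide) (by decide +kernel) (by decide +kernel) (by decide +kernel))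

theorem not_growsFromCycle_model22e (k : ℕ) : ¬ model22e.GrowsFromCycle k :=
  (isPendantPair_excModel (by decide) (by decide)).not_growsFromCycle rfl
    (by rw [Nat.card_eq_fintype_card, Fintype.card_fin]; omega) k

theorem growthType_model22e : model22e.growthType = ⊤ :=
  growthType_eq_top not_growsFromCycle_model22e

/-- In the first graph the two missing pairs share the vertex `4`, whose degree drops to 4. The
second graph has no vertex of degree 4. -/
theorem not_iso_model22c_model22d : ¬ Nonempty (model22c ≃g model22d) := by
  rintro ⟨e⟩
  have h : ∃ v, model22c.degree v = 4 := ⟨4, by decide +kernel⟩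
  obtain ⟨v, hv⟩ := h
  have hv' : model22d.degree (e v) = 4 := by
    rw [← hv, ← ncard_neighborSet_eq_degree, ← ncard_neighborSet_eq_degree, e.ncard_neighborSet]
  have : ∀ v, model22d.degree v ≠ 4 := by decide +kernel
  exact this _ hv'

/-- Only in the first graph does a vertex of degree 2 have a neighbour of degree 5: there `2` lies
in both missing pairs. -/
theorem not_iso_model22a_model22b : ¬ Nonempty (model22a ≃g model22b) := by
  rintro ⟨e⟩
  have h0 : model22a.degree 0 = 2 := by decide +kernel
  have h2 : model22a.degree 2 = 5 := by decide +kernel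
  have hadj : model22a.Adj 0 2 := by decide +kernel
  have hdeg : ∀ v, model22b.degree (e v) = model22a.degree v := fun v => by
    rw [← ncard_neighborSet_eq_degree, ← ncard_neighborSet_eq_degree, e.ncard_neighborSet]
  have : ∀ a b, model22b.Adj a b → model22b.degree a = 2 → model22b.degree b ≠ 5 := by
    decide +kernel
  exact this _ _ (e.map_adj_iff.2 hadj) ((hdeg 0).trans h0) ((hdeg 2).trans h2)

section

variable {V : Type*} [Fintype V] {H : SimpleGraph V}

/-- The graphs with nine vertices and many edges that do not grow from a triangle. -/
theorem iso_model_of_not_growsFromCycle (hn : Fintype.card V = 9) (hd : DegreesIn 2 6 H)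
    (he : 22 ≤ H.edgeSet.ncard) (h : ¬ H.GrowsFromCycle 3) :
    (H.edgeSet.ncard = 23 ∧ Nonempty (H ≃g model23)) ∨
    (H.edgeSet.ncard = 22 ∧ (Nonempty (H ≃g model22a) ∨ Nonempty (H ≃g model22b) ∨
      Nonempty (H ≃g model22c) ∨ Nonempty (H ≃g model22d) ∨ Nonempty (H ≃g model22e))) := by
  obtain ⟨T, hT, h7⟩ := exists_isGrowthClosed_seven hn hd (by omega) h
  obtain ⟨u, w, x, y, P⟩ := exists_isPendantPair hn hd hT h7
  have hK := P.ncard_edgeSet_add hn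
  have hpos : (H.missing {u, w}ᶜ).edgeSet.ncard ≠ 0 := by
    intro h0
    rw [Set.ncard_eq_zero, edgeSet_eq_empty] at h0
    have hx := (hd x).2
    have hN : ((H.missing {u, w}ᶜ).neighborSet x).ncard = 0 := by
      rw [h0, Set.ncard_eq_zero]; ext; simp
    by_cases hxy : x = y
    · have := P.ncard_neighborSet_add_of_eq hn hxy; omega
    · have := P.ncard_neighborSet_add hn hxy; omega
  have hle : (H.missing {u, w}ᶜ).edgeSet.ncard = 1 ∨ (H.missing {u, w}ᶜ).edgeSet.ncard = 2 := by
    omega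
  rcases hle with h1 | h1
  · exact Or.inl ⟨by omega, P.iso_of_ncard_eq_one hn hd h1⟩
  · exact Or.inr ⟨by omega, P.iso_of_ncard_eq_two hn hd h1⟩

/-- The outer vertices in the exceptional situation have degree 2, which minimal degree 4 excludes.
This settles the absorbing sets. -/
theorem growsFromCycle_three_of_four_le_degree (h5 : 5 ≤ Fintype.card V)
    (hn : Fintype.card V ≤ 9) (hd : DegreesIn 4 6 H)
    (he : 6 * Fintype.card V ≤ 2 * H.edgeSet.ncard + 10) : H.GrowsFromCycle 3 := by
  have hd2 : DegreesIn 2 6 H := fun v => ⟨le_trans (by norm_num) (hd v).1, (hd v).2⟩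
  rcases Nat.lt_or_ge (Fintype.card V) 9 with h9 | h9
  · exact growsFromCycle_three h5 (by omega) hd2 he
  have h9 : Fintype.card V = 9 := by omega
  by_contra h
  obtain ⟨T, hT, h7⟩ := exists_isGrowthClosed_seven h9 hd2 (by omega) h
  obtain ⟨u, w, x, y, P⟩ := exists_isPendantPair h9 hd2 hT h7
  have hN : H.neighborSet u = {w, x} := by ext c; simp [P.adj_left]
  have h4 := (hd u).1
  rw [hN] at h4
  have := Set.ncard_insert_le w {x}
  rw [Set.ncard_singleton] at this
  omega

end

end SimpleGraph

/-! ### The computed class numbers. -/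

/-- The number with the given digits in base `2 ^ 64`. -/
def ofDigits64 (l : List ℕ) : ℕ := l.foldr (fun d s => d + 2 ^ 64 * s) 0

theorem ofDigits64_digit {l : List ℕ} (hl : ∀ d ∈ l, d < 2 ^ 64) (i : ℕ) :
    ofDigits64 l / (2 ^ 64) ^ i % 2 ^ 64 = l.getD i 0 := by
  induction l generalizing i with
  | nil => simp [ofDigits64]
  | cons d l ih =>
    have h1 := hl d (by simp)
    have e : ofDigits64 (d :: l) = d + 2 ^ 64 * ofDigits64 l := rfl
    cases i with
    | zero => rw [e, pow_zero, Nat.div_one, Nat.add_mul_mod_self_left, Nat.mod_eq_of_lt h1]; rfl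
    | succ i =>
      rw [e, pow_succ' (2 ^ 64) i, ← Nat.div_div_eq_div_mul, Nat.add_mul_div_left _ _ (by norm_num),
        Nat.div_eq_of_lt h1, zero_add, ih fun d hd => hl d (by simp [hd])]
      rfl

/-- Dividing by `(2 ^ 64) ^ m` removes the digits of the smaller edge numbers. One comparison of
numbers then certifies the counts for `m` and all larger edge numbers. -/
theorem ncard_isoClasses_of_digits {n : ℕ} [NeZero n] (hn : n ≤ 9) (h : PartitionCheck n)
    {lo hi m : ℕ} {l : List ℕ} (hl : ∀ d ∈ l, d < 2 ^ 64)
    (hd : Nat.beq (burnsideSum n lo hi / (2 ^ 64) ^ m) (ofDigits64 l) = true) {i : ℕ}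
    (hi' : m + i ≤ (n + 1).choose 2) :
    (isoClasses fun H : SimpleGraph (Fin n) =>
      DegreesIn lo hi H ∧ H.edgeSet.ncard = m + i).ncard = l.getD i 0 := by
  rw [ncard_isoClasses_eq_digit hn h lo hi _ hi', pow_add, ← Nat.div_div_eq_div_mul,
    Nat.eq_of_beq_eq_true hd, ofDigits64_digit hl]

section

set_option maxRecDepth 100000

theorem partitionCheck_five : PartitionCheck 5 := by decide +kernel
theorem partitionCheck_six : PartitionCheck 6 := by decide +kernel
theorem partitionCheck_seven : PartitionCheck 7 := by decide +kernel
theorem partitionCheck_eight : PartitionCheck 8 := by decide +kernel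
theorem partitionCheck_nine : PartitionCheck 9 := by decide +kernel

/-- The numbers of isomorphism classes of graphs with `n` vertices, degrees between `lo` and `6`,
and `3 * n - 5`, `3 * n - 4`, ... edges, for `lo = 2` and for `lo = 4`. -/
def classCounts (lo n : ℕ) : List ℕ :=
  match lo, n with
  | 2, 5 => [1]
  | 2, 6 => [2, 1, 1]
  | 2, 7 => [20, 10, 5, 2, 1, 1]
  | 2, 8 => [260, 120, 48, 15, 3, 1]
  | 2, 9 => [5411, 2274, 726, 162, 25, 4]
  | 4, 5 => [1]
  | 4, 6 => [1, 1, 1]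
  | 4, 7 => [7, 6, 4, 2, 1, 1]
  | 4, 8 => [76, 60, 32, 12, 3, 1]
  | 4, 9 => [1620, 1157, 525, 146, 25, 4]
  | _, _ => []

theorem burnsideSum_two_five :
    Nat.beq (burnsideSum 5 2 6 / (2 ^ 64) ^ 10) (ofDigits64 (classCounts 2 5)) = true := by
  decide +kernel
theorem burnsideSum_two_six :
    Nat.beq (burnsideSum 6 2 6 / (2 ^ 64) ^ 13) (ofDigits64 (classCounts 2 6)) = true := by
  decide +kernel
theorem burnsideSum_two_seven :
    Nat.beq (burnsideSum 7 2 6 / (2 ^ 64) ^ 16) (ofDigits64 (classCounts 2 7)) = true := by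
  decide +kernel
theorem burnsideSum_two_eight :
    Nat.beq (burnsideSum 8 2 6 / (2 ^ 64) ^ 19) (ofDigits64 (classCounts 2 8)) = true := by
  decide +kernel
theorem burnsideSum_two_nine :
    Nat.beq (burnsideSum 9 2 6 / (2 ^ 64) ^ 22) (ofDigits64 (classCounts 2 9)) = true := by
  decide +kernel
theorem burnsideSum_four_five :
    Nat.beq (burnsideSum 5 4 6 / (2 ^ 64) ^ 10) (ofDigits64 (classCounts 4 5)) = true := by
  decide +kernel
theorem burnsideSum_four_six :
    Nat.beq (burnsideSum 6 4 6 / (2 ^ 64) ^ 13) (ofDigits64 (classCounts 4 6)) = true := by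
  decide +kernel
theorem burnsideSum_four_seven :
    Nat.beq (burnsideSum 7 4 6 / (2 ^ 64) ^ 16) (ofDigits64 (classCounts 4 7)) = true := by
  decide +kernel
theorem burnsideSum_four_eight :
    Nat.beq (burnsideSum 8 4 6 / (2 ^ 64) ^ 19) (ofDigits64 (classCounts 4 8)) = true := by
  decide +kernel
theorem burnsideSum_four_nine :
    Nat.beq (burnsideSum 9 4 6 / (2 ^ 64) ^ 22) (ofDigits64 (classCounts 4 9)) = true := by
  decide +kernel

end

/-- The relation `b + 2m = 6n` with `b = 10 - 2i` gives `m = 3n - 5 + i`. Positions beyond the end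
of a list count as zero. -/
theorem ncard_isoClasses_eq_classCounts {n lo : ℕ} (h5 : 5 ≤ n) (h9 : n ≤ 9)
    (hlo : lo = 2 ∨ lo = 4) {i : ℕ} (hi : i ≤ 5) :
    (isoClasses fun H : SimpleGraph (Fin n) =>
      DegreesIn lo 6 H ∧ H.edgeSet.ncard = 3 * n - 5 + i).ncard = (classCounts lo n).getD i 0 := by
  rcases hlo with rfl | rfl <;> interval_cases n
  · exact ncard_isoClasses_of_digits (by omega) partitionCheck_five (by decide)
      burnsideSum_two_five (by simp [Nat.choose]; omega)
  · exact ncard_isoClasses_of_digits (by omega) partitionCheck_six (by decide)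
      burnsideSum_two_six (by simp [Nat.choose]; omega)
  · exact ncard_isoClasses_of_digits (by omega) partitionCheck_seven (by decide)
      burnsideSum_two_seven (by simp [Nat.choose]; omega)
  · exact ncard_isoClasses_of_digits (by omega) partitionCheck_eight (by decide)
      burnsideSum_two_eight (by simp [Nat.choose]; omega)
  · exact ncard_isoClasses_of_digits (by omega) partitionCheck_nine (by decide)
      burnsideSum_two_nine (by simp [Nat.choose]; omega)
  · exact ncard_isoClasses_of_digits (by omega) partitionCheck_five (by decide)
      burnsideSum_four_five (by simp [Nat.choose]; omega)
  · exact ncard_isoClasses_of_digits (by omega) partitionCheck_six (by decide)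
      burnsideSum_four_six (by simp [Nat.choose]; omega)
  · exact ncard_isoClasses_of_digits (by omega) partitionCheck_seven (by decide)
      burnsideSum_four_seven (by simp [Nat.choose]; omega)
  · exact ncard_isoClasses_of_digits (by omega) partitionCheck_eight (by decide)
      burnsideSum_four_eight (by simp [Nat.choose]; omega)
  · exact ncard_isoClasses_of_digits (by omega) partitionCheck_nine (by decide)
      burnsideSum_four_nine (by simp [Nat.choose]; omega)

/-! ### Distribution of the isomorphism classes over the growth types. -/

theorem isoClasses_congr {V : Type*} {p q : SimpleGraph V → Prop} (h : ∀ H, p H ↔ q H) :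
    isoClasses p = isoClasses q := by
  have : p = q := funext fun H => propext (h H)
  rw [this]

theorem isoClasses_eq_empty {V : Type*} {p : SimpleGraph V → Prop} (h : ∀ H, ¬ p H) :
    isoClasses p = ∅ := by
  rw [isoClasses, Set.image_eq_empty, Set.eq_empty_iff_forall_notMem]
  exact h

theorem ncard_isoClasses_add {n : ℕ} {p q : SimpleGraph (Fin n) → Prop} (hq : IsoInvariant q) :
    (isoClasses fun H => p H ∧ q H).ncard + (isoClasses fun H => p H ∧ ¬ q H).ncard =
      (isoClasses p).ncard := by
  rw [← Set.ncard_union_eq]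
  · congr 1
    rw [isoClasses, isoClasses, isoClasses, ← Set.image_union]
    congr 1
    ext H
    simp only [Set.mem_union, Set.mem_ofPred_eq]
    tauto
  · rw [Set.disjoint_left]
    rintro _ ⟨H, hH, rfl⟩ ⟨H', hH', h⟩
    exact hH'.2 (hq _ _ (Quotient.exact h.symm) hH.2)

theorem isoInvariant_growthType {V : Type*} (x : ℕ∞) :
    IsoInvariant (V := V) fun H => H.growthType = x :=
  fun _ _ ⟨e⟩ h => (growthType_iso e).trans h

theorem ncard_isoClasses_growthType_of_forall {n : ℕ} {p : SimpleGraph (Fin n) → Prop}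
    (h : ∀ H, p H → H.growthType = 6) (x : ℕ∞) :
    (isoClasses fun H => p H ∧ H.growthType = x).ncard =
      if x = 6 then (isoClasses p).ncard else 0 := by
  split_ifs with hx
  · subst hx
    rw [isoClasses_congr fun H => and_iff_left_of_imp (h H)]
  · rw [isoClasses_eq_empty, Set.ncard_empty]
    rintro H ⟨h1, h2⟩
    exact hx (h2.symm.trans (h H h1))

/-- The classes of the graphs with given degrees, number of edges and growth type. -/
def growthClasses (n lo m : ℕ) (x : ℕ∞) : Set (Quotient (graphSetoid (Fin n))) :=
  isoClasses fun H => (DegreesIn lo 6 H ∧ H.edgeSet.ncard = m) ∧ H.growthType = x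

/-- The multiplicities of the growth types of the graphs with `9` vertices and `22` or `23`
edges. -/
def exceptionalCount (m : ℕ) (x : ℕ∞) : ℕ :=
  if m = 22 then if x = 6 then 5406 else if x = 8 then 2 else if x = 10 then 2 else
    if x = ⊤ then 1 else 0
  else if m = 23 then if x = 6 then 2273 else if x = 10 then 1 else 0
  else 0

/-- Outside the two cases of 9 vertices with 22 or 23 edges and lower degree bound 2, every graph
grows from a triangle. The whole count then belongs to type 6. -/
theorem ncard_growthClasses {n lo : ℕ} (h5 : 5 ≤ n) (h9 : n ≤ 9) (hlo : lo = 2 ∨ lo = 4) {i : ℕ}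
    (hi : i ≤ 5) (hex : lo = 2 → n = 9 → 2 ≤ i) (x : ℕ∞) :
    (growthClasses n lo (3 * n - 5 + i) x).ncard =
      if x = 6 then (classCounts lo n).getD i 0 else 0 := by
  rw [growthClasses, ncard_isoClasses_growthType_of_forall,
    ncard_isoClasses_eq_classCounts h5 h9 hlo hi]
  rintro H ⟨h1, h2⟩
  refine GrowsFromCycle.growthType_eq_six ?_
  have hcard : Fintype.card (Fin n) = n := Fintype.card_fin n
  rcases hlo with rfl | rfl
  · rcases Nat.lt_or_ge n 9 with h | h
    · exact growsFromCycle_three (by omega) (by omega) h1 (by omega)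
    · by_contra hg
      have := iso_model_of_not_growsFromCycle (by omega) h1 (by omega) hg
      have := hex rfl (by omega)
      omega
  · exact growsFromCycle_three_of_four_le_degree (by omega) (by omega) h1 (by omega)

theorem growthType_eq_six_or_model {H : SimpleGraph (Fin 9)} (hd : DegreesIn 2 6 H)
    (he : 22 ≤ H.edgeSet.ncard) : H.growthType = 6 ∨
    (H.edgeSet.ncard = 23 ∧ Nonempty (H ≃g model23)) ∨
    (H.edgeSet.ncard = 22 ∧ (Nonempty (H ≃g model22a) ∨ Nonempty (H ≃g model22b) ∨
      Nonempty (H ≃g model22c) ∨ Nonempty (H ≃g model22d) ∨ Nonempty (H ≃g model22e))) := by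
  by_cases h : H.GrowsFromCycle 3
  · exact Or.inl h.growthType_eq_six
  · exact Or.inr (iso_model_of_not_growsFromCycle (by simp) hd he h)

theorem growthClasses_twentythree_ten :
    growthClasses 9 2 23 10 = {Quotient.mk _ model23} := by
  ext c
  constructor
  · rintro ⟨H, ⟨⟨h1, h2⟩, h3⟩, rfl⟩
    rcases growthType_eq_six_or_model h1 (by omega) with h | ⟨-, h⟩ | h
    · rw [h] at h3; exact absurd h3 (by decide)
    · exact Quotient.sound h
    · omega
  · rintro rfl
    exact ⟨_, ⟨model23_mem, growthType_model23⟩, rfl⟩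

theorem growthClasses_twentytwo_ten :
    growthClasses 9 2 22 10 = {Quotient.mk _ model22a, Quotient.mk _ model22b} := by
  ext c
  constructor
  · rintro ⟨H, ⟨⟨h1, h2⟩, h3⟩, rfl⟩
    rcases growthType_eq_six_or_model h1 (by omega) with h | h | ⟨-, h | h | h | h | h⟩
    · rw [h] at h3; exact absurd h3 (by decide)
    · omega
    · exact Or.inl (Quotient.sound h)
    · exact Or.inr (Quotient.sound h)
    · rw [← growthType_iso h.some, growthType_model22c] at h3; exact absurd h3 (by decide)
    · rw [← growthType_iso h.some, growthType_model22d] at h3; exact absurd h3 (by decide)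
    · rw [← growthType_iso h.some, growthType_model22e] at h3; exact absurd h3 (by decide)
  · rintro (rfl | rfl)
    · exact ⟨_, ⟨model22a_mem, growthType_model22a⟩, rfl⟩
    · exact ⟨_, ⟨model22b_mem, growthType_model22b⟩, rfl⟩

theorem growthClasses_twentytwo_eight :
    growthClasses 9 2 22 8 = {Quotient.mk _ model22c, Quotient.mk _ model22d} := by
  ext c
  constructor
  · rintro ⟨H, ⟨⟨h1, h2⟩, h3⟩, rfl⟩
    rcases growthType_eq_six_or_model h1 (by omega) with h | h | ⟨-, h | h | h | h | h⟩
    · rw [h] at h3; exact absurd h3 (by decide)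
    · omega
    · rw [← growthType_iso h.some, growthType_model22a] at h3; exact absurd h3 (by decide)
    · rw [← growthType_iso h.some, growthType_model22b] at h3; exact absurd h3 (by decide)
    · exact Or.inl (Quotient.sound h)
    · exact Or.inr (Quotient.sound h)
    · rw [← growthType_iso h.some, growthType_model22e] at h3; exact absurd h3 (by decide)
  · rintro (rfl | rfl)
    · exact ⟨_, ⟨model22c_mem, growthType_model22c⟩, rfl⟩
    · exact ⟨_, ⟨model22d_mem, growthType_model22d⟩, rfl⟩

theorem growthClasses_twentytwo_top :
    growthClasses 9 2 22 ⊤ = {Quotient.mk _ model22e} := by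
  ext c
  constructor
  · rintro ⟨H, ⟨⟨h1, h2⟩, h3⟩, rfl⟩
    rcases growthType_eq_six_or_model h1 (by omega) with h | h | ⟨-, h | h | h | h | h⟩
    · rw [h] at h3; exact absurd h3 (by decide)
    · omega
    · rw [← growthType_iso h.some, growthType_model22a] at h3; exact absurd h3 (by decide)
    · rw [← growthType_iso h.some, growthType_model22b] at h3; exact absurd h3 (by decide)
    · rw [← growthType_iso h.some, growthType_model22c] at h3; exact absurd h3 (by decide)
    · rw [← growthType_iso h.some, growthType_model22d] at h3; exact absurd h3 (by decide)
    · exact Quotient.sound h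
  · rintro rfl
    exact ⟨_, ⟨model22e_mem, growthType_model22e⟩, rfl⟩

theorem mem_growthType_values {H : SimpleGraph (Fin 9)} (hd : DegreesIn 2 6 H)
    (he : 22 ≤ H.edgeSet.ncard) : H.growthType = 6 ∨
    (H.edgeSet.ncard = 23 ∧ H.growthType = 10) ∨
    (H.edgeSet.ncard = 22 ∧ (H.growthType = 10 ∨ H.growthType = 8 ∨ H.growthType = ⊤)) := by
  rcases growthType_eq_six_or_model hd he with h | ⟨h1, h⟩ | ⟨h1, h | h | h | h | h⟩
  · exact Or.inl h
  · rw [← growthType_iso h.some, growthType_model23]; simp [h1]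
  · rw [← growthType_iso h.some, growthType_model22a]; simp [h1]
  · rw [← growthType_iso h.some, growthType_model22b]; simp [h1]
  · rw [← growthType_iso h.some, growthType_model22c]; simp [h1]
  · rw [← growthType_iso h.some, growthType_model22d]; simp [h1]
  · rw [← growthType_iso h.some, growthType_model22e]; simp [h1]

/-- The exceptional class is counted directly, and type 6 receives the rest: `2274 - 1 = 2273`. -/
theorem ncard_growthClasses_twentythree (x : ℕ∞) :
    (growthClasses 9 2 23 x).ncard = exceptionalCount 23 x := by
  have h10 : (growthClasses 9 2 23 10).ncard = 1 := by
    rw [growthClasses_twentythree_ten, Set.ncard_singleton]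
  have htotal := ncard_isoClasses_eq_classCounts (n := 9) (lo := 2) (i := 1) (by omega) (by omega)
    (Or.inl rfl) (by omega)
  rw [← ncard_isoClasses_add (isoInvariant_growthType 6)] at htotal
  have hne : (isoClasses fun H : SimpleGraph (Fin 9) =>
      (DegreesIn 2 6 H ∧ H.edgeSet.ncard = 23) ∧ ¬ H.growthType = 6) = growthClasses 9 2 23 10 := by
    refine isoClasses_congr fun H => and_congr_right fun ⟨h1, h2⟩ => ?_
    constructor
    · intro h
      rcases mem_growthType_values h1 (by omega) with h' | h' | h'
      · exact absurd h' h
      · exact h'.2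
      · omega
    · intro h; rw [h]; decide
  have h6 : (growthClasses 9 2 23 6).ncard = 2273 := by
    change (growthClasses 9 2 23 6).ncard + (isoClasses fun H : SimpleGraph (Fin 9) =>
      (DegreesIn 2 6 H ∧ H.edgeSet.ncard = 23) ∧ ¬ H.growthType = 6).ncard = 2274 at htotal
    rw [hne] at htotal
    omega
  by_cases hx6 : x = 6
  · subst hx6; rw [h6]; rfl
  by_cases hx10 : x = 10
  · subst hx10; rw [h10]; rfl
  rw [growthClasses, isoClasses_eq_empty, Set.ncard_empty]
  · simp [exceptionalCount, hx6, hx10]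
  · rintro H ⟨⟨h1, h2⟩, rfl⟩
    rcases mem_growthType_values h1 (by omega) with h' | h' | h'
    · exact hx6 h'
    · exact hx10 h'.2
    · omega

/-- Types 8, 10 and `⊤` are counted by their models, and type 6 receives the rest: `5411 - 2 - 2 - 1
= 5406`. -/
theorem ncard_growthClasses_twentytwo (x : ℕ∞) :
    (growthClasses 9 2 22 x).ncard = exceptionalCount 22 x := by
  have h10 : (growthClasses 9 2 22 10).ncard = 2 := by
    rw [growthClasses_twentytwo_ten, Set.ncard_pair]
    exact fun h => not_iso_model22a_model22b (Quotient.exact h)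
  have h8 : (growthClasses 9 2 22 8).ncard = 2 := by
    rw [growthClasses_twentytwo_eight, Set.ncard_pair]
    exact fun h => not_iso_model22c_model22d (Quotient.exact h)
  have htop : (growthClasses 9 2 22 ⊤).ncard = 1 := by
    rw [growthClasses_twentytwo_top, Set.ncard_singleton]
  have htotal := ncard_isoClasses_eq_classCounts (n := 9) (lo := 2) (i := 0) (by omega) (by omega)
    (Or.inl rfl) (by omega)
  rw [← ncard_isoClasses_add (isoInvariant_growthType 6),
    ← ncard_isoClasses_add (p := fun H : SimpleGraph (Fin 9) =>
      (DegreesIn 2 6 H ∧ H.edgeSet.ncard = 3 * 9 - 5 + 0) ∧ ¬ H.growthType = 6)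
      (isoInvariant_growthType 8),
    ← ncard_isoClasses_add (p := fun H : SimpleGraph (Fin 9) =>
      ((DegreesIn 2 6 H ∧ H.edgeSet.ncard = 3 * 9 - 5 + 0) ∧ ¬ H.growthType = 6) ∧
        ¬ H.growthType = 8) (isoInvariant_growthType 10)] at htotal
  have e8 : (isoClasses fun H : SimpleGraph (Fin 9) =>
      ((DegreesIn 2 6 H ∧ H.edgeSet.ncard = 3 * 9 - 5 + 0) ∧ ¬ H.growthType = 6) ∧
        H.growthType = 8) = growthClasses 9 2 22 8 := by
    refine isoClasses_congr fun H => ⟨fun ⟨⟨h1, _⟩, h2⟩ => ⟨h1, h2⟩, fun ⟨h1, h2⟩ => ⟨⟨h1, ?_⟩, h2⟩⟩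
    rw [h2]; decide
  have e10 : (isoClasses fun H : SimpleGraph (Fin 9) =>
      (((DegreesIn 2 6 H ∧ H.edgeSet.ncard = 3 * 9 - 5 + 0) ∧ ¬ H.growthType = 6) ∧
        ¬ H.growthType = 8) ∧ H.growthType = 10) = growthClasses 9 2 22 10 := by
    refine isoClasses_congr fun H =>
      ⟨fun ⟨⟨⟨h1, _⟩, _⟩, h2⟩ => ⟨h1, h2⟩, fun ⟨h1, h2⟩ => ⟨⟨⟨h1, ?_⟩, ?_⟩, h2⟩⟩ <;>
    · rw [h2]; decide
  have etop : (isoClasses fun H : SimpleGraph (Fin 9) =>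
      (((DegreesIn 2 6 H ∧ H.edgeSet.ncard = 3 * 9 - 5 + 0) ∧ ¬ H.growthType = 6) ∧
        ¬ H.growthType = 8) ∧ ¬ H.growthType = 10) = growthClasses 9 2 22 ⊤ := by
    refine isoClasses_congr fun H => ⟨fun ⟨⟨⟨h1, h6⟩, h8⟩, h10⟩ => ⟨h1, ?_⟩,
      fun ⟨h1, h2⟩ => ⟨⟨⟨h1, ?_⟩, ?_⟩, ?_⟩⟩
    · rcases mem_growthType_values h1.1 (by omega) with h' | h' | ⟨-, h' | h' | h'⟩
      · exact absurd h' h6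
      · omega
      · exact absurd h' h10
      · exact absurd h' h8
      · exact h'
    all_goals rw [h2]; decide
  rw [e8, e10, etop, h8, h10, htop] at htotal
  have h6 : (growthClasses 9 2 22 6).ncard = 5406 := by
    change (growthClasses 9 2 22 6).ncard + (2 + (2 + 1)) = 5411 at htotal
    omega
  by_cases hx6 : x = 6
  · subst hx6; rw [h6]; rfl
  by_cases hx8 : x = 8
  · subst hx8; rw [h8]; rfl
  by_cases hx10 : x = 10
  · subst hx10; rw [h10]; rfl
  by_cases hxt : x = ⊤
  · subst hxt; rw [htop]; rfl
  rw [growthClasses, isoClasses_eq_empty, Set.ncard_empty]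
  · simp [exceptionalCount, hx6, hx8, hx10, hxt]
  · rintro H ⟨⟨h1, h2⟩, rfl⟩
    rcases mem_growthType_values h1 (by omega) with h' | h' | ⟨-, h' | h' | h'⟩
    · exact hx6 h'
    · omega
    · exact hx10 h'
    · exact hx8 h'
    · exact hxt h'

/-! ### Cycles as walks and cycles as periodic sequences. -/

namespace SimpleGraph

variable {V : Type*} {H : SimpleGraph V}

/-- The sequence defines an injective homomorphism from the standard cycle graph, and the image of
the standard cycle is the required walk. -/
theorem exists_isCycle_of_periodic {n : ℕ} (hn : 3 ≤ n) {F : ℕ → V}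
    (h1 : ∀ i < n, ∀ j < n, F i = F j → i = j) (h2 : ∀ i, F (i + n) = F i)
    (h3 : ∀ i, H.Adj (F i) (F (i + 1))) :
    ∃ (u : V) (p : H.Walk u u), p.IsCycle ∧ p.length = n ∧ ∀ v, v ∈ p.support ↔ v ∈ Set.range F := by
  obtain ⟨n, rfl⟩ : ∃ m, n = m + 3 := ⟨n - 3, by omega⟩
  have hp : Function.Periodic F (n + 3) := h2
  have hadj : ∀ {u v : Fin (n + 3)}, (u - v).val = 1 → H.Adj (F v) (F u) := by
    intro u v h
    have huv : u = v + 1 := by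
      have h' : u - v = 1 := Fin.ext (by simpa using h)
      rw [← h', add_sub_cancel]
    have : F u = F (v + 1) := by
      rw [huv, Fin.val_add]
      simpa using hp.map_mod_nat (v.val + 1)
    exact this ▸ h3 v
  let φ : cycleGraph (n + 3) →g H :=
    ⟨fun x => F x.val, fun {u v} h => by
      rcases cycleGraph_adj'.1 h with h | h
      · exact (hadj h).symm
      · exact hadj h⟩
  have hφ : Function.Injective φ := fun u v h => Fin.ext (h1 _ u.2 _ v.2 h)
  refine ⟨_, (cycleGraph.cycle n).map φ, (Walk.isCycle_map_iff_of_injective hφ).2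
    cycleGraph.isCycle_cycle, by rw [Walk.length_map, cycleGraph.length_cycle], fun v => ?_⟩
  rw [Walk.support_map, List.mem_map]
  constructor
  · rintro ⟨x, -, rfl⟩
    exact ⟨x.val, rfl⟩
  · rintro ⟨i, rfl⟩
    refine ⟨⟨i % (n + 3), Nat.mod_lt _ (by omega)⟩, ?_, hp.map_mod_nat i⟩
    rw [Walk.mem_support_iff_exists_getVert]
    have hi : i % (n + 3) < n + 3 := Nat.mod_lt _ (by omega)
    -- The standard cycle runs backwards: the vertex with number `j` stands at position `n + 3 - j`.
    refine ⟨n + 3 - i % (n + 3), ?_, by rw [cycleGraph.length_cycle]; omega⟩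
    rw [cycleGraph.getVert_cycle (by omega)]
    ext
    simp only
    rw [show n + 3 - (n + 3 - i % (n + 3)) = i % (n + 3) by omega, Nat.mod_mod]

theorem Walk.IsCycle.exists_periodic {u : V} {p : H.Walk u u} (hp : p.IsCycle) :
    ∃ F : ℕ → V, F 0 = u ∧ (∀ i < p.length, ∀ j < p.length, F i = F j → i = j) ∧
      (∀ i, F (i + p.length) = F i) ∧ (∀ i, H.Adj (F i) (F (i + 1))) ∧
      ∀ v, v ∈ p.support ↔ v ∈ Set.range F := by
  have h3 := hp.three_le_length
  refine ⟨fun i => p.getVert (i % p.length), by simp, fun i hi j hj h => ?_, fun i => by simp,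
    fun i => ?_, fun v => ?_⟩
  · simp only [Nat.mod_eq_of_lt hi, Nat.mod_eq_of_lt hj] at h
    exact hp.getVert_injOn' (by simp; omega) (by simp; omega) h
  · have hi : i % p.length < p.length := Nat.mod_lt _ (by omega)
    have h := p.adj_getVert_succ hi
    have : p.getVert ((i + 1) % p.length) = p.getVert (i % p.length + 1) := by
      rw [Nat.add_mod, Nat.mod_eq_of_lt (show 1 < p.length by omega)]
      rcases (Nat.succ_le_of_lt hi).eq_or_lt with h | h
      · rw [show i % p.length + 1 = p.length from h, Nat.mod_self, p.getVert_zero, p.getVert_length]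
      · rw [Nat.mod_eq_of_lt h]
    simpa only [this] using h
  · rw [Walk.mem_support_iff_exists_getVert]
    constructor
    · rintro ⟨i, rfl, hi⟩
      rcases hi.eq_or_lt with h | h
      · exact ⟨0, by simp [h]⟩
      · exact ⟨i, by simp [Nat.mod_eq_of_lt h]⟩
    · rintro ⟨i, rfl⟩
      exact ⟨_, rfl, (Nat.mod_lt _ (by omega)).le⟩

end SimpleGraph

/-! ### Cycles and girth of Tanner graphs. -/

namespace TannerGraph

variable {L R : Type*} (G : TannerGraph L R)

@[simp]
theorem graph_adj_inl_inr {v : L} {c : R} : G.graph.Adj (Sum.inl v) (Sum.inr c) ↔ G.Adj v c := by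
  simp [graph]

@[simp]
theorem graph_adj_inr_inl {v : L} {c : R} : G.graph.Adj (Sum.inr c) (Sum.inl v) ↔ G.Adj v c := by
  simp [graph]

@[simp]
theorem not_graph_adj_inl_inl {v w : L} : ¬ G.graph.Adj (Sum.inl v) (Sum.inl w) := by
  simp [graph]

@[simp]
theorem not_graph_adj_inr_inr {c d : R} : ¬ G.graph.Adj (Sum.inr c) (Sum.inr d) := by
  simp [graph]

/-- Two variable nodes share at most one check node. -/
def IsLinear : Prop :=
  ∀ ⦃v w : L⦄ ⦃c d : R⦄, v ≠ w → G.Adj v c → G.Adj w c → G.Adj v d → G.Adj w d → c = d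

/-- The graph on `S` in which two variable nodes are joined if they share a check node. -/
def normalGraph (S : Set L) : SimpleGraph S where
  Adj v w := v ≠ w ∧ ∃ c, G.Adj v c ∧ G.Adj w c
  symm := ⟨fun _ _ ⟨h, c, h1, h2⟩ => ⟨h.symm, c, h2, h1⟩⟩
  loopless := ⟨fun _ h => h.1 rfl⟩

variable {G}

/-- A cycle alternates between variable nodes and check nodes, so after a rotation the variable
nodes stand at even positions. -/
theorem exists_alternating_of_isCycle {u : L ⊕ R} {p : G.graph.Walk u u} (hp : p.IsCycle) :
    ∃ (k : ℕ) (f : ℕ → L) (g : ℕ → R), p.length = 2 * k ∧ 2 ≤ k ∧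
      (∀ i < k, ∀ j < k, f i = f j → i = j) ∧ (∀ i < k, ∀ j < k, g i = g j → i = j) ∧
      (∀ i, f (i + k) = f i) ∧ (∀ i, G.Adj (f i) (g i)) ∧ (∀ i, G.Adj (f (i + 1)) (g i)) ∧
      ∀ v, Sum.inl v ∈ p.support ↔ v ∈ Set.range f := by
  classical
  wlog hu : ∃ v, u = Sum.inl v generalizing u
  -- If the base point is a check node, the next node is a variable node, and the cycle is rotated
  -- to start there.
  · obtain ⟨F, h0, -, -, hadj, hs⟩ := hp.exists_periodic
    have hu1 : F 1 ∈ p.support := (hs _).2 ⟨1, rfl⟩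
    have h01 := hadj 0
    obtain ⟨k, f, g, h⟩ := this ((SimpleGraph.Walk.isCycle_rotate hu1).2 hp) (by
      rw [h0] at h01
      rcases hF : F 1 with v | c
      · exact ⟨v, rfl⟩
      · rcases u with v | d
        · exact absurd ⟨v, rfl⟩ hu
        · simp [hF] at h01)
    simp only [SimpleGraph.Walk.length_rotate, SimpleGraph.Walk.mem_support_rotate_iff] at h
    exact ⟨k, f, g, h⟩
  obtain ⟨v₀, rfl⟩ := hu
  have h3 := hp.three_le_length
  obtain ⟨F, h0, h1, h2, hadj, hs⟩ := hp.exists_periodic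
  have hsides : ∀ i, (∃ v, F (2 * i) = Sum.inl v) ∧ ∃ c, F (2 * i + 1) = Sum.inr c := by
    have hr : ∀ i, (∃ v, F (2 * i) = Sum.inl v) → ∃ c, F (2 * i + 1) = Sum.inr c := by
      rintro i ⟨v, hv⟩
      have := hadj (2 * i)
      rw [hv] at this
      rcases hF : F (2 * i + 1) with w | c
      · simp [hF] at this
      · exact ⟨c, rfl⟩
    intro i
    induction i with
    | zero => exact ⟨⟨v₀, h0⟩, hr 0 ⟨v₀, h0⟩⟩
    | succ i ih =>
      have : ∃ v, F (2 * (i + 1)) = Sum.inl v := by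
        obtain ⟨c, hc⟩ := ih.2
        have := hadj (2 * i + 1)
        rw [hc] at this
        rcases hF : F (2 * i + 1 + 1) with w | d
        · exact ⟨w, by rw [← hF]⟩
        · simp [hF] at this
      exact ⟨this, hr _ this⟩
  choose hf hg using hsides
  choose f hf using hf
  choose g hg using hg
  -- An odd period would identify a check node with the variable node at position 0.
  obtain ⟨k, hk⟩ : ∃ k, p.length = 2 * k := by
    rcases Nat.even_or_odd' p.length with ⟨k, h | h⟩
    · exact ⟨k, h⟩
    · have := h2 0
      rw [h, zero_add, hg, h0] at this
      simp at this
  rw [hk] at h1 h2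
  refine ⟨k, f, g, hk, by omega, fun i hi j hj h => ?_, fun i hi j hj h => ?_, fun i => ?_,
    fun i => ?_, fun i => ?_, fun v => ?_⟩
  · have := h1 (2 * i) (by omega) (2 * j) (by omega) (by rw [hf, hf, h])
    omega
  · have := h1 (2 * i + 1) (by omega) (2 * j + 1) (by omega) (by rw [hg, hg, h])
    omega
  · have := h2 (2 * i)
    rw [← mul_add, hf, hf] at this
    exact Sum.inl_injective this
  · have := hadj (2 * i)
    rwa [hf, hg, graph_adj_inl_inr] at this
  · have := hadj (2 * i + 1)
    rwa [hg, show 2 * i + 1 + 1 = 2 * (i + 1) by ring, hf, graph_adj_inr_inl] at this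
  · rw [hs]
    constructor
    · rintro ⟨i, hi⟩
      rcases Nat.even_or_odd' i with ⟨j, rfl | rfl⟩
      · rw [hf] at hi
        exact ⟨j, Sum.inl_injective hi⟩
      · simp [hg] at hi
    · rintro ⟨i, rfl⟩
      exact ⟨2 * i, hf i⟩

theorem isCycleSet_of_alternating {k : ℕ} (hk : 2 ≤ k) {f : ℕ → L} {g : ℕ → R}
    (hf : ∀ i < k, ∀ j < k, f i = f j → i = j) (hg : ∀ i < k, ∀ j < k, g i = g j → i = j)
    (hf' : ∀ i, f (i + k) = f i) (hg' : ∀ i, g (i + k) = g i) (h1 : ∀ i, G.Adj (f i) (g i))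
    (h2 : ∀ i, G.Adj (f (i + 1)) (g i)) : G.IsCycleSet (2 * k) (Set.range f) := by
  set F : ℕ → L ⊕ R := fun m => if m % 2 = 0 then Sum.inl (f (m / 2)) else Sum.inr (g (m / 2)) with hF
  have hF0 : ∀ i, F (2 * i) = Sum.inl (f i) := fun i => by simp [hF]
  have hF1 : ∀ i, F (2 * i + 1) = Sum.inr (g i) := fun i => by
    simp only [hF, show (2 * i + 1) % 2 = 1 by omega, show (2 * i + 1) / 2 = i by omega]
    simp
  obtain ⟨u, p, hp, hl, hs⟩ := SimpleGraph.exists_isCycle_of_periodic (H := G.graph) (n := 2 * k)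
    (F := F) (by omega) (by
      intro i hi j hj h
      rcases Nat.even_or_odd' i with ⟨i, rfl | rfl⟩ <;>
        rcases Nat.even_or_odd' j with ⟨j, rfl | rfl⟩ <;>
        simp only [hF0, hF1, Sum.inl.injEq, Sum.inr.injEq, reduceCtorEq] at h
      · rw [hf i (by omega) j (by omega) h]
      · rw [hg i (by omega) j (by omega) h])
    (by
      intro i
      rcases Nat.even_or_odd' i with ⟨i, rfl | rfl⟩
      · rw [← mul_add, hF0, hF0, hf']
      · rw [show 2 * i + 1 + 2 * k = 2 * (i + k) + 1 by ring, hF1, hF1, hg'])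
    (by
      intro i
      rcases Nat.even_or_odd' i with ⟨i, rfl | rfl⟩
      · rw [hF0, hF1]
        exact G.graph_adj_inl_inr.2 (h1 i)
      · rw [show 2 * i + 1 + 1 = 2 * (i + 1) by ring, hF0, hF1]
        exact G.graph_adj_inr_inl.2 (h2 i))
  refine ⟨u, p, hp, hl, ?_⟩
  ext v
  rw [Set.mem_ofPred_eq, hs]
  constructor
  · rintro ⟨i, rfl⟩
    exact ⟨2 * i, hF0 i⟩
  · rintro ⟨i, hi⟩
    rcases Nat.even_or_odd' i with ⟨i, rfl | rfl⟩
    · rw [hF0] at hi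
      exact ⟨i, Sum.inl_injective hi⟩
    · simp [hF1] at hi

/-- Two variable nodes with two common check nodes form a cycle of length 4. -/
theorem isLinear_of_girth_eq_six (h : G.graph.girth = 6) : G.IsLinear := by
  intro v w c d hvw hvc hwc hvd hwd
  by_contra hcd
  obtain ⟨u, p, hp, hl, -⟩ := isCycleSet_of_alternating (G := G) (k := 2) le_rfl
    (f := fun i => if i % 2 = 0 then v else w) (g := fun i => if i % 2 = 0 then c else d)
    (by intro i hi j hj; interval_cases i <;> interval_cases j <;> simp [hvw, hvw.symm])
    (by
      have := Ne.symm hcd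
      intro i hi j hj; interval_cases i <;> interval_cases j <;> simp [hcd, this])
    (by simp) (by simp)
    (by intro i; split_ifs <;> assumption)
    (by
      intro i
      rcases Nat.mod_two_eq_zero_or_one i with hi | hi
      · rw [if_neg (by omega), if_pos hi]; exact hwc
      · rw [if_pos (by omega), if_neg (by omega)]; exact hvd)
  have := SimpleGraph.girth_le_length hp
  omega

theorem IsLinear.three_le {k : ℕ} {f : ℕ → L} {g : ℕ → R} (h : G.IsLinear) (hk : 2 ≤ k)
    (hf : ∀ i < k, ∀ j < k, f i = f j → i = j) (hg : ∀ i < k, ∀ j < k, g i = g j → i = j)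
    (hf' : ∀ i, f (i + k) = f i) (h1 : ∀ i, G.Adj (f i) (g i))
    (h2 : ∀ i, G.Adj (f (i + 1)) (g i)) : 3 ≤ k := by
  by_contra hk3
  obtain rfl : k = 2 := by omega
  have h01 : f 0 ≠ f 1 := fun h => by simpa using hf 0 (by omega) 1 (by omega) h
  have := hg 0 (by omega) 1 (by omega)
    (h h01 (h1 0) (h2 0) (by have := h2 1; rwa [hf' 0] at this) (h1 1))
  omega

/-- Linearity excludes cycles of length 4, and all cycles have even length. A given cycle of length
6 is therefore shortest. -/
theorem girth_eq_six (h : G.IsLinear) {C : Set L} (hC : G.IsCycleSet 6 C) : G.graph.girth = 6 := by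
  obtain ⟨u, p, hp, hl, -⟩ := hC
  refine le_antisymm (hl ▸ SimpleGraph.girth_le_length hp) ?_
  obtain ⟨u', q, hq, hl'⟩ := SimpleGraph.exists_girth_eq_length.2 fun hA => hA p hp
  obtain ⟨k, f, g, hk, hk2, hf, hg, hf', h1, h2, -⟩ := exists_alternating_of_isCycle hq
  have := h.three_le hk2 hf hg hf' h1 h2
  omega

end TannerGraph

/-! ### Trapping sets in terms of their normal graphs. -/

namespace TannerGraph

variable {L R : Type*} {G : TannerGraph L R} {S T : Set L}

theorem IsElementary.checkDegree_le (h : G.IsElementary S) (c : R) : G.checkDegree S c ≤ 2 := by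
  by_cases hc : c ∈ G.neighbors S
  · rcases h c hc with h | h <;> omega
  · have : {v | v ∈ S ∧ G.Adj v c} = ∅ := by
      ext v
      simp only [Set.mem_ofPred_eq, Set.mem_empty_iff_false, iff_false]
      exact fun hv => hc ⟨v, hv⟩
    simp [checkDegree, this]

theorem ncard_unsatisfied_add_ncard_satisfied [Finite R] {d : ℕ} (hd : G.LeftRegular d) {v : L}
    (hv : v ∈ S) : {c | G.Adj v c ∧ c ∈ G.unsatisfied S}.ncard +
      {c | G.Adj v c ∧ c ∈ G.satisfied S}.ncard = d := by
  rw [← hd v, ← Set.ncard_union_eq]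
  · congr 1
    ext c
    constructor
    · rintro (h | h) <;> exact h.1
    · intro h
      rcases Nat.even_or_odd (G.checkDegree S c) with he | ho
      · exact Or.inr ⟨h, ⟨v, hv, h⟩, he⟩
      · exact Or.inl ⟨h, ⟨v, hv, h⟩, ho⟩
  · rw [Set.disjoint_left]
    rintro c ⟨-, -, h1⟩ ⟨-, -, h2⟩
    exact Nat.not_even_iff_odd.2 h1 h2

theorem not_exists_isLSSOfCycle_iff (G : TannerGraph L R) (S : Set L) :
    (¬ ∃ x, G.IsLSSOfCycle x S) ↔ G.lssType S = ⊤ := by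
  simp only [lssType, iInf_eq_top, ENat.natCast_ne_top, imp_false, not_exists]

section Finite

variable [Finite L]

theorem IsElementary.mono (hS : G.IsElementary S) (h : T ⊆ S) : G.IsElementary T := by
  rintro c ⟨v, hv, hc⟩
  have h1 : G.checkDegree T c ≤ G.checkDegree S c :=
    Set.ncard_le_ncard fun w ⟨hw, hwc⟩ => ⟨h hw, hwc⟩
  have h2 : 0 < G.checkDegree T c := (Set.ncard_pos).2 ⟨v, hv, hc⟩
  have := hS.checkDegree_le c
  omega

theorem IsElementary.eq_of_adj (hS : G.IsElementary S) {u v w : L} {c : R} (hu : u ∈ S)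
    (hv : v ∈ S) (hw : w ∈ S) (huc : G.Adj u c) (hvc : G.Adj v c) (hwc : G.Adj w c) (huv : u ≠ v)
    (huw : u ≠ w) : v = w := by
  by_contra hvw
  have h1 : ({u, v, w} : Set L).ncard ≤ G.checkDegree S c := by
    refine Set.ncard_le_ncard ?_
    rintro x (rfl | rfl | rfl)
    exacts [⟨hu, huc⟩, ⟨hv, hvc⟩, ⟨hw, hwc⟩]
  rw [Set.ncard_eq_three.2 ⟨u, v, w, huv, huw, hvw, rfl⟩] at h1
  have := hS.checkDegree_le c
  omega

theorem IsElementary.mem_satisfied_iff (hS : G.IsElementary S) {v : L} {c : R} (hv : v ∈ S)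
    (hc : G.Adj v c) : c ∈ G.satisfied S ↔ ∃ w ∈ S, w ≠ v ∧ G.Adj w c := by
  have hn : c ∈ G.neighbors S := ⟨v, hv, hc⟩
  constructor
  · rintro ⟨-, he⟩
    have h2 : 1 < G.checkDegree S c := by
      rcases hS c hn with h | h
      · rw [h] at he; exact absurd he (by decide)
      · omega
    obtain ⟨w, ⟨hw, hwc⟩, hne⟩ := Set.exists_ne_of_one_lt_ncard h2 v
    exact ⟨w, hw, hne, hwc⟩
  · rintro ⟨w, hw, hne, hwc⟩
    have h2 : 1 < G.checkDegree S c := (Set.one_lt_ncard).2 ⟨w, ⟨hw, hwc⟩, v, ⟨hv, hc⟩, hne⟩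
    have := hS.checkDegree_le c
    refine ⟨hn, ?_⟩
    rw [show G.checkDegree S c = 2 by omega]
    exact even_two

/-- A neighbour of `v` in `T` is sent to the check node shared with `v`. This is injective because a
check meets at most two nodes of `T`, and it reaches every satisfied check at `v` because the shared
check is unique. -/
theorem IsElementary.ncard_satisfied (hT : G.IsElementary T) (hG : G.IsLinear) (hTS : T ⊆ S)
    {v : L} (hv : v ∈ T) : {c | G.Adj v c ∧ c ∈ G.satisfied T}.ncard =
      ((G.normalGraph S).neighborSet ⟨v, hTS hv⟩ ∩ Subtype.val ⁻¹' T).ncard := by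
  symm
  refine Set.ncard_congr (fun w hw => hw.1.2.choose) ?_ ?_ ?_
  · rintro w ⟨hw, hwT⟩
    have h := hw.2.choose_spec
    exact ⟨h.1, (hT.mem_satisfied_iff hv h.1).2 ⟨w, hwT, fun he => hw.1 (Subtype.ext he.symm), h.2⟩⟩
  · rintro w w' ⟨hw, hwT⟩ ⟨hw', hwT'⟩ h
    have h1 := hw.2.choose_spec
    have h2 := hw'.2.choose_spec
    have h3 := h2.2
    rw [← h] at h3
    exact Subtype.ext (hT.eq_of_adj hv hwT hwT' h1.1 h1.2 h3 (fun he => hw.1 (Subtype.ext he))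
      (fun he => hw'.1 (Subtype.ext he)))
  · rintro c ⟨hvc, hc⟩
    obtain ⟨w, hw, hne, hwc⟩ := (hT.mem_satisfied_iff hv hvc).1 hc
    have hadj : (G.normalGraph S).Adj ⟨v, hTS hv⟩ ⟨w, hTS hw⟩ :=
      ⟨fun he => hne (Subtype.ext_iff.1 he).symm, c, hvc, hwc⟩
    refine ⟨⟨w, hTS hw⟩, ⟨hadj, hw⟩, ?_⟩
    have h := hadj.2.choose_spec
    exact hG hne.symm h.1 h.2 hvc hwc

theorem IsElementary.ncard_satisfied_self (hS : G.IsElementary S) (hG : G.IsLinear) (v : S) :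
    {c | G.Adj v c ∧ c ∈ G.satisfied S}.ncard = ((G.normalGraph S).neighborSet v).ncard := by
  rw [hS.ncard_satisfied hG subset_rfl v.2]
  simp

/-- An unsatisfied check has degree one in `G(S)`, so it is counted at exactly one variable node. -/
theorem IsElementary.ncard_unsatisfied [Finite R] [Fintype S] (hS : G.IsElementary S) :
    (G.unsatisfied S).ncard = ∑ v : S, {c | G.Adj v c ∧ c ∈ G.unsatisfied S}.ncard := by
  have hb : Function.Bijective (fun p : Σ v : S, {c | G.Adj v c ∧ c ∈ G.unsatisfied S} =>
      (⟨p.2.1, p.2.2.2⟩ : G.unsatisfied S)) := by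
    constructor
    · rintro ⟨v, c, hvc, hc⟩ ⟨w, c', hwc, hc'⟩ h
      obtain rfl : c = c' := Subtype.ext_iff.1 h
      suffices hvw : v = w by subst hvw; rfl
      by_contra hne
      have h2 : 1 < G.checkDegree S c :=
        (Set.one_lt_ncard).2 ⟨v, ⟨v.2, hvc⟩, w, ⟨w.2, hwc⟩, fun he => hne (Subtype.ext he)⟩
      have := hS.checkDegree_le c
      have h3 := hc.2
      rw [show G.checkDegree S c = 2 by omega] at h3
      exact absurd h3 (by decide)
    · rintro ⟨c, hc⟩
      obtain ⟨v, hv, hvc⟩ := hc.1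
      exact ⟨⟨⟨v, hv⟩, c, hvc, hc⟩, rfl⟩
  rw [← Nat.card_coe_set_eq, ← Nat.card_eq_of_bijective _ hb, Nat.card_sigma]
  rfl

/-- Both sides count the edges of `G(S)`: each unsatisfied check contributes one, and each satisfied
check, that is each edge of the normal graph, contributes two. -/
theorem IsElementary.ncard_unsatisfied_add [Finite R] {d : ℕ} (hS : G.IsElementary S)
    (hG : G.IsLinear) (hd : G.LeftRegular d) :
    (G.unsatisfied S).ncard + 2 * (G.normalGraph S).edgeSet.ncard = d * S.ncard := by
  have := Fintype.ofFinite S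
  rw [hS.ncard_unsatisfied, ← sum_ncard_neighborSet, ← Finset.sum_add_distrib,
    Finset.sum_congr rfl fun v _ => by
      rw [← hS.ncard_satisfied_self hG v, ncard_unsatisfied_add_ncard_satisfied hd v.2]]
  rw [Finset.sum_const, Finset.card_univ, smul_eq_mul, mul_comm, ← Nat.card_eq_fintype_card,
    Nat.card_coe_set_eq]

/-- With six checks at each node, a satisfied majority means at least four satisfied checks. -/
theorem IsElementary.isAbsorbing_iff [Finite R] (hS : G.IsElementary S) (hG : G.IsLinear)
    (hd : G.LeftRegular 6) : G.IsAbsorbing S ↔ DegreesIn 4 6 (G.normalGraph S) := by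
  constructor
  · intro h v
    have h1 := h v v.2
    have h2 := ncard_unsatisfied_add_ncard_satisfied hd v.2
    rw [hS.ncard_satisfied_self hG] at h1 h2
    omega
  · intro h v hv
    have h1 := (h ⟨v, hv⟩).1
    have h2 := ncard_unsatisfied_add_ncard_satisfied hd hv
    rw [← hS.ncard_satisfied_self hG ⟨v, hv⟩] at h1
    dsimp only at h1
    omega

theorem IsElementary.degreesIn [Finite R] (hS : G.IsElementary S) (hG : G.IsLinear)
    (hd : G.LeftRegular 6) (h : ∀ v ∈ S, 2 ≤ {c | G.Adj v c ∧ c ∈ G.satisfied S}.ncard) :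
    DegreesIn 2 6 (G.normalGraph S) := by
  intro v
  have h1 := h v v.2
  have h2 := ncard_unsatisfied_add_ncard_satisfied hd v.2
  rw [hS.ncard_satisfied_self hG] at h1 h2
  omega

end Finite

/-- A variable node as a node of the induced subgraph. -/
def variableNode (G : TannerGraph L R) (v : S) : G.inducedNodes S :=
  ⟨Sum.inl v, Or.inl ⟨v, v.2, rfl⟩⟩

/-- A check node as a node of the induced subgraph. -/
def checkNode (c : G.neighbors S) : G.inducedNodes S :=
  ⟨Sum.inr c, Or.inr ⟨c, c.2, rfl⟩⟩

theorem inducedNodes_cases (x : G.inducedNodes S) :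
    (∃ v : S, x = variableNode G v) ∨ ∃ c : G.neighbors S, x = checkNode c := by
  rcases x with ⟨x, ⟨v, hv, rfl⟩ | ⟨c, hc, rfl⟩⟩
  · exact Or.inl ⟨⟨v, hv⟩, rfl⟩
  · exact Or.inr ⟨⟨c, hc⟩, rfl⟩

theorem variableNode_injective : Function.Injective (variableNode G : S → G.inducedNodes S) :=
  fun _ _ h => Subtype.ext (Sum.inl_injective (Subtype.ext_iff.1 h))

theorem checkNode_injective : Function.Injective (checkNode : G.neighbors S → G.inducedNodes S) :=
  fun _ _ h => Subtype.ext (Sum.inr_injective (Subtype.ext_iff.1 h))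

@[simp]
theorem variableNode_ne_checkNode (v : S) (c : G.neighbors S) : variableNode G v ≠ checkNode c :=
  fun h => Sum.inl_ne_inr (Subtype.ext_iff.1 h)

@[simp]
theorem inducedSubgraph_adj_variableNode_checkNode (v : S) (c : G.neighbors S) :
    (G.inducedSubgraph S).Adj (variableNode G v) (checkNode c) ↔ G.Adj v c :=
  G.graph_adj_inl_inr

@[simp]
theorem not_inducedSubgraph_adj_variableNode (v w : S) :
    ¬ (G.inducedSubgraph S).Adj (variableNode G v) (variableNode G w) :=
  G.not_graph_adj_inl_inl

@[simp]
theorem not_inducedSubgraph_adj_checkNode (c d : G.neighbors S) :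
    ¬ (G.inducedSubgraph S).Adj (checkNode c) (checkNode d) :=
  G.not_graph_adj_inr_inr

/-- This expresses the normal graph through `G(S)` alone, so that isomorphisms of `G(S)` carry over
to it. -/
theorem normalGraph_adj_iff (v w : S) : (G.normalGraph S).Adj v w ↔ v ≠ w ∧
    ∃ x, (G.inducedSubgraph S).Adj (variableNode G v) x ∧
      (G.inducedSubgraph S).Adj (variableNode G w) x := by
  refine and_congr_right fun _ => ⟨?_, ?_⟩
  · rintro ⟨c, h1, h2⟩
    exact ⟨checkNode ⟨c, v, v.2, h1⟩, by simpa using h1, by simpa using h2⟩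
  · rintro ⟨x, h1, h2⟩
    rcases inducedNodes_cases x with ⟨u, rfl⟩ | ⟨c, rfl⟩
    · simp at h1
    · exact ⟨c, by simpa using h1, by simpa using h2⟩

theorem connected_inducedSubgraph (h : (G.normalGraph S).Connected) :
    (G.inducedSubgraph S).Connected := by
  have hv : ∀ v w : S, (G.inducedSubgraph S).Reachable (variableNode G v) (variableNode G w) := by
    intro v w
    obtain ⟨p⟩ := h.preconnected v w
    induction p with
    | nil => rfl
    | cons hadj _ ih =>
      obtain ⟨-, x, h1, h2⟩ := (normalGraph_adj_iff _ _).1 hadj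
      exact (h1.reachable.trans h2.symm.reachable).trans ih
  obtain ⟨v₀⟩ := h.nonempty
  have h0 : ∀ x, (G.inducedSubgraph S).Reachable (variableNode G v₀) x := by
    intro x
    rcases inducedNodes_cases x with ⟨v, rfl⟩ | ⟨c, rfl⟩
    · exact hv v₀ v
    · obtain ⟨v, hvS, hc⟩ := c.2
      exact (hv v₀ ⟨v, hvS⟩).trans
        ((inducedSubgraph_adj_variableNode_checkNode ⟨v, hvS⟩ c).2 hc).reachable
  have : Nonempty (G.inducedNodes S) := ⟨variableNode G v₀⟩
  exact ⟨fun x y => (h0 x).symm.trans (h0 y)⟩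

/-- Passing to the normal graph commutes with restriction to a set of variable nodes. -/
noncomputable def normalGraphInduceIso (G : TannerGraph L R) (A : Set S) :
    (G.normalGraph S).induce A ≃g G.normalGraph (Subtype.val '' A) where
  toEquiv := Equiv.Set.image _ A Subtype.val_injective
  map_rel_iff' := by
    rintro ⟨v, hv⟩ ⟨w, hw⟩
    simp [normalGraph, Subtype.ext_iff]

theorem nonempty_of_connected (h : (G.inducedSubgraph S).Connected) : S.Nonempty := by
  obtain ⟨x⟩ := h.nonempty
  rcases inducedNodes_cases x with ⟨v, rfl⟩ | ⟨c, rfl⟩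
  · exact ⟨v, v.2⟩
  · exact ⟨_, c.2.choose_spec.1⟩

theorem inT_image [Finite L] (hS : G.IsElementary S) (hG : G.IsLinear) {A : Set S}
    (hc : ((G.normalGraph S).induce A).Connected)
    (h2 : ∀ v ∈ A, 2 ≤ ((G.normalGraph S).neighborSet v ∩ A).ncard) :
    G.InT (Subtype.val '' A) := by
  have hsub : Subtype.val '' A ⊆ S := by rintro _ ⟨v, -, rfl⟩; exact v.2
  refine ⟨connected_inducedSubgraph ((normalGraphInduceIso G A).connected_iff.1 hc), ?_⟩
  rintro _ ⟨v, hv, rfl⟩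
  rw [(hS.mono hsub).ncard_satisfied hG hsub ⟨v, hv, rfl⟩,
    Set.preimage_image_eq _ Subtype.val_injective]
  exact h2 v hv

/-- Consecutive vertices of the cycle are joined through their shared checks. What needs proof is
that these checks are distinct. -/
theorem isCycleSet_image [Finite L] (hS : G.IsElementary S) {k : ℕ} {A : Set S}
    (h : (G.normalGraph S).IsCyclicSet k A) : G.IsCycleSet (2 * k) (Subtype.val '' A) := by
  obtain ⟨hk, f, h1, h2, h3, rfl⟩ := h
  have hR : Nonempty R := ⟨(h3 0).2.choose⟩
  have hsh : ∀ v w : S, ∃ c, (G.normalGraph S).Adj v w → G.Adj v c ∧ G.Adj w c := by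
    intro v w
    by_cases h : (G.normalGraph S).Adj v w
    · exact ⟨h.2.choose, fun _ => h.2.choose_spec⟩
    · exact ⟨hR.some, fun h' => absurd h' h⟩
  choose sh hsh using hsh
  have hl := fun i => (hsh _ _ (h3 i)).1
  have hr := fun i => (hsh _ _ (h3 i)).2
  rw [← Set.range_comp]
  refine isCycleSet_of_alternating (g := fun i => sh (f i) (f (i + 1))) (by omega)
    (fun i hi j hj h => h1 i hi j hj (Subtype.ext h)) (fun i hi j hj h => ?_)
    (fun i => by simp [h2]) (fun i => by simp only [add_right_comm i k 1, h2]) hl hr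
  -- A check used at positions `i` and `j` would contain `f i`, `f (i + 1)`, `f j` and `f (j + 1)`,
  -- but it meets only two nodes of `S`. This forces `f (i + 1) = f j`, and then either `f i = f (i
  -- + 2)` or `f j = f (j + 1)`.
  by_contra hij
  have key : ∀ a b : S, G.Adj a (sh (f i) (f (i + 1))) → G.Adj b (sh (f i) (f (i + 1))) →
      f i ≠ a → f i ≠ b → a = b := fun a b ha hb hia hib =>
    Subtype.ext (hS.eq_of_adj (f i).2 a.2 b.2 (hl i) ha hb (fun he => hia (Subtype.ext he))
      (fun he => hib (Subtype.ext he)))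
  have hne : f i ≠ f j := fun h => hij (h1 i hi j hj h)
  have e1 : f (i + 1) = f j := key _ _ (hr i) (h ▸ hl j) (h3 i).1 hne
  by_cases hji : f i = f (j + 1)
  · have h4 := IsCyclicSet.eq_mod h1 h2 (by omega) e1
    have h5 := IsCyclicSet.eq_mod h1 h2 (by omega) hji
    refine IsCyclicSet.ne_add_two h1 h2 hk i (hji.trans ?_)
    have h6 : (i + 2) ≡ (j + 1) [MOD k] := Nat.ModEq.add_right 1 h4
    have hp : Function.Periodic f k := h2
    rw [← hp.map_mod_nat, ← hp.map_mod_nat (i + 2), h6]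
  · exact (h3 j).1 (key _ _ (h ▸ hl j) (h ▸ hr j) hne hji)

theorem isCyclicSet_preimage (hG : G.IsLinear) {x : ℕ} {C : Set L} (h : G.IsCycleSet x C)
    (hC : C ⊆ S) : ∃ k, x = 2 * k ∧ (G.normalGraph S).IsCyclicSet k (Subtype.val ⁻¹' C) := by
  obtain ⟨u, p, hp, rfl, rfl⟩ := h
  obtain ⟨k, f, g, hk, hk2, hf, hg, hf', h1, h2, hs⟩ := exists_alternating_of_isCycle hp
  have hC' : {v | Sum.inl v ∈ p.support} = Set.range f := Set.ext hs
  rw [hC'] at hC ⊢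
  refine ⟨k, hk, hG.three_le hk2 hf hg hf' h1 h2, fun i => ⟨f i, hC ⟨i, rfl⟩⟩,
    fun i hi j hj h => hf i hi j hj (Subtype.ext_iff.1 h), fun i => Subtype.ext (hf' i),
    fun i => ⟨fun h => ?_, g i, h1 i, h2 i⟩, ?_⟩
  · have h3 := IsCyclicSet.eq_mod hf hf' (by omega) (Subtype.ext_iff.1 h)
    have h4 : k ∣ 1 := by simpa using (Nat.modEq_iff_dvd' (by omega)).1 h3
    have := Nat.le_of_dvd (by omega) h4
    omega
  · ext v
    simp [Subtype.ext_iff]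

theorem IsLayeredSuperset.insert {C T : Set L} {v : L} (h : G.IsLayeredSuperset C T) [Finite L]
    (hv : v ∉ T) (hE : G.IsElementary (insert v T)) (hT : G.InT (insert v T)) :
    G.IsLayeredSuperset C (insert v T) := by
  obtain ⟨n, F, h0, hn, hss, hall⟩ := h
  refine ⟨n + 1, fun i => if i ≤ n then F i else Insert.insert v T, by simpa using h0, by simp,
    fun i hi => ?_, fun i hi => ?_⟩
  · rcases (Nat.lt_succ_iff.1 hi).eq_or_lt with rfl | hi
    · simpa [hn] using Set.ssubset_insert hv
    · simpa [hi.le, Nat.succ_le_of_lt hi] using hss i hi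
  · rcases hi.eq_or_lt with rfl | hi
    · have := (hall n le_rfl).2.2
      rw [hn] at this
      simp only [show ¬ n + 1 ≤ n by omega, if_false]
      exact ⟨hE, hT, by rw [Set.ncard_insert_of_notMem hv, this, add_assoc]⟩
    · simpa [Nat.lt_succ_iff.1 hi] using hall i (Nat.lt_succ_iff.1 hi)

end TannerGraph

/-! ### Layered supersets as growth in the normal graph. -/

/-- Each new vertex has two neighbours on arrival, and neighbours are never lost. Every intermediate
set therefore meets the condition of `𝒯` on satisfied checks. -/
theorem SimpleGraph.Grows.two_le_ncard {V : Type*} [Finite V] {H : SimpleGraph V} {C T : Set V}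
    (h : H.Grows C T) (hC : ∀ v ∈ C, 2 ≤ (H.neighborSet v ∩ C).ncard) :
    ∀ v ∈ T, 2 ≤ (H.neighborSet v ∩ T).ncard := by
  induction h with
  | refl => exact hC
  | @step T v _ _ h2 ih =>
    intro w hw
    refine le_trans ?_ (Set.ncard_le_ncard
      (Set.inter_subset_inter_right (H.neighborSet w) (Set.subset_insert v T)))
    rcases hw with rfl | hw
    · exact h2
    · exact ih w hw

namespace TannerGraph

variable {L R : Type*} [Finite L] {G : TannerGraph L R} {S : Set L}

theorem isLayeredSuperset_image (hS : G.IsElementary S) (hG : G.IsLinear) {k : ℕ} {C T : Set S}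
    (hC : (G.normalGraph S).IsCyclicSet k C) (h : (G.normalGraph S).Grows C T) :
    G.IsLayeredSuperset (Subtype.val '' C) (Subtype.val '' T) := by
  have hE : ∀ A : Set S, G.IsElementary (Subtype.val '' A) := fun A =>
    hS.mono (by rintro _ ⟨v, -, rfl⟩; exact v.2)
  have hT : ∀ {A}, (G.normalGraph S).Grows C A → G.InT (Subtype.val '' A) := fun hA =>
    inT_image hS hG (hA.connected hC.connected) (hA.two_le_ncard fun v hv => hC.two_le_ncard hv)
  induction h with
  | refl =>
    exact ⟨0, fun _ => Subtype.val '' C, rfl, rfl, by simp, fun i hi => ⟨hE C, hT .refl, by simp_all⟩⟩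
  | @step T v h hv h2 ih =>
    have hE' := hE (insert v T)
    have hT' := hT (h.step hv h2)
    rw [Set.image_insert_eq] at hE' hT' ⊢
    exact ih.insert (by simpa using hv) hE' hT'

/-- Each layer adds one vertex `v`. Membership of the enlarged set in `𝒯` gives `v` two satisfied
checks, hence two neighbours in the enlarged set, and these already lie in the previous one. -/
theorem grows_preimage (hS : G.IsElementary S) (hG : G.IsLinear) {C : Set L}
    (h : G.IsLayeredSuperset C S) :
    C ⊆ S ∧ (G.normalGraph S).Grows (Subtype.val ⁻¹' C) Set.univ := by
  obtain ⟨n, T, rfl, hn, hss, hall⟩ := h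
  have hsub : ∀ i ≤ n, T i ⊆ S := by
    intro i hi
    induction hi using Nat.decreasingInduction with
    | self => exact hn.subset
    | of_succ j hj ih => exact (hss j hj).subset.trans ih
  refine ⟨hsub 0 (Nat.zero_le n), ?_⟩
  have key : ∀ i ≤ n, (G.normalGraph S).Grows (Subtype.val ⁻¹' T 0) (Subtype.val ⁻¹' T i) := by
    intro i hi
    induction i with
    | zero => exact .refl
    | succ i ih =>
      obtain ⟨v, hv, he⟩ := (Set.exists_eq_insert_iff_ncard).2 ⟨(hss i hi).subset, by
        rw [(hall i (by omega)).2.2, (hall _ hi).2.2, add_assoc]⟩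
      have hvT : v ∈ T (i + 1) := he ▸ Set.mem_insert _ _
      have hvS : v ∈ S := hsub _ hi hvT
      have h2 := (hall _ hi).2.1.2 v hvT
      rw [(hS.mono (hsub _ hi)).ncard_satisfied hG (hsub _ hi) hvT] at h2
      have hpre : (Subtype.val ⁻¹' T (i + 1) : Set S) = insert ⟨v, hvS⟩ (Subtype.val ⁻¹' T i) := by
        ext w
        simp [← he, Subtype.ext_iff]
      rw [hpre] at h2 ⊢
      refine (ih (by omega)).step hv ?_
      rwa [Set.inter_insert_of_notMem (by simp)] at h2
  have := key n le_rfl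
  rwa [hn, Subtype.coe_preimage_self] at this

theorem isLSSOfCycle_iff (hS : G.IsElementary S) (hG : G.IsLinear) (x : ℕ) :
    G.IsLSSOfCycle x S ↔ ∃ k, x = 2 * k ∧ (G.normalGraph S).GrowsFromCycle k := by
  constructor
  · rintro ⟨C, hC, h⟩
    obtain ⟨hCS, hgrow⟩ := grows_preimage hS hG h
    obtain ⟨k, hk, hcyc⟩ := isCyclicSet_preimage hG hC hCS
    exact ⟨k, hk, _, hcyc, hgrow⟩
  · rintro ⟨k, rfl, C, hC, h⟩
    have h' := isLayeredSuperset_image hS hG hC h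
    rw [Set.image_univ, Subtype.range_coe] at h'
    exact ⟨_, isCycleSet_image hS hC, h'⟩

theorem lssType_eq (hS : G.IsElementary S) (hG : G.IsLinear) :
    G.lssType S = (G.normalGraph S).growthType := by
  simp only [lssType, growthType, isLSSOfCycle_iff hS hG]
  refine le_antisymm (le_iInf₂ fun k hk => iInf₂_le (2 * k) ⟨k, rfl, hk⟩) (le_iInf₂ ?_)
  rintro _ ⟨k, rfl, hk⟩
  exact iInf₂_le k hk

end TannerGraph

/-! ### Equal structures mean isomorphic normal graphs. -/

namespace TannerGraph

variable {L R L' R' : Type*} {G : TannerGraph L R} {G' : TannerGraph L' R'} {S : Set L} {S' : Set L'}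

theorem ncard_neighborSet_variableNode (v : S) :
    ((G.inducedSubgraph S).neighborSet (variableNode G v)).ncard = {c | G.Adj v c}.ncard := by
  symm
  refine Set.ncard_congr (fun c hc => checkNode ⟨c, v, v.2, hc⟩) (fun c hc => ?_)
    (fun c d hc hd h => Subtype.ext_iff.1 (checkNode_injective h)) (fun x hx => ?_)
  · simpa using hc
  · rcases inducedNodes_cases x with ⟨w, rfl⟩ | ⟨c, rfl⟩
    · simp at hx
    · exact ⟨c, by simpa using hx, rfl⟩

theorem ncard_neighborSet_checkNode (c : G.neighbors S) :
    ((G.inducedSubgraph S).neighborSet (checkNode c)).ncard = G.checkDegree S c := by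
  symm
  refine Set.ncard_congr (fun v hv => variableNode G ⟨v, hv.1⟩) (fun v hv => ?_)
    (fun v w hv hw h => Subtype.ext_iff.1 (variableNode_injective h)) (fun x hx => ?_)
  · rw [mem_neighborSet, adj_comm]
    simpa using hv.2
  · rw [mem_neighborSet, adj_comm] at hx
    rcases inducedNodes_cases x with ⟨w, rfl⟩ | ⟨d, rfl⟩
    · exact ⟨w, ⟨w.2, by simpa using hx⟩, rfl⟩
    · simp at hx

/-- An isomorphism of structures is not assumed to respect the two sides, but variable nodes have
degree 6 and check nodes have degree at most 2. -/
theorem exists_variableNode_eq (hd : G.LeftRegular 6) (hS' : G'.IsElementary S')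
    (e : G.inducedSubgraph S ≃g G'.inducedSubgraph S') (v : S) :
    ∃ w, e (variableNode G v) = variableNode G' w := by
  rcases inducedNodes_cases (e (variableNode G v)) with h | ⟨c, hc⟩
  · exact h
  · have h1 := e.ncard_neighborSet (variableNode G v)
    rw [hc, ncard_neighborSet_variableNode, ncard_neighborSet_checkNode, hd] at h1
    have := hS'.checkDegree_le c
    omega

theorem nonempty_normalGraph_iso (hd : G.LeftRegular 6) (hd' : G'.LeftRegular 6)
    (hS : G.IsElementary S) (hS' : G'.IsElementary S')
    (e : G.inducedSubgraph S ≃g G'.inducedSubgraph S') :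
    Nonempty (G.normalGraph S ≃g G'.normalGraph S') := by
  choose φ hφ using exists_variableNode_eq hd hS' e
  choose ψ hψ using exists_variableNode_eq hd' hS e.symm
  refine ⟨⟨⟨φ, ψ, fun v => variableNode_injective (G := G) ?_,
    fun v => variableNode_injective (G := G') ?_⟩, fun {v w} => ?_⟩⟩
  · rw [← hψ, ← hφ, RelIso.symm_apply_apply]
  · rw [← hφ, ← hψ, RelIso.apply_symm_apply]
  · have hinj : Function.Injective φ := fun a b h => variableNode_injective (G := G)
      (e.injective (by rw [hφ, hφ, h]))
    change (G'.normalGraph S').Adj (φ v) (φ w) ↔ _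
    rw [normalGraph_adj_iff, normalGraph_adj_iff, hinj.ne_iff, ← hφ, ← hφ]
    refine and_congr_right fun _ => ⟨?_, ?_⟩
    · rintro ⟨x, h1, h2⟩
      obtain ⟨x, rfl⟩ := e.surjective x
      exact ⟨x, e.map_adj_iff.1 h1, e.map_adj_iff.1 h2⟩
    · rintro ⟨x, h1, h2⟩
      exact ⟨e x, e.map_adj_iff.2 h1, e.map_adj_iff.2 h2⟩

/-- The variable nodes in `S` that are joined to a check node. -/
def variablesAt (c : G.neighbors S) : Set S := {v | G.Adj v c}

theorem ncard_variablesAt (c : G.neighbors S) :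
    (variablesAt c).ncard = G.checkDegree S c := by
  rw [checkDegree, ← Set.ncard_image_of_injective _ Subtype.val_injective]
  congr 1
  ext v
  simp [variablesAt, and_comm]

theorem ncard_variablesAt_eq_singleton [Finite L] (hS : G.IsElementary S) (v : S) :
    {c : G.neighbors S | variablesAt c = {v}}.ncard =
      {c | G.Adj v c ∧ c ∈ G.unsatisfied S}.ncard := by
  refine Set.ncard_congr (fun c _ => c.1) (fun c hc => ?_) (fun c d _ _ h => Subtype.ext h)
    (fun c hc => ⟨⟨c, hc.2.1⟩, ?_, rfl⟩)
  · have h1 : v ∈ variablesAt c := (show variablesAt c = {v} from hc) ▸ Set.mem_singleton v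
    refine ⟨h1, c.2, ?_⟩
    rw [← ncard_variablesAt, show variablesAt c = {v} from hc, Set.ncard_singleton]
    exact odd_one
  · have h2 : G.checkDegree S c = 1 := by
      rcases hS c hc.2.1 with h | h
      · exact h
      · exact absurd (h ▸ hc.2.2) (by decide)
    obtain ⟨u, hu⟩ := Set.ncard_eq_one.1
      ((ncard_variablesAt (G := G) (S := S) ⟨c, hc.2.1⟩).trans h2)
    have hv : v ∈ variablesAt (G := G) (S := S) ⟨c, hc.2.1⟩ := hc.1
    rw [hu, Set.mem_singleton_iff] at hv
    rw [Set.mem_ofPred_eq, hu, hv]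

theorem ncard_variablesAt_eq_pair [Finite L] (hS : G.IsElementary S) (hG : G.IsLinear) {v w : S}
    (hvw : v ≠ w) [Decidable ((G.normalGraph S).Adj v w)] :
    {c : G.neighbors S | variablesAt c = {v, w}}.ncard =
      if (G.normalGraph S).Adj v w then 1 else 0 := by
  have hmem : ∀ c : G.neighbors S, variablesAt c = {v, w} → G.Adj v c ∧ G.Adj w c := fun c hc =>
    ⟨show v ∈ variablesAt c by simp [hc], show w ∈ variablesAt c by simp [hc]⟩
  split_ifs with h
  · obtain ⟨-, c, h1, h2⟩ := h
    rw [Set.ncard_eq_one]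
    refine ⟨⟨c, v, v.2, h1⟩, Set.eq_singleton_iff_unique_mem.2 ⟨?_, fun d hd => ?_⟩⟩
    · ext u
      constructor
      · intro hu
        by_contra hne
        rw [Set.mem_insert_iff, Set.mem_singleton_iff, not_or] at hne
        exact hvw (Subtype.ext (hS.eq_of_adj u.2 v.2 w.2 hu h1 h2
          (fun he => hne.1 (Subtype.ext he)) (fun he => hne.2 (Subtype.ext he))))
      · rintro (rfl | rfl)
        exacts [h1, h2]
    · obtain ⟨h3, h4⟩ := hmem d hd
      exact Subtype.ext (hG (fun he => hvw (Subtype.ext he)) h3 h4 h1 h2)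
  · have : {c : G.neighbors S | variablesAt c = {v, w}} = ∅ := by
      ext c
      simp only [Set.mem_ofPred_eq, Set.mem_empty_iff_false, iff_false]
      exact fun hc => h ⟨hvw, c, hmem c hc⟩
    rw [this, Set.ncard_empty]

/-- The nodes of the induced subgraph are the variable nodes in `S` and their neighbours. -/
noncomputable def nodeEquiv (G : TannerGraph L R) (S : Set L) :
    S ⊕ G.neighbors S ≃ G.inducedNodes S :=
  Equiv.ofBijective (Sum.elim (variableNode G) checkNode) <| by
    constructor
    · rintro (v | c) (w | d) h
      · exact congrArg _ (variableNode_injective h)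
      · exact absurd h (variableNode_ne_checkNode v d)
      · exact absurd h.symm (variableNode_ne_checkNode w c)
      · exact congrArg _ (checkNode_injective h)
    · intro x
      rcases inducedNodes_cases x with ⟨v, rfl⟩ | ⟨c, rfl⟩
      · exact ⟨Sum.inl v, rfl⟩
      · exact ⟨Sum.inr c, rfl⟩

/-- A check node is known up to isomorphism from its set of variable nodes. It suffices to match the
checks with a given such set, and these agree in number. -/
theorem nonempty_inducedSubgraph_iso [Finite L] [Finite R] [Finite L'] [Finite R']
    (hd : G.LeftRegular 6) (hd' : G'.LeftRegular 6) (hS : G.IsElementary S)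
    (hS' : G'.IsElementary S') (hG : G.IsLinear) (hG' : G'.IsLinear)
    (e : G.normalGraph S ≃g G'.normalGraph S') :
    Nonempty (G.inducedSubgraph S ≃g G'.inducedSubgraph S') := by
  classical
  have hunsat : ∀ v : S, {c | G.Adj v c ∧ c ∈ G.unsatisfied S}.ncard =
      {c | G'.Adj (e v) c ∧ c ∈ G'.unsatisfied S'}.ncard := by
    intro v
    have h1 := ncard_unsatisfied_add_ncard_satisfied hd v.2
    have h2 := ncard_unsatisfied_add_ncard_satisfied hd' (e v).2
    rw [hS.ncard_satisfied_self hG] at h1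
    rw [hS'.ncard_satisfied_self hG', e.ncard_neighborSet] at h2
    omega
  -- A singleton belongs to `6 - d` checks, where `d` is the degree in the normal graph. A pair
  -- belongs to one check if it is an edge and to none otherwise, and no other set occurs.
  have hfib : ∀ A : Set S', {c : G.neighbors S | e '' variablesAt c = A}.ncard =
      {c : G'.neighbors S' | variablesAt c = A}.ncard := by
    intro A
    obtain ⟨A, rfl⟩ : ∃ B, A = e '' B := ⟨e ⁻¹' A, (Set.image_preimage_eq _ e.surjective).symm⟩
    simp only [Set.image_eq_image e.injective]
    by_cases h1 : A.ncard = 1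
    · obtain ⟨v, rfl⟩ := Set.ncard_eq_one.1 h1
      rw [Set.image_singleton, ncard_variablesAt_eq_singleton hS,
        ncard_variablesAt_eq_singleton hS', hunsat]
    by_cases h2 : A.ncard = 2
    · obtain ⟨v, w, hvw, rfl⟩ := Set.ncard_eq_two.1 h2
      rw [Set.image_pair, ncard_variablesAt_eq_pair hS hG hvw,
        ncard_variablesAt_eq_pair hS' hG' (e.injective.ne hvw)]
      simp only [e.map_adj_iff]
    · have h3 : {c : G.neighbors S | variablesAt c = A} = ∅ := by
        ext c
        simp only [Set.mem_ofPred_eq, Set.mem_empty_iff_false, iff_false]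
        rintro rfl
        rcases hS c c.2 with h | h <;> rw [← ncard_variablesAt] at h <;> contradiction
      have h4 : {c : G'.neighbors S' | variablesAt c = e '' A} = ∅ := by
        ext c
        simp only [Set.mem_ofPred_eq, Set.mem_empty_iff_false, iff_false]
        intro h
        rcases hS' c c.2 with h' | h' <;>
          rw [← ncard_variablesAt, h, Set.ncard_image_of_injective _ e.injective] at h' <;>
          contradiction
      rw [h3, h4, Set.ncard_empty, Set.ncard_empty]
  let κ : G.neighbors S ≃ G'.neighbors S' := Equiv.ofFiberEquiv
    (f := fun c => e '' variablesAt c) (g := variablesAt) fun A =>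
      (Finite.card_eq.1 (hfib A)).some
  have hκ : ∀ (v : S) c, G'.Adj (e v) (κ c) ↔ G.Adj v c := by
    intro v c
    have h : variablesAt (κ c) = e '' variablesAt c := Equiv.ofFiberEquiv_map _ c
    have h' : e v ∈ variablesAt (κ c) ↔ v ∈ variablesAt c := by
      rw [h, e.injective.mem_set_image]
    exact h'
  refine ⟨⟨(nodeEquiv G S).symm.trans ((Equiv.sumCongr e.toEquiv κ).trans (nodeEquiv G' S')), ?_⟩⟩
  intro x y
  obtain ⟨x, rfl⟩ := (nodeEquiv G S).surjective x
  obtain ⟨y, rfl⟩ := (nodeEquiv G S).surjective y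
  simp only [Equiv.trans_apply, Equiv.symm_apply_apply]
  rcases x with v | c <;> rcases y with w | d
  · exact iff_of_false (not_inducedSubgraph_adj_variableNode _ _)
      (not_inducedSubgraph_adj_variableNode _ _)
  · exact (inducedSubgraph_adj_variableNode_checkNode _ _).trans
      ((hκ v d).trans (inducedSubgraph_adj_variableNode_checkNode _ _).symm)
  · rw [adj_comm, adj_comm (G.inducedSubgraph S)]
    exact (inducedSubgraph_adj_variableNode_checkNode _ _).trans
      ((hκ w c).trans (inducedSubgraph_adj_variableNode_checkNode _ _).symm)
  · exact iff_of_false (not_inducedSubgraph_adj_checkNode _ _)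
      (not_inducedSubgraph_adj_checkNode _ _)

end TannerGraph

/-! ### Realisation of graphs by trapping sets, and the conditions on `a`. -/

namespace TannerGraph

/-- The Tanner graph with variable nodes `V` that has a check node for each edge of `H`, and
further check nodes of degree one, such that each variable node has degree `6`. -/
def ofGraph {V : Type*} (H : SimpleGraph V) :
    TannerGraph V (H.edgeSet ⊕ Σ v : V, Fin (6 - (H.neighborSet v).ncard)) where
  Adj v c := Sum.elim (fun e => v ∈ e.1) (fun p => p.1 = v) c

section

variable {V : Type*} {H : SimpleGraph V}

@[simp]
theorem ofGraph_adj_inl (v : V) (e : H.edgeSet) : (ofGraph H).Adj v (Sum.inl e) ↔ v ∈ e.1 :=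
  Iff.rfl

@[simp]
theorem ofGraph_adj_inr (v : V) (p : Σ v : V, Fin (6 - (H.neighborSet v).ncard)) :
    (ofGraph H).Adj v (Sum.inr p) ↔ p.1 = v :=
  Iff.rfl

theorem exists_ofGraph_adj_iff {v w : V} (hvw : v ≠ w) :
    (∃ c, (ofGraph H).Adj v c ∧ (ofGraph H).Adj w c) ↔ H.Adj v w := by
  constructor
  · rintro ⟨⟨e, he⟩ | p, h1, h2⟩
    · rw [ofGraph_adj_inl] at h1 h2
      obtain rfl := (Sym2.mem_and_mem_iff hvw).1 ⟨h1, h2⟩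
      exact he
    · exact absurd (Eq.trans (Eq.symm h1) h2) hvw
  · intro h
    exact ⟨Sum.inl ⟨s(v, w), h⟩, Sym2.mem_mk_left v w, Sym2.mem_mk_right v w⟩

theorem ofGraph_isLinear : (ofGraph H).IsLinear := by
  rintro v w (⟨e, he⟩ | p) (⟨e', he'⟩ | p') hvw h1 h2 h3 h4
  · rw [ofGraph_adj_inl] at h1 h2 h3 h4
    exact congrArg _ (Subtype.ext (((Sym2.mem_and_mem_iff hvw).1 ⟨h1, h2⟩).trans
      ((Sym2.mem_and_mem_iff hvw).1 ⟨h3, h4⟩).symm))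
  · exact absurd (Eq.trans (Eq.symm h3) h4) hvw
  · exact absurd (Eq.trans (Eq.symm h1) h2) hvw
  · exact absurd (Eq.trans (Eq.symm h1) h2) hvw

theorem ofGraph_isElementary : (ofGraph H).IsElementary Set.univ := by
  rintro (⟨⟨v, w⟩, he⟩ | p) -
  · right
    have : {u | u ∈ Set.univ ∧ (ofGraph H).Adj u (Sum.inl ⟨s(v, w), he⟩)} = {v, w} := by
      ext u
      simp
    exact (congrArg _ this).trans (Set.ncard_pair (H.ne_of_adj he))
  · left
    have : {u | u ∈ Set.univ ∧ (ofGraph H).Adj u (Sum.inr p)} = {p.1} := by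
      ext u
      simp [eq_comm]
    exact (congrArg _ this).trans (Set.ncard_singleton _)

theorem ofGraph_leftRegular [Finite V] (hd : ∀ v, (H.neighborSet v).ncard ≤ 6) :
    (ofGraph H).LeftRegular 6 := by
  classical
  intro v
  have h1 : {c | (ofGraph H).Adj v c} =
      Sum.inl '' {e : H.edgeSet | v ∈ e.1} ∪ Sum.inr '' Set.range (Sigma.mk v) := by
    ext c
    rcases c with e | ⟨w, i⟩
    · simp
    · simp only [Set.mem_ofPred_eq, ofGraph_adj_inr, Set.mem_union, Set.mem_image, reduceCtorEq,
        and_false, exists_false, false_or, Set.exists_range_iff, Sum.inr.injEq]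
      constructor
      · rintro rfl
        exact ⟨i, rfl⟩
      · rintro ⟨j, h⟩
        exact (Sigma.mk.inj h).1.symm
  have h2 : {e : H.edgeSet | v ∈ e.1}.ncard = (H.neighborSet v).ncard := by
    rw [← Set.ncard_image_of_injective _ Subtype.val_injective,
      show Subtype.val '' {e : H.edgeSet | v ∈ e.1} = H.incidenceSet v by
        ext e; simp [incidenceSet, and_comm]]
    exact Nat.card_congr (H.incidenceSetEquivNeighborSet v)
  rw [h1, Set.ncard_union_eq, Set.ncard_image_of_injective _ Sum.inl_injective,
    Set.ncard_image_of_injective _ Sum.inr_injective, h2, ← Set.image_univ,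
    Set.ncard_image_of_injective _ sigma_mk_injective, Set.ncard_univ, Nat.card_fin]
  · have := hd v
    omega
  · rw [Set.disjoint_left]
    rintro _ ⟨e, -, rfl⟩ ⟨p, -, h⟩
    simp at h

/-- The normal graph of `ofGraph H` is `H`. -/
def normalGraphOfGraphIso (H : SimpleGraph V) : (ofGraph H).normalGraph Set.univ ≃g H where
  toEquiv := Equiv.Set.univ V
  map_rel_iff' := by
    intro v w
    change H.Adj v w ↔ _ ∧ _
    constructor
    · intro h
      exact ⟨fun he => h.ne (Subtype.ext_iff.1 he), (exists_ofGraph_adj_iff h.ne).2 h⟩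
    · rintro ⟨hne, h⟩
      exact (exists_ofGraph_adj_iff fun he => hne (Subtype.ext he)).1 h

end

/-- Both properties not built into `ofGraph` follow from the number of edges: a triangle makes the
girth exactly 6, and density makes the graph connected. -/
theorem isETSIn_ofGraph {a b : ℕ} {H : SimpleGraph (Fin a)} (h5 : 5 ≤ a) (h9 : a ≤ 9) (hb : b ≤ 10)
    (hd : DegreesIn 2 6 H) (he : b + 2 * H.edgeSet.ncard = 6 * a) :
    (ofGraph H).IsETSIn 6 6 a b Set.univ := by
  have hreg := ofGraph_leftRegular fun v => (hd v).2
  let e := normalGraphOfGraphIso H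
  have : NeZero a := ⟨by omega⟩
  obtain ⟨C, hC⟩ := exists_isCyclicSet_three (H := H) (by
    rw [Fintype.card_fin]
    interval_cases a <;> omega)
  refine ⟨hreg, girth_eq_six ofGraph_isLinear (isCycleSet_image ofGraph_isElementary (hC.map e.symm)),
    ⟨by simp, ?_⟩, ofGraph_isElementary, connected_inducedSubgraph (e.connected_iff.2
      (connected_of_dense (by simpa using h9) hd (by rw [Fintype.card_fin]; omega))),
    fun v hv => ?_⟩
  · have := ofGraph_isElementary.ncard_unsatisfied_add ofGraph_isLinear hreg
    rw [← e.ncard_edgeSet, Set.ncard_univ, Nat.card_fin] at this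
    omega
  · rw [ofGraph_isElementary.ncard_satisfied_self ofGraph_isLinear ⟨v, hv⟩, ← e.ncard_neighborSet]
    exact (hd _).1

variable {L R : Type*} {G : TannerGraph L R} {S : Set L} {a b : ℕ}

theorem IsETSIn.isLinear (h : G.IsETSIn 6 6 a b S) : G.IsLinear :=
  isLinear_of_girth_eq_six h.2.1

variable [Finite L] [Finite R]

theorem IsETSIn.degreesIn (h : G.IsETSIn 6 6 a b S) : DegreesIn 2 6 (G.normalGraph S) :=
  h.2.2.2.1.degreesIn h.isLinear h.1 h.2.2.2.2.2

theorem IsETSIn.add_ncard_edgeSet (h : G.IsETSIn 6 6 a b S) :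
    b + 2 * (G.normalGraph S).edgeSet.ncard = 6 * a := by
  have := h.2.2.2.1.ncard_unsatisfied_add h.isLinear h.1
  rwa [h.2.2.1.1, h.2.2.1.2] at this

/-- Degrees of at least 2 require three vertices. For `a = 3` or `4` the complete graph has too few
edges for `b ≤ 10`. -/
theorem IsETSIn.five_le (h : G.IsETSIn 6 6 a b S) (hb : b ≤ 10) : 5 ≤ a := by
  have := Fintype.ofFinite S
  have hcard : Fintype.card S = a := by
    rw [← Nat.card_eq_fintype_card, Nat.card_coe_set_eq, h.2.2.1.1]
  obtain ⟨v, hv⟩ := nonempty_of_connected h.2.2.2.2.1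
  have hlt : ∀ v : S, ((G.normalGraph S).neighborSet v).ncard < a := by
    intro v
    classical
    rw [ncard_neighborSet_eq_degree, ← hcard]
    exact SimpleGraph.degree_lt_card_verts v
  have h2 := (h.degreesIn ⟨v, hv⟩).1
  have h3 := hlt ⟨v, hv⟩
  have he := h.add_ncard_edgeSet
  have hs : 2 * (G.normalGraph S).edgeSet.ncard ≤ a * (a - 1) := by
    rw [← sum_ncard_neighborSet]
    refine (Finset.sum_le_card_nsmul _ _ (a - 1) fun v _ => Nat.le_sub_one_of_lt (hlt v)).trans ?_
    rw [Finset.card_univ, hcard, smul_eq_mul]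
  by_contra h5
  interval_cases a <;> omega

theorem IsETSIn.isLSSOfCycle_six (h : G.IsETSIn 6 6 a b S) (ha : a ≤ 9) (hb : b ≤ 10)
    (hA : G.IsAbsorbing S) : G.IsLSSOfCycle 6 S := by
  have := Fintype.ofFinite S
  have hcard : Fintype.card S = a := by
    rw [← Nat.card_eq_fintype_card, Nat.card_coe_set_eq, h.2.2.1.1]
  have he := h.add_ncard_edgeSet
  have h5 := h.five_le hb
  exact (isLSSOfCycle_iff h.2.2.2.1 h.isLinear 6).2 ⟨3, rfl, growsFromCycle_three_of_four_le_degree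
    (by omega) (by omega) ((h.2.2.2.1.isAbsorbing_iff h.isLinear h.1).1 hA) (by omega)⟩

end TannerGraph

/-! ### From structures of trapping sets to isomorphism classes of graphs. -/

/-- If the structures with the property `P` correspond to the isomorphism classes of the graphs on
`Fin n` with the property `p`, by way of normal graphs, then they are equal in number. -/
theorem structureCount_eq_encard {n : ℕ} {P : MarkedTannerGraph → Prop}
    {p : SimpleGraph (Fin n) → Prop}
    (hto : ∀ X, P X → ∃ H, p H ∧ Nonempty (X.G.normalGraph X.S ≃g H))
    (hof : ∀ H, p H → ∃ X, P X ∧ Nonempty (X.G.normalGraph X.S ≃g H))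
    (hiso : ∀ X Y, P X → P Y →
      (X ≈ Y ↔ Nonempty (X.G.normalGraph X.S ≃g Y.G.normalGraph Y.S))) :
    structureCount P = (isoClasses p).encard := by
  choose! F hF hFp using hto
  have h1 : isoClasses p = (fun X => Quotient.mk (graphSetoid (Fin n)) (F X)) '' {X | P X} := by
    ext q
    constructor
    · rintro ⟨H, hH, rfl⟩
      obtain ⟨X, hX, ⟨e⟩⟩ := hof H hH
      obtain ⟨e'⟩ := hFp X hX
      exact ⟨X, hX, Quotient.sound ⟨e.comp e'.symm⟩⟩
    · rintro ⟨X, hX, rfl⟩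
      exact ⟨F X, hF X hX, rfl⟩
  have h2 : ∀ X Y, P X → P Y → ((Quotient.mk (graphSetoid (Fin n)) (F X) =
      Quotient.mk (graphSetoid (Fin n)) (F Y)) ↔
        Quotient.mk structureSetoid X = Quotient.mk structureSetoid Y) := by
    intro X Y hX hY
    rw [Quotient.eq, Quotient.eq]
    refine Iff.trans ?_ (hiso X Y hX hY).symm
    obtain ⟨e⟩ := hFp X hX
    obtain ⟨e'⟩ := hFp Y hY
    exact ⟨fun ⟨f⟩ => ⟨(e'.symm.comp f).comp e⟩, fun ⟨f⟩ => ⟨(e'.comp f).comp e.symm⟩⟩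
  rw [structureCount, h1]
  have : Nonempty MarkedTannerGraph :=
    ⟨⟨Empty, Empty, inferInstance, inferInstance, ⟨fun _ _ => False⟩, ∅⟩⟩
  -- A representative is chosen in each structure. The induced map from structures to isomorphism
  -- classes is injective by `h2` and has the image `isoClasses p`.
  choose! r hr hrq using fun (q : Quotient structureSetoid)
    (hq : q ∈ (fun X => Quotient.mk structureSetoid X) '' {X | P X}) => hq
  have h3 : (fun X => Quotient.mk (graphSetoid (Fin n)) (F X)) '' {X | P X} =
      (fun q => Quotient.mk (graphSetoid (Fin n)) (F (r q))) ''
        ((fun X => Quotient.mk structureSetoid X) '' {X | P X}) := by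
    rw [Set.image_image]
    refine Set.image_congr fun X hX => ?_
    have hq : Quotient.mk structureSetoid X ∈ (fun X => Quotient.mk structureSetoid X) '' {X | P X} :=
      ⟨X, hX, rfl⟩
    exact (h2 X _ hX (hr _ hq)).2 (hrq _ hq).symm
  rw [h3]
  refine (Set.InjOn.encard_image ?_).symm
  intro q hq q' hq' h
  rw [← hrq q hq, ← hrq q' hq']
  exact (h2 _ _ (hr q hq) (hr q' hq')).1 h

theorem structureCount_eq_zero {P : MarkedTannerGraph → Prop} (h : ∀ X, ¬ P X) :
    structureCount P = 0 := by
  have : {X | P X} = ∅ := Set.eq_empty_of_forall_notMem h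
  simp [structureCount, this]

theorem structureCount_congr {P Q : MarkedTannerGraph → Prop} (h : ∀ X, P X ↔ Q X) :
    structureCount P = structureCount Q := by
  rw [show P = Q from funext fun X => propext (h X)]

namespace MarkedTannerGraph

open TannerGraph

attribute [local instance] finite_left finite_right

/-- The structures of elementary trapping sets correspond to isomorphism classes of graphs. -/
theorem structureCount_isETSIn {a b m : ℕ} (h5 : 5 ≤ a) (h9 : a ≤ 9) (hb : b ≤ 10)
    (hm : b + 2 * m = 6 * a) {Q : MarkedTannerGraph → Prop} {q : SimpleGraph (Fin a) → Prop}
    (hq : ∀ H, q H → DegreesIn 2 6 H)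
    (hQ : ∀ X, X.G.IsETSIn 6 6 a b X.S →
      ∀ H, Nonempty (X.G.normalGraph X.S ≃g H) → (Q X ↔ q H)) :
    structureCount (fun X => X.G.IsETSIn 6 6 a b X.S ∧ Q X) =
      (isoClasses fun H => q H ∧ H.edgeSet.ncard = m).encard := by
  refine structureCount_eq_encard ?_ ?_ ?_
  · rintro X ⟨hX, hQX⟩
    have e : X.S ≃ Fin a := Finite.equivFinOfCardEq (by
      rw [Nat.card_coe_set_eq, hX.2.2.1.1])
    let H := (X.G.normalGraph X.S).map e.toEmbedding
    have f : X.G.normalGraph X.S ≃g H := SimpleGraph.Iso.map e _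
    refine ⟨H, ⟨(hQ X hX H ⟨f⟩).1 hQX, ?_⟩, ⟨f⟩⟩
    have := hX.add_ncard_edgeSet
    rw [f.ncard_edgeSet]
    omega
  · rintro H ⟨hqH, hmH⟩
    have hX := isETSIn_ofGraph h5 h9 hb (hq H hqH) (by rw [hmH, hm])
    exact ⟨⟨Fin a, _, inferInstance, inferInstance, ofGraph H, Set.univ⟩,
      ⟨hX, (hQ ⟨Fin a, _, inferInstance, inferInstance, ofGraph H, Set.univ⟩ hX H
        ⟨normalGraphOfGraphIso H⟩).2 hqH⟩, ⟨normalGraphOfGraphIso H⟩⟩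
  · rintro X Y ⟨hX, -⟩ ⟨hY, -⟩
    constructor
    · rintro ⟨e⟩
      exact nonempty_normalGraph_iso hX.1 hY.1 hX.2.2.2.1 hY.2.2.2.1 e
    · rintro ⟨e⟩
      exact nonempty_inducedSubgraph_iso hX.1 hY.1 hX.2.2.2.1 hY.2.2.2.1 hX.isLinear hY.isLinear e

end MarkedTannerGraph

/-! ### Comparison with the tables and the main theorem. -/

theorem listedCount_nil (x : ℕ∞) : listedCount [] x = 0 := rfl

theorem listedCount_cons (y : ℕ∞) (c : ℕ) (t : List (ℕ∞ × ℕ)) (x : ℕ∞) :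
    listedCount ((y, c) :: t) x = if x = y then c else listedCount t x := by
  by_cases h : x = y
  · simp [listedCount, List.lookup, h]
  · simp [listedCount, List.lookup, h, beq_eq_false_iff_ne.2 h]

theorem ncard_growthClasses_two {n i : ℕ} (h5 : 5 ≤ n) (h9 : n ≤ 9) (hi : i ≤ 5) (x : ℕ∞) :
    (growthClasses n 2 (3 * n - 5 + i) x).ncard =
      listedCount (trappingTable n (10 - 2 * i)) x := by
  by_cases hex : n = 9 ∧ i < 2
  · obtain ⟨rfl, hi2⟩ := hex
    interval_cases i
    · exact (ncard_growthClasses_twentytwo x).trans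
        (by simp [exceptionalCount, trappingTable, listedCount_cons, listedCount_nil])
    · exact (ncard_growthClasses_twentythree x).trans
        (by simp [exceptionalCount, trappingTable, listedCount_cons, listedCount_nil])
  · rw [ncard_growthClasses h5 h9 (Or.inl rfl) hi (by omega)]
    interval_cases n <;> interval_cases i <;>
      first
      | exact absurd ⟨rfl, by omega⟩ hex
      | simp [classCounts, trappingTable, listedCount_cons, listedCount_nil]

theorem ncard_growthClasses_four {n i : ℕ} (h5 : 5 ≤ n) (h9 : n ≤ 9) (hi : i ≤ 5) (x : ℕ∞) :
    (growthClasses n 4 (3 * n - 5 + i) x).ncard =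
      listedCount (absorbingTable n (10 - 2 * i)) x := by
  rw [ncard_growthClasses h5 h9 (Or.inr rfl) hi (by omega)]
  interval_cases n <;> interval_cases i <;>
    simp [classCounts, absorbingTable, listedCount_cons, listedCount_nil]

theorem cast_ncard_isoClasses {n : ℕ} (p : SimpleGraph (Fin n) → Prop) :
    (isoClasses p).encard = (isoClasses p).ncard :=
  (Set.Finite.cast_ncard_eq ((Set.toFinite {H | p H}).image _)).symm

theorem degreesIn_congr {lo : ℕ} {V W : Type*} {H : SimpleGraph V} {H' : SimpleGraph W}
    (h : Nonempty (H ≃g H')) : DegreesIn lo 6 H ↔ DegreesIn lo 6 H' := by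
  obtain ⟨e⟩ := h
  exact ⟨fun h => h.iso e, fun h => h.iso e.symm⟩

namespace MarkedTannerGraph

attribute [local instance] finite_left finite_right

open TannerGraph

theorem lssType_eq_iff {a b : ℕ} {X : MarkedTannerGraph} (hX : X.G.IsETSIn 6 6 a b X.S)
    {V : Type*} {H : SimpleGraph V} (h : Nonempty (X.G.normalGraph X.S ≃g H)) (x : ℕ∞) :
    X.G.lssType X.S = x ↔ H.growthType = x := by
  obtain ⟨e⟩ := h
  rw [lssType_eq hX.2.2.2.1 hX.isLinear, growthType_iso e]

theorem structureCount_trapping {a i : ℕ} (h5 : 5 ≤ a) (h9 : a ≤ 9) (hi : i ≤ 5) (x : ℕ∞) :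
    structureCount (fun X => X.G.IsETSIn 6 6 a (10 - 2 * i) X.S ∧ X.G.lssType X.S = x) =
      listedCount (trappingTable a (10 - 2 * i)) x := by
  rw [structureCount_isETSIn (m := 3 * a - 5 + i) h5 h9 (by omega) (by omega)
    (q := fun H => DegreesIn 2 6 H ∧ H.growthType = x) (fun H h => h.1) fun X hX H h => by
      rw [lssType_eq_iff hX h]
      exact (and_iff_right ((degreesIn_congr h).1 hX.degreesIn)).symm,
    cast_ncard_isoClasses, ← ncard_growthClasses_two h5 h9 hi, growthClasses,
    isoClasses_congr fun H => and_right_comm]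

theorem structureCount_absorbing {a i : ℕ} (h5 : 5 ≤ a) (h9 : a ≤ 9) (hi : i ≤ 5) (x : ℕ∞) :
    structureCount (fun X => X.G.IsETSIn 6 6 a (10 - 2 * i) X.S ∧ X.G.IsAbsorbing X.S ∧
      X.G.lssType X.S = x) = listedCount (absorbingTable a (10 - 2 * i)) x := by
  rw [structureCount_isETSIn (m := 3 * a - 5 + i) h5 h9 (by omega) (by omega)
    (q := fun H => DegreesIn 4 6 H ∧ H.growthType = x)
    (fun H h v => ⟨le_trans (by norm_num) (h.1 v).1, (h.1 v).2⟩) fun X hX H h => by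
      rw [lssType_eq_iff hX h, hX.2.2.2.1.isAbsorbing_iff hX.isLinear hX.1, degreesIn_congr h],
    cast_ncard_isoClasses, ← ncard_growthClasses_four h5 h9 hi, growthClasses,
    isoClasses_congr fun H => and_right_comm]

end MarkedTannerGraph

-- The relation `b + 2m = 6a` makes `b` even, so with `a ≥ 5` only the listed shapes of `(a, b)`
-- remain.
open MarkedTannerGraph in
theorem eq_ten_sub_of_isETSIn {a b : ℕ} {X : MarkedTannerGraph} (hb : b ≤ 10)
    (hX : X.G.IsETSIn 6 6 a b X.S) : 5 ≤ a ∧ ∃ i ≤ 5, b = 10 - 2 * i := by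
  have := X.finite_left
  have := X.finite_right
  have := hX.add_ncard_edgeSet
  exact ⟨hX.five_le hb, 5 - b / 2, by omega, by omega⟩

theorem mainTheorem4 :
    (∀ a b : ℕ, a ≤ 9 → b ≤ 10 → ∀ x : ℕ∞,
      structureCount (fun X => X.G.IsETSIn 6 6 a b X.S ∧ X.G.lssType X.S = x) =
          listedCount (trappingTable a b) x ∧
      structureCount (fun X => X.G.IsETSIn 6 6 a b X.S ∧ X.G.IsAbsorbing X.S ∧
          X.G.lssType X.S = x) =
        listedCount (absorbingTable a b) x) ∧
    (∀ (L R : Type*) [Finite L] [Finite R] (G : TannerGraph L R) (S : Set L)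
      (a b : ℕ), a ≤ 9 → b ≤ 10 → G.IsETSIn 6 6 a b S → G.IsAbsorbing S →
        G.IsLSSOfCycle 6 S) ∧
    structureCount (fun X => X.G.IsETSIn 6 6 9 10 X.S) = 5411 ∧
    structureCount (fun X => X.G.IsETSIn 6 6 9 10 X.S ∧ ¬ ∃ x, X.G.IsLSSOfCycle x X.S) = 1 := by
  refine ⟨fun a b ha hb x => ?_, fun L R _ _ G S a b ha hb h hA => h.isLSSOfCycle_six ha hb hA,
    ?_, ?_⟩
  · by_cases hab : 5 ≤ a ∧ ∃ i ≤ 5, b = 10 - 2 * i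
    · obtain ⟨h5, i, hi, rfl⟩ := hab
      exact ⟨MarkedTannerGraph.structureCount_trapping h5 ha hi x,
        MarkedTannerGraph.structureCount_absorbing h5 ha hi x⟩
    · have hab' : a < 5 ∨ b % 2 = 1 := by
        by_contra! h
        exact hab ⟨h.1, 5 - b / 2, by omega, by omega⟩
      have ht : trappingTable a b = [] ∧ absorbingTable a b = [] := by
        interval_cases a <;> interval_cases b <;> first | exact ⟨rfl, rfl⟩ | omega
      rw [ht.1, ht.2, listedCount_nil, Nat.cast_zero]
      exact ⟨structureCount_eq_zero fun X hX => hab (eq_ten_sub_of_isETSIn hb hX.1),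
        structureCount_eq_zero fun X hX => hab (eq_ten_sub_of_isETSIn hb hX.1)⟩
  -- The total is counted with the trivial condition on the trapping set. On the side of graphs only
  -- the degree bounds remain.
  · rw [structureCount_congr (Q := fun X => X.G.IsETSIn 6 6 9 10 X.S ∧ True) (by simp),
      MarkedTannerGraph.structureCount_isETSIn (m := 22) (by norm_num) le_rfl le_rfl (by norm_num)
        (q := fun H => DegreesIn 2 6 H) (fun H h => h) fun X hX H h => by
          have := X.finite_left
          have := X.finite_right
          simpa using (degreesIn_congr h).1 hX.degreesIn,
      cast_ncard_isoClasses]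
    have := ncard_isoClasses_eq_classCounts (n := 9) (lo := 2) (i := 0) (by norm_num) le_rfl
      (Or.inl rfl) (by norm_num)
    simp only [show 3 * 9 - 5 + 0 = 22 from rfl] at this
    rw [this]
    rfl
  · simp only [TannerGraph.not_exists_isLSSOfCycle_iff]
    refine (MarkedTannerGraph.structureCount_trapping (a := 9) (i := 0) (by norm_num) le_rfl
      (by norm_num) ⊤).trans ?_
    simp [trappingTable, listedCount_cons]
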